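/- Let $\mathfrak{gl}_\infty$ be the Lie algebra of doubly infinite complex matrices with finitely many nonzero entries, with basis the matrix units $E_{m,n}$ ($m,n\in\mathbb Z$), and let $H=\mathrm{span}\{E_{n,n} : n\in\mathbb Z\}$. For a finite nonempty $T\subset\mathbb Z$ put $\mathfrak{gl}_T=\mathrm{span}\{E_{m,n} : m,n\in T\}$, and let $P_+(T)$ be the set of $\lambda\in H^*$ such that $\lambda_i:=\lambda(E_{i,i})\in\mathbb N$ for all $i\in\mathbb Z$, $\lambda_i=0$ for $i\notin T$, and $\lambda_i\ge\lambda_j$ for $i<j$ in $T$. For $\lambda\in P_+(T)$ let $L(\lambda_T)$ be the irreducible highest weight $\mathfrak{gl}_T$-module with highest weight $\lambda|_{\mathrm{span}\{E_{n,n}:n\in T\}}$ (the irreducible quotient of the Verma module, with respect to the raising operators $E_{m,n}$, $m<n$ in $T$). Let $L(T,\lambda)$ be the irreducible quotient of the $\mathfrak{gl}_\infty$-module induced from $L(\lambda_T)$, on which all $E_{m,n}$ with $m\in\mathbb Z$, $n\notin T$ are made to act as zero. **Theorem 4.4.** Let $r\le n$ be integers, $S=\{r,r+1,\dots,n\}$,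 and $\lambda,\mu\in P_+(S)$. Then $L(S,\lambda)\otimes L(S,\mu)$ is a cyclic $\mathfrak{gl}_\infty$-module (it is generated by one vector). Furthermore, there is an integer $k\ge n$ such that for every integer $\bar n\ge k$, with $\bar S=\{r,r+1,\dots,\bar n\}$, the decomposition of $L(S,\lambda)\otimes L(S,\mu)$ into irreducible $\mathfrak{gl}_\infty$-modules agrees with the decomposition of $L(\lambda_{\bar S})\otimes L(\mu_{\bar S})$ into irreducible $\mathfrak{gl}_{\bar S}$-modules: there are finitely many weights $\nu^1,\dots,\nu^N\in P_+(\bar S)$ such that $$L(S,\lambda)\otimes L(S,\mu)\simeq\bigoplus_{i=1}^N L(\bar S,\nu^i)\ \text{ over }\mathfrak{gl}_\infty,\qquad L(\lambda_{\bar S})\otimes L(\mu_{\bar S})\simeq\bigoplus_{i=1}^N L(\nu^i_{\bar S})\ \text{ over }\mathfrak{gl}_{\bar S},$$ where all the summands are irreducible; and for every family $(\nu^\alpha)_{\alpha\in I}$ in $P_+(\bar S)$, $L(S,\lambda)\otimes L(S,\mu)\simeq\bigoplus_{\alpha\in I} L(\bar S,\nu^\alpha)$ over $\mathfrak{gl}_\infty$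 if and only if $L(\lambda_{\bar S})\otimes L(\mu_{\bar S})\simeq\bigoplus_{\alpha\in I} L(\nu^\alpha_{\bar S})$ over $\mathfrak{gl}_{\bar S}$. In particular, $L(S,\lambda)\otimes L(S,\mu)$ is a finite direct sum of irreducible $\mathfrak{gl}_\infty$-modules. -/

import Mathlib

open scoped TensorProduct DirectSum

noncomputable section

namespace GlInfty

attribute [local instance] LieRing.ofAssociativeRing LieAlgebra.ofAssociativeAlgebra

/-! ### The Lie algebra of doubly infinite matrices with finitely many nonzero entries

A doubly infinite matrix with finitely many nonzero entries is identified with the operator by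
which it acts on column vectors. -/

/-- The space of doubly infinite column vectors with finitely many nonzero entries. -/
def Vec : Type := ℤ →₀ ℂ

instance : AddCommGroup Vec := inferInstanceAs (AddCommGroup (ℤ →₀ ℂ))
instance : Module ℂ Vec := inferInstanceAs (Module ℂ (ℤ →₀ ℂ))

/-- The matrix unit: it sends the unit vector at `n` to the unit vector at `m`, and it kills the
other unit vectors. -/
def unit (m n : ℤ) : Module.End ℂ Vec :=
  (Finsupp.lsingle m : ℂ →ₗ[ℂ] (ℤ →₀ ℂ)) ∘ₗ (Finsupp.lapply n : (ℤ →₀ ℂ) →ₗ[ℂ] ℂ)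

theorem unit_mul (m n r s : ℤ) :
    unit m n * unit r s = if n = r then unit m s else 0 := by
  refine LinearMap.ext fun v => ?_
  change Finsupp.single m ((Finsupp.single r (Finsupp.toFun v s) : ℤ →₀ ℂ) n) = _
  by_cases h : n = r
  · subst h
    rw [if_pos rfl, Finsupp.single_eq_same]
    rfl
  · rw [if_neg h, Finsupp.single_eq_of_ne h, Finsupp.single_zero]
    rfl

theorem unit_lie (m n r s : ℤ) :
    ⁅unit m n, unit r s⁆ =
      (if n = r then unit m s else 0) - (if m = s then unit r n else 0) := by
  rw [LieRing.of_associative_ring_bracket, unit_mul, unit_mul]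
  simp only [eq_comm (a := s)]

theorem span_lie_mem {L : Type*} [LieRing L] [LieAlgebra ℂ L] {X : Set L}
    (hX : ∀ x ∈ X, ∀ y ∈ X, ⁅x, y⁆ ∈ Submodule.span ℂ X) {a b : L}
    (ha : a ∈ Submodule.span ℂ X) (hb : b ∈ Submodule.span ℂ X) :
    ⁅a, b⁆ ∈ Submodule.span ℂ X := by
  induction ha using Submodule.span_induction with
  | mem x hx =>
    induction hb using Submodule.span_induction with
    | mem y hy => exact hX x hx y hy
    | zero => simp
    | add y z _ _ h1 h2 => rw [lie_add]; exact add_mem h1 h2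
    | smul c y _ h => rw [lie_smul]; exact Submodule.smul_mem _ c h
  | zero => simp
  | add y z _ _ h1 h2 => rw [add_lie]; exact add_mem h1 h2
  | smul c y _ h => rw [smul_lie]; exact Submodule.smul_mem _ c h

/-- The Lie algebra `𝔤𝔩_∞` of doubly infinite complex matrices with finitely many nonzero entries,
under the commutator bracket. -/
def gl : LieSubalgebra ℂ (Module.End ℂ Vec) where
  toSubmodule := Submodule.span ℂ {x | ∃ m n : ℤ, x = unit m n}
  lie_mem' := by
    intro a b ha hb
    refine span_lie_mem ?_ ha hb
    rintro _ ⟨m, n, rfl⟩ _ ⟨r, s, rfl⟩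
    rw [unit_lie]
    refine Submodule.sub_mem _ ?_ ?_ <;> split_ifs
    · exact Submodule.subset_span ⟨_, _, rfl⟩
    · exact zero_mem _
    · exact Submodule.subset_span ⟨_, _, rfl⟩
    · exact zero_mem _

/-- The basis element `E_{m,n}` of `𝔤𝔩_∞`. -/
def E (m n : ℤ) : gl := ⟨unit m n, Submodule.subset_span ⟨m, n, rfl⟩⟩

theorem E_lie (m n r s : ℤ) :
    ⁅E m n, E r s⁆ = (if n = r then E m s else 0) - (if m = s then E r n else 0) := by
  apply Subtype.ext
  have h := unit_lie m n r s
  split_ifs at h ⊢ <;> simpa [E] using h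

/-- The subalgebra `𝔤𝔩_S` of `𝔤𝔩_∞` spanned by the `E_{m,n}` with `m, n ∈ S`. -/
def glS (S : Finset ℤ) : LieSubalgebra ℂ gl where
  toSubmodule := Submodule.span ℂ {x | ∃ m ∈ S, ∃ n ∈ S, x = E m n}
  lie_mem' := by
    intro a b ha hb
    refine span_lie_mem ?_ ha hb
    rintro _ ⟨m, hm, n, hn, rfl⟩ _ ⟨r, hr, s, hs, rfl⟩
    rw [E_lie]
    refine sub_mem ?_ ?_ <;> split_ifs
    · exact Submodule.subset_span ⟨m, hm, s, hs, rfl⟩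
    · exact zero_mem _
    · exact Submodule.subset_span ⟨r, hr, n, hn, rfl⟩
    · exact zero_mem _

/-- `E_{m,n}` as an element of `𝔤𝔩_S`, for `m, n ∈ S`. -/
def ES {S : Finset ℤ} {m n : ℤ} (hm : m ∈ S) (hn : n ∈ S) : glS S :=
  ⟨E m n, Submodule.subset_span ⟨m, hm, n, hn, rfl⟩⟩

/-! ### Weights -/

/-- The Cartan subalgebra `H = span {E_{n,n}}` (as a vector space). -/
def cartan : Submodule ℂ gl := Submodule.span ℂ {x | ∃ n : ℤ, x = E n n}

/-- The dual space `H^*`. -/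
abbrev Weight : Type := Module.Dual ℂ cartan

/-- The value `λ_n = λ(E_{n,n})`. -/
def Weight.val (lam : Weight) (n : ℤ) : ℂ :=
  lam ⟨E n n, Submodule.subset_span ⟨n, rfl⟩⟩

/-- `P_+(S)`: the weights `λ` for which all `λ_i` are in `ℕ`, `λ_i = 0` for `i ∉ S`, and
`λ_i ≥ λ_j` for `i < j` in `S`. -/
def Pplus (S : Finset ℤ) : Set Weight :=
  {lam | ∃ f : ℤ → ℕ, (∀ i, lam.val i = f i) ∧ (∀ i, i ∉ S → f i = 0) ∧
    ∀ i ∈ S, ∀ j ∈ S, i < j → f j ≤ f i}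

/-! ### Modules over the enveloping algebra as Lie modules; irreducible quotients -/

/-- A module over `U(𝔤)` is a `𝔤`-module through `𝔤 → U(𝔤)`. -/
@[reducible] def envLieRingModule (g M : Type*) [LieRing g] [LieAlgebra ℂ g] [AddCommGroup M]
    [Module (UniversalEnvelopingAlgebra ℂ g) M] : LieRingModule g M where
  bracket x m := UniversalEnvelopingAlgebra.ι ℂ x • m
  add_lie x y m := by simp only [map_add, add_smul]
  lie_add x m n := by simp only [smul_add]
  leibniz_lie x y m := by
    rw [LieHom.map_lie, LieRing.of_associative_ring_bracket, sub_smul, mul_smul, mul_smul]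
    abel

theorem envLieModule (g M : Type*) [LieRing g] [LieAlgebra ℂ g] [AddCommGroup M] [Module ℂ M]
    [Module (UniversalEnvelopingAlgebra ℂ g) M]
    [IsScalarTower ℂ (UniversalEnvelopingAlgebra ℂ g) M] :
    letI := envLieRingModule g M
    LieModule ℂ g M := by
  let _ := envLieRingModule g M
  refine ⟨fun t x m => ?_, fun t x m => ?_⟩
  · change UniversalEnvelopingAlgebra.ι ℂ (t • x) • m = t • (UniversalEnvelopingAlgebra.ι ℂ x • m)
    rw [map_smul, smul_assoc]
  · change UniversalEnvelopingAlgebra.ι ℂ x • (t • m) = t • (UniversalEnvelopingAlgebra.ι ℂ x • m)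
    rw [algebra_compatible_smul (UniversalEnvelopingAlgebra ℂ g) t m,
      algebra_compatible_smul (UniversalEnvelopingAlgebra ℂ g) t
        (UniversalEnvelopingAlgebra.ι ℂ x • m), smul_smul, smul_smul, Algebra.commutes]

/-- The sum of all proper submodules. For the modules below this is the unique maximal proper
submodule. -/
def maxSubmodule (g M : Type*) [LieRing g] [LieAlgebra ℂ g] [AddCommGroup M] [Module ℂ M]
    [LieRingModule g M] [LieModule ℂ g M] : LieSubmodule ℂ g M :=
  sSup {N : LieSubmodule ℂ g M | N ≠ ⊤}

/-! ### Highest weight modules of `𝔤𝔩_S` -/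

/-- The left ideal of `U(𝔤𝔩_S)` generated by the `E_{m,n}` with `m < n` in `S` and by the
`E_{n,n} - λ_n` with `n ∈ S`. -/
def vermaIdeal (S : Finset ℤ) (lam : Weight) :
    Submodule (UniversalEnvelopingAlgebra ℂ (glS S)) (UniversalEnvelopingAlgebra ℂ (glS S)) :=
  Submodule.span _
    ({x | ∃ (m n : ℤ) (hm : m ∈ S) (hn : n ∈ S), m < n ∧
        x = UniversalEnvelopingAlgebra.ι ℂ (ES hm hn)} ∪
     {x | ∃ (n : ℤ) (hn : n ∈ S),
        x = UniversalEnvelopingAlgebra.ι ℂ (ES hn hn) - algebraMap ℂ _ (lam.val n)})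

/-- The Verma module `M(λ_S)` of `𝔤𝔩_S`. -/
def Verma (S : Finset ℤ) (lam : Weight) : Type :=
  UniversalEnvelopingAlgebra ℂ (glS S) ⧸ vermaIdeal S lam

instance (S : Finset ℤ) (lam : Weight) : AddCommGroup (Verma S lam) :=
  inferInstanceAs (AddCommGroup (_ ⧸ vermaIdeal S lam))
instance (S : Finset ℤ) (lam : Weight) : Module ℂ (Verma S lam) :=
  inferInstanceAs (Module ℂ (_ ⧸ vermaIdeal S lam))
instance (S : Finset ℤ) (lam : Weight) :
    Module (UniversalEnvelopingAlgebra ℂ (glS S)) (Verma S lam) :=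
  inferInstanceAs (Module _ (_ ⧸ vermaIdeal S lam))
instance (S : Finset ℤ) (lam : Weight) :
    IsScalarTower ℂ (UniversalEnvelopingAlgebra ℂ (glS S)) (Verma S lam) :=
  inferInstanceAs (IsScalarTower ℂ _ (_ ⧸ vermaIdeal S lam))
instance (S : Finset ℤ) (lam : Weight) : LieRingModule (glS S) (Verma S lam) :=
  envLieRingModule _ _
instance (S : Finset ℤ) (lam : Weight) : LieModule ℂ (glS S) (Verma S lam) :=
  envLieModule _ _

/-- The irreducible quotient `L(λ_S)` of the Verma module `M(λ_S)` of `𝔤𝔩_S`. -/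
def LFin (S : Finset ℤ) (lam : Weight) : Type :=
  Verma S lam ⧸ maxSubmodule (glS S) (Verma S lam)

instance (S : Finset ℤ) (lam : Weight) : AddCommGroup (LFin S lam) :=
  inferInstanceAs (AddCommGroup (_ ⧸ maxSubmodule (glS S) (Verma S lam)))
instance (S : Finset ℤ) (lam : Weight) : Module ℂ (LFin S lam) :=
  inferInstanceAs (Module ℂ (_ ⧸ maxSubmodule (glS S) (Verma S lam)))
instance (S : Finset ℤ) (lam : Weight) : LieRingModule (glS S) (LFin S lam) :=
  inferInstanceAs (LieRingModule (glS S) (_ ⧸ maxSubmodule (glS S) (Verma S lam)))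
instance (S : Finset ℤ) (lam : Weight) : LieModule ℂ (glS S) (LFin S lam) :=
  inferInstanceAs (LieModule ℂ (glS S) (_ ⧸ maxSubmodule (glS S) (Verma S lam)))

/-! ### Generalized Verma modules of `𝔤𝔩_∞` -/

section GenVerma

variable (S : Finset ℤ) (V : Type) [AddCommGroup V] [Module ℂ V] [LieRingModule (glS S) V]
  [LieModule ℂ (glS S) V]

/-- The kernel of `U(𝔤𝔩_∞) ⊗_ℂ V → U(𝔤𝔩_∞) ⊗_{U(𝔭)} V`, where
`𝔭 = 𝔤𝔩_S + span {E_{m,n} | n ∉ S}` and the second summand acts on `V` as zero: the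
`U(𝔤𝔩_∞)`-submodule generated by the `a ⊗ v - 1 ⊗ a v` for `a` in `𝔤𝔩_S`, and by the
`E_{m,n} ⊗ v` for `n ∉ S`. -/
def genVermaRel :
    Submodule (UniversalEnvelopingAlgebra ℂ gl) (UniversalEnvelopingAlgebra ℂ gl ⊗[ℂ] V) :=
  Submodule.span _
    ({t | ∃ (a : glS S) (v : V),
        t = UniversalEnvelopingAlgebra.ι ℂ (a : gl) ⊗ₜ[ℂ] v - 1 ⊗ₜ[ℂ] ⁅a, v⁆} ∪
     {t | ∃ (m n : ℤ) (v : V), n ∉ S ∧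
        t = UniversalEnvelopingAlgebra.ι ℂ (E m n) ⊗ₜ[ℂ] v})

/-- The generalized Verma module `M(S, V)` of `𝔤𝔩_∞`, induced from the `𝔤𝔩_S`-module `V`. -/
def GenVerma : Type :=
  (UniversalEnvelopingAlgebra ℂ gl ⊗[ℂ] V) ⧸ genVermaRel S V

instance : AddCommGroup (GenVerma S V) :=
  inferInstanceAs (AddCommGroup (_ ⧸ genVermaRel S V))
instance : Module ℂ (GenVerma S V) :=
  inferInstanceAs (Module ℂ (_ ⧸ genVermaRel S V))
instance : Module (UniversalEnvelopingAlgebra ℂ gl) (GenVerma S V) :=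
  inferInstanceAs (Module _ (_ ⧸ genVermaRel S V))
instance : IsScalarTower ℂ (UniversalEnvelopingAlgebra ℂ gl) (GenVerma S V) :=
  inferInstanceAs (IsScalarTower ℂ _ (_ ⧸ genVermaRel S V))
instance : LieRingModule gl (GenVerma S V) := envLieRingModule _ _
instance : LieModule ℂ gl (GenVerma S V) := envLieModule _ _

end GenVerma

/-- The `𝔤𝔩_∞`-module `L(S, λ)`: the irreducible quotient of the generalized Verma module
`M(S, L(λ_S))`. -/
def LInf (S : Finset ℤ) (lam : Weight) : Type :=
  GenVerma S (LFin S lam) ⧸ maxSubmodule gl (GenVerma S (LFin S lam))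

instance (S : Finset ℤ) (lam : Weight) : AddCommGroup (LInf S lam) :=
  inferInstanceAs (AddCommGroup (_ ⧸ maxSubmodule gl (GenVerma S (LFin S lam))))
instance (S : Finset ℤ) (lam : Weight) : Module ℂ (LInf S lam) :=
  inferInstanceAs (Module ℂ (_ ⧸ maxSubmodule gl (GenVerma S (LFin S lam))))
instance (S : Finset ℤ) (lam : Weight) : LieRingModule gl (LInf S lam) :=
  inferInstanceAs (LieRingModule gl (_ ⧸ maxSubmodule gl (GenVerma S (LFin S lam))))
instance (S : Finset ℤ) (lam : Weight) : LieModule ℂ gl (LInf S lam) :=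
  inferInstanceAs (LieModule ℂ gl (_ ⧸ maxSubmodule gl (GenVerma S (LFin S lam))))

/-! ### Cyclic modules and decompositions -/

/-- A module is cyclic if some single vector generates it. -/
def IsCyclicModule (g M : Type*) [LieRing g] [LieAlgebra ℂ g] [AddCommGroup M] [Module ℂ M]
    [LieRingModule g M] [LieModule ℂ g M] : Prop :=
  ∃ w : M, LieSubmodule.lieSpan ℂ g {w} = ⊤

/-- `L(S, λ) ⊗ L(S, μ)` is isomorphic to the direct sum of the `L(T, ν_i)` over `𝔤𝔩_∞`. -/
def InfDecomp (S T : Finset ℤ) (lam mu : Weight) {I : Type} (nu : I → Weight) : Prop :=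
  Nonempty (LInf S lam ⊗[ℂ] LInf S mu ≃ₗ⁅ℂ, gl⁆ ⨁ i, LInf T (nu i))

/-- `L(λ_T) ⊗ L(μ_T)` is isomorphic to the direct sum of the `L((ν_i)_T)` over `𝔤𝔩_T`. -/
def FinDecomp (T : Finset ℤ) (lam mu : Weight) {I : Type} (nu : I → Weight) : Prop :=
  Nonempty (LFin T lam ⊗[ℂ] LFin T mu ≃ₗ⁅ℂ, glS T⁆ ⨁ i, LFin T (nu i))

end GlInfty

end

noncomputable section

namespace GlInfty

attribute [local instance] LieRing.ofAssociativeRing LieAlgebra.ofAssociativeAlgebra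

set_option linter.unusedSectionVars false

/-! ### Families of matrix units and highest weight theory -/

/-! Everything takes place inside polynomials in variables `x_{i,j}` with `i ∈ ℤ` and finitely many
columns `j`, on which `E_{m,n}` acts as the polarization operator `∑_j x_{m,j} ∂_{n,j}`. The Fock
form is positive definite and makes `E_{m,n}` and `E_{n,m}` adjoint (`fockForm`). A product of
powers of leading principal minors is a highest weight vector of any prescribed dominant weight
(`exists_isHWInf`). Positivity forces a nonzero map from a highest weight module to have the maximal
submodule as its kernel (`IsHighest.ker_eq_maxSubmodule`). Hence `L(S, λ)` embeds into polynomials,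
and so does a tensor product of two such modules, by putting the two sets of columns side by side
(`IsPolynomial.tensor`).

The passage between `𝔤𝔩_∞` and `𝔤𝔩_T` takes a module `M` to the space of its vectors supported in
`T`, those killed by all `E_{m,n}` with `n ∉ T`. For `T = {r, …, n̄}` this space is `L(λ_T)` in
`L(S, λ)` and `L(λ_T) ⊗ L(μ_T)` in the tensor product (`exists_lfin_hom_linf`, `exists_tensor_hom`).
Two facts make the passage faithful. A `𝔤𝔩_T`-stable space of supported vectors generates no further
supported vectors (`mem_of_mem_lieSpan`). If `T` has at least as many elements as the total degree,
the supported vectors generate `M`: a weight that is nonzero somewhere outside `T` must vanish at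
some `t ∈ T`, and the outside weight can be moved to `t` and back (`eq_top_of_supportedIn_le`).
Decompositions therefore correspond (`inf_decomposition_of_fin`, `fin_decomposition_of_inf`), and
one exists because the form gives complete reducibility in finite dimension
(`exists_decomposition`).

For cyclicity, take nonzero vectors `v` and `w` in the two factors, supported in the nonnegative and
in the negative integers. Matrix units inside one half-line act on one factor only, so
irreducibility yields all tensors of vectors with such supports from `v ⊗ w`; moving weights to
fresh indices then yields everything (`isCyclicModule_tensor`). -/

/-- A family of elements of a Lie algebra which spans it and satisfies the relations of the matrix
units. -/
structure IsGlFamily {ι L : Type*} [DecidableEq ι] [LieRing L] [LieAlgebra ℂ L]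
    (e : ι → ι → L) : Prop where
  span_eq : Submodule.span ℂ {x | ∃ m n, x = e m n} = ⊤
  lie_eq : ∀ m n r s,
    ⁅e m n, e r s⁆ = (if n = r then e m s else 0) - (if m = s then e r n else 0)

section Generic

variable {ι L : Type*} [DecidableEq ι] [LieRing L] [LieAlgebra ℂ L] {e : ι → ι → L}
  {M : Type*} [AddCommGroup M] [Module ℂ M] [LieRingModule L M] [LieModule ℂ L M]

theorem IsGlFamily.induction (he : IsGlFamily e) {p : L → Prop} (hz : p 0)
    (hadd : ∀ x y, p x → p y → p (x + y)) (hsmul : ∀ (t : ℂ) x, p x → p (t • x))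
    (hmem : ∀ m n, p (e m n)) (x : L) : p x := by
  have hx : x ∈ Submodule.span ℂ {x | ∃ m n, x = e m n} := he.span_eq ▸ Submodule.mem_top
  induction hx using Submodule.span_induction with
  | mem x h => obtain ⟨m, n, rfl⟩ := h; exact hmem m n
  | zero => exact hz
  | add x y _ _ h1 h2 => exact hadd x y h1 h2
  | smul t x _ h => exact hsmul t x h

theorem IsGlFamily.lie_mem (he : IsGlFamily e) {W : Submodule ℂ M} {w : M}
    (h : ∀ m n, ⁅e m n, w⁆ ∈ W) (x : L) : ⁅x, w⁆ ∈ W := by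
  refine he.induction (p := fun x => ⁅x, w⁆ ∈ W) ?_ ?_ ?_ h x
  · simp
  · intro x y hx hy; rw [add_lie]; exact add_mem hx hy
  · intro t x hx; rw [smul_lie]; exact W.smul_mem t hx

/-- The Lie submodule given by a subspace that is stable under the matrix units. -/
def IsGlFamily.toLieSubmodule (he : IsGlFamily e) (W : Submodule ℂ M)
    (h : ∀ m n, ∀ w ∈ W, ⁅e m n, w⁆ ∈ W) : LieSubmodule ℂ L M where
  toSubmodule := W
  lie_mem {x w} hw := he.lie_mem (fun m n => h m n w hw) x

theorem IsGlFamily.lie_lie_mem (he : IsGlFamily e) {W : Submodule ℂ M} {a b m n : ι} {w : M}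
    (h1 : ∀ m n, ⁅e m n, w⁆ ∈ W) (h2 : ⁅e m n, ⁅e a b, w⁆⁆ ∈ W) :
    ⁅e a b, ⁅e m n, w⁆⁆ ∈ W := by
  rw [leibniz_lie]
  exact add_mem (he.lie_mem h1 _) h2

/-- The submodule generated by a subspace `V` stable under the matrix units of nonnegative
degree is obtained from `V` by applying the matrix units of negative degree. -/
theorem IsGlFamily.lieSpan_le_sup (he : IsGlFamily e) (c : ι → ℤ) {V P : Submodule ℂ M}
    (hV : ∀ m n, c n ≤ c m → ∀ x ∈ V, ⁅e m n, x⁆ ∈ V)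
    (hVP : ∀ m n, c m < c n → ∀ x ∈ V, ⁅e m n, x⁆ ∈ P)
    (hP : ∀ m n, c m < c n → ∀ x ∈ P, ⁅e m n, x⁆ ∈ P) :
    (LieSubmodule.lieSpan ℂ L (V : Set M)).toSubmodule ≤ V ⊔ P := by
  set A : Set (Submodule ℂ M) := {W | V ≤ W ∧ ∀ m n, c m < c n → ∀ x ∈ W, ⁅e m n, x⁆ ∈ W} with hA
  set W := sInf A with hW
  have hVW : V ≤ W := le_sInf fun _ h => h.1
  have hlow : ∀ m n, c m < c n → ∀ x ∈ W, ⁅e m n, x⁆ ∈ W := fun m n hmn x hx =>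
    Submodule.mem_sInf.2 fun U hU => hU.2 m n hmn x (Submodule.mem_sInf.1 hx U hU)
  -- A substitute for the PBW theorem: `W` is the least subspace containing `V` and stable under
  -- lowering, and `Q` collects the vectors of `W` that no matrix unit moves out of `W`. Commuting a
  -- matrix unit past a lowering one shows that `Q` has the two defining properties of `W`, so `Q`
  -- is all of `W`.
  let Q : Submodule ℂ M :=
    { carrier := {w | w ∈ W ∧ ∀ m n, ⁅e m n, w⁆ ∈ W}
      add_mem' := fun {x y} hx hy => ⟨add_mem hx.1 hy.1, fun m n => by
        rw [lie_add]; exact add_mem (hx.2 m n) (hy.2 m n)⟩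
      zero_mem' := ⟨zero_mem _, fun m n => by rw [lie_zero]; exact zero_mem _⟩
      smul_mem' := fun t x hx => ⟨W.smul_mem t hx.1, fun m n => by
        rw [lie_smul]; exact W.smul_mem t (hx.2 m n)⟩ }
  have hQ : Q ∈ A := by
    refine ⟨fun x hx => ⟨hVW hx, fun m n => ?_⟩, fun m n hmn x hx => ⟨hx.2 m n, fun a b => ?_⟩⟩
    · rcases lt_or_ge (c m) (c n) with h | h
      · exact hlow m n h x (hVW hx)
      · exact hVW (hV m n h x hx)
    · rcases lt_or_ge (c a) (c b) with h | h
      · exact hlow a b h _ (hx.2 m n)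
      · exact he.lie_lie_mem hx.2 (hlow m n hmn _ (hx.2 a b))
  have hWQ : W ≤ Q := sInf_le hQ
  have h1 : LieSubmodule.lieSpan ℂ L (V : Set M) ≤
      he.toLieSubmodule W fun m n w hw => (hWQ hw).2 m n :=
    LieSubmodule.lieSpan_le.2 hVW
  refine le_trans (show _ ≤ W from h1) (sInf_le ⟨le_sup_left, fun m n hmn x hx => ?_⟩)
  obtain ⟨y, hy, z, hz, rfl⟩ := Submodule.mem_sup.1 hx
  rw [lie_add]
  exact Submodule.mem_sup_right (add_mem (hVP m n hmn y hy) (hP m n hmn z hz))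

/-- `v` is a highest weight vector with respect to the order of the indices given by `c`; the
element `h` measures the degree, and `v` has degree `a`. -/
structure IsHighest (e : ι → ι → L) (c : ι → ℤ) (h : L) (a : ℂ) (v : M) : Prop where
  degree : ∀ m n, ⁅h, e m n⁆ = ((c m - c n : ℤ) : ℂ) • e m n
  lie_eq : ⁅h, v⁆ = a • v
  raise : ∀ m n, c n ≤ c m → ∃ t : ℂ, ⁅e m n, v⁆ = t • v

/-- The sum of the eigenspaces of `h` with eigenvalues `a - 1, a - 2, …`. -/
def lowerPart (M : Type*) [AddCommGroup M] [Module ℂ M] [LieRingModule L M] [LieModule ℂ L M]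
    (h : L) (a : ℂ) : Submodule ℂ M :=
  ⨆ b : {b : ℂ // b ≠ a}, (LieModule.toEnd ℂ L M h).eigenspace b

theorem mem_lowerPart_of_lie_eq {h : L} {a b : ℂ} {x : M} (hb : b ≠ a) (hx : ⁅h, x⁆ = b • x) :
    x ∈ lowerPart M h a :=
  Submodule.mem_iSup_of_mem (p := fun b : {b : ℂ // b ≠ a} =>
    (LieModule.toEnd ℂ L M h).eigenspace (b : ℂ)) ⟨b, hb⟩ (Module.End.mem_eigenspace_iff.2 hx)

theorem lowerPart_map {M' : Type*} [AddCommGroup M'] [Module ℂ M'] [LieRingModule L M']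
    [LieModule ℂ L M'] (f : M →ₗ⁅ℂ, L⁆ M') {h : L} {a : ℂ} {x : M} (hx : x ∈ lowerPart M h a) :
    f x ∈ lowerPart M' h a := by
  have : lowerPart M h a ≤ (lowerPart M' h a).comap (f : M →ₗ[ℂ] M') := by
    refine iSup_le fun b x hx => ?_
    have hx' : ⁅h, x⁆ = (b : ℂ) • x := Module.End.mem_eigenspace_iff.1 hx
    refine mem_lowerPart_of_lie_eq b.2 ?_
    change ⁅h, f x⁆ = (b : ℂ) • f x
    rw [← LieModuleHom.map_lie, hx', map_smul]
  exact this hx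

theorem lowerPart_disjoint {h : L} {a : ℂ} {x : M} (hx : x ∈ lowerPart M h a)
    (hx' : ⁅h, x⁆ = a • x) : x = 0 := by
  have hd := (Module.End.eigenspaces_iSupIndep (LieModule.toEnd ℂ L M h)) a
  refine Submodule.disjoint_def.1 hd x (Module.End.mem_eigenspace_iff.2 hx') ?_
  refine (iSup_le fun b => ?_ : lowerPart M h a ≤ _) hx
  exact le_iSup₂_of_le (b : ℂ) b.2 le_rfl

/-- The line through `v` is stable in degrees `≥ 0`, and every other matrix unit has degree at most
`-1`, so whatever else is generated has an eigenvalue different from `a`. -/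
theorem IsHighest.lieSpan_le (he : IsGlFamily e) {c : ι → ℤ} {h : L} {a : ℂ} {v : M}
    (hv : IsHighest e c h a v) :
    (LieSubmodule.lieSpan ℂ L {v}).toSubmodule ≤ (ℂ ∙ v) ⊔ lowerPart M h a := by
  -- `lowerPart` admits every eigenvalue other than `a`, and lowering could lead from such an
  -- eigenvalue back to `a`. The smaller sum `P` is stable under lowering.
  let P : Submodule ℂ M := ⨆ k : ℕ, (LieModule.toEnd ℂ L M h).eigenspace (a - (k + 1))
  have key : ∀ m n (b : ℂ) (x : M), ⁅h, x⁆ = b • x →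
      ⁅h, ⁅e m n, x⁆⁆ = (b + ((c m - c n : ℤ) : ℂ)) • ⁅e m n, x⁆ := by
    intro m n b x hx
    rw [leibniz_lie, hv.degree, hx, smul_lie, lie_smul, ← add_smul, add_comm]
  have hP : P ≤ lowerPart M h a := iSup_le fun k x hx => by
    refine mem_lowerPart_of_lie_eq (b := a - (k + 1)) ?_ (Module.End.mem_eigenspace_iff.1 hx)
    intro h0
    have : (k : ℂ) + 1 = 0 := by linear_combination -h0
    exact Nat.cast_add_one_ne_zero k this
  have hmem : ∀ (k : ℕ) (x : M), ⁅h, x⁆ = (a - (k + 1)) • x → x ∈ P := fun k x hx =>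
    Submodule.mem_iSup_of_mem k (Module.End.mem_eigenspace_iff.2 hx)
  have h1 : (LieSubmodule.lieSpan ℂ L ((ℂ ∙ v : Submodule ℂ M) : Set M)).toSubmodule ≤
      (ℂ ∙ v) ⊔ P := by
    refine he.lieSpan_le_sup c ?_ ?_ ?_
    · intro m n hmn x hx
      obtain ⟨t, rfl⟩ := Submodule.mem_span_singleton.1 hx
      obtain ⟨s, hs⟩ := hv.raise m n hmn
      rw [lie_smul, hs]
      exact Submodule.smul_mem _ _ (Submodule.smul_mem _ _ (Submodule.mem_span_singleton_self v))
    · intro m n hmn x hx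
      obtain ⟨t, rfl⟩ := Submodule.mem_span_singleton.1 hx
      rw [lie_smul]
      refine Submodule.smul_mem _ _ ?_
      obtain ⟨k, hk⟩ := Int.eq_ofNat_of_zero_le (show 0 ≤ c n - c m - 1 by omega)
      refine hmem k _ ?_
      rw [key m n a v hv.lie_eq]
      have : c m - c n = -((k : ℤ) + 1) := by omega
      rw [this]; push_cast; congr 1
    · intro m n hmn x hx
      induction hx using Submodule.iSup_induction' with
      | mem k x hx =>
        obtain ⟨j, hj⟩ := Int.eq_ofNat_of_zero_le (show 0 ≤ c n - c m by omega)
        refine hmem (k + j) _ ?_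
        rw [key m n _ x (Module.End.mem_eigenspace_iff.1 hx)]
        have : c m - c n = -(j : ℤ) := by omega
        rw [this]; push_cast; congr 1; ring
      | zero => rw [lie_zero]; exact zero_mem _
      | add x y _ _ h1 h2 => rw [lie_add]; exact add_mem h1 h2
  refine le_trans ?_ (h1.trans (sup_le_sup le_rfl hP))
  exact LieSubmodule.lieSpan_mono (by simp)

theorem IsHighest.map {M' : Type*} [AddCommGroup M'] [Module ℂ M'] [LieRingModule L M']
    [LieModule ℂ L M'] {c : ι → ℤ} {h : L} {a : ℂ} {v : M}
    (hv : IsHighest e c h a v) (f : M →ₗ⁅ℂ, L⁆ M') : IsHighest e c h a (f v) where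
  degree := hv.degree
  lie_eq := by rw [← LieModuleHom.map_lie, hv.lie_eq, map_smul]
  raise m n hmn := by
    obtain ⟨t, ht⟩ := hv.raise m n hmn
    exact ⟨t, by rw [← LieModuleHom.map_lie, ht, map_smul]⟩

/-- If `v + p` lies in a submodule, and `p` has no component of the degree of `v`, then `v` lies
in the submodule. -/
theorem mem_of_add_mem {h : L} {a : ℂ} {v p : M} (hv : ⁅h, v⁆ = a • v) (hp : p ∈ lowerPart M h a)
    (N : LieSubmodule ℂ L M) (hN : v + p ∈ N) : v ∈ N := by
  let π := LieSubmodule.Quotient.mk' N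
  have h1 : π v = -π p := by
    rw [eq_neg_iff_add_eq_zero, ← map_add]
    exact (LieSubmodule.Quotient.mk_eq_zero _).2 hN
  have h2 : π v ∈ lowerPart (M ⧸ N) h a := h1 ▸ neg_mem (lowerPart_map π hp)
  have h3 : π v = 0 := lowerPart_disjoint h2 (by
    rw [← LieModuleHom.map_lie, hv, map_smul])
  exact (LieSubmodule.Quotient.mk_eq_zero _).1 h3

/-- The component in degree `a` of an element of `N` is a multiple of `v` and lies in `N` itself; a
nonzero multiple would put the generator into `N`. -/
theorem IsHighest.le_lowerPart (he : IsGlFamily e) {c : ι → ℤ} {h : L} {a : ℂ} {v : M}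
    (hv : IsHighest e c h a v) (hgen : LieSubmodule.lieSpan ℂ L {v} = ⊤)
    {N : LieSubmodule ℂ L M} (hN : N ≠ ⊤) : N.toSubmodule ≤ lowerPart M h a := by
  intro x hx
  have hx' : x ∈ (ℂ ∙ v) ⊔ lowerPart M h a :=
    hv.lieSpan_le he (hgen ▸ LieSubmodule.mem_top x)
  obtain ⟨y, hy, p, hp, rfl⟩ := Submodule.mem_sup.1 hx'
  obtain ⟨t, rfl⟩ := Submodule.mem_span_singleton.1 hy
  have htv : t • v ∈ N := mem_of_add_mem
    (by rw [lie_smul, hv.lie_eq, smul_comm]) hp N hx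
  by_cases ht : t = 0
  · simpa [ht] using hp
  · refine absurd ?_ hN
    have : v ∈ N := by simpa [ht, smul_smul] using N.smul_mem t⁻¹ htv
    exact top_le_iff.1 (hgen ▸ LieSubmodule.lieSpan_le.2 (by simpa using this))

/-- The bound for a single proper submodule is by one fixed subspace, so it passes to the sum of
them all. -/
theorem IsHighest.maxSubmodule_le (he : IsGlFamily e) {c : ι → ℤ} {h : L} {a : ℂ} {v : M}
    (hv : IsHighest e c h a v) (hgen : LieSubmodule.lieSpan ℂ L {v} = ⊤) :
    (maxSubmodule L M).toSubmodule ≤ lowerPart M h a := by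
  rw [maxSubmodule, LieSubmodule.sSup_toSubmodule]
  refine sSup_le ?_
  rintro _ ⟨N, hN, rfl⟩
  exact hv.le_lowerPart he hgen hN

theorem IsHighest.notMem_maxSubmodule (he : IsGlFamily e) {c : ι → ℤ} {h : L} {a : ℂ} {v : M}
    (hv : IsHighest e c h a v) (hgen : LieSubmodule.lieSpan ℂ L {v} = ⊤) (h0 : v ≠ 0) :
    v ∉ maxSubmodule L M := fun hmem =>
  h0 (lowerPart_disjoint (hv.maxSubmodule_le he hgen hmem) hv.lie_eq)

/-- The preimage of a proper submodule of the quotient is proper, hence already one of the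
submodules being summed. -/
theorem isIrreducible_quotient_maxSubmodule (h : maxSubmodule L M ≠ ⊤) :
    LieModule.IsIrreducible ℂ L (M ⧸ maxSubmodule L M) := by
  have hnt : Nontrivial (M ⧸ maxSubmodule L M) := by
    by_contra hn
    rw [not_nontrivial_iff_subsingleton] at hn
    refine h (eq_top_iff.2 fun x _ => ?_)
    exact (LieSubmodule.Quotient.mk_eq_zero _).1
      (Subsingleton.elim (LieSubmodule.Quotient.mk' (maxSubmodule L M) x) 0)
  refine LieModule.IsIrreducible.mk fun N hN => ?_
  by_contra hT
  refine hN (eq_bot_iff.2 fun x hx => ?_)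
  obtain ⟨y, rfl⟩ := LieSubmodule.Quotient.surjective_mk' _ x
  have h1 : N.comap (LieSubmodule.Quotient.mk' (maxSubmodule L M)) ≤ maxSubmodule L M := by
    refine le_sSup fun hc => hT (eq_top_iff.2 fun z _ => ?_)
    obtain ⟨w, rfl⟩ := LieSubmodule.Quotient.surjective_mk' _ z
    exact (hc ▸ LieSubmodule.mem_top w :
      w ∈ N.comap (LieSubmodule.Quotient.mk' (maxSubmodule L M)))
  exact (LieSubmodule.mem_bot _).2 ((LieSubmodule.Quotient.mk_eq_zero _).2 (h1 hx))

/-- A positive definite Hermitian form for which `e m n` and `e n m` are adjoint. -/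
structure ContraForm (e : ι → ι → L) (M : Type*) [AddCommGroup M] [Module ℂ M]
    [LieRingModule L M] where
  /-- The underlying sesquilinear form. -/
  form : M →ₗ⋆[ℂ] M →ₗ[ℂ] ℂ
  contra : ∀ m n x y, form ⁅e m n, x⁆ y = form x ⁅e n m, y⁆
  pos : ∀ x, x ≠ 0 → 0 < (form x x).re

theorem ContraForm.eq_zero (B : ContraForm e M) {x : M} (h : B.form x x = 0) : x = 0 := by
  by_contra h0
  have := B.pos x h0
  rw [h] at this
  exact lt_irrefl _ this

/-- The restriction of a form along an injective homomorphism. -/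
def ContraForm.comap {M' : Type*} [AddCommGroup M'] [Module ℂ M'] [LieRingModule L M']
    [LieModule ℂ L M'] (B : ContraForm e M') (f : M →ₗ⁅ℂ, L⁆ M') (hf : Function.Injective f) :
    ContraForm e M where
  form := (B.form.comp (f : M →ₗ[ℂ] M')).compl₂ (f : M →ₗ[ℂ] M')
  contra m n x y := by
    change B.form (f ⁅e m n, x⁆) (f y) = B.form (f x) (f ⁅e n m, y⁆)
    rw [LieModuleHom.map_lie, LieModuleHom.map_lie, B.contra]
  pos x hx := B.pos (f x) fun h => hx (hf (h.trans (map_zero f).symm))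

/-- The orthogonal complement of a submodule. -/
def ContraForm.orthogonal (he : IsGlFamily e) (B : ContraForm e M) (N : LieSubmodule ℂ L M) :
    LieSubmodule ℂ L M :=
  he.toLieSubmodule
    { carrier := {y | ∀ x ∈ N, B.form x y = 0}
      add_mem' := fun {y z} hy hz x hx => by rw [map_add, hy x hx, hz x hx, add_zero]
      zero_mem' := fun x _ => map_zero _
      smul_mem' := fun t y hy x hx => by rw [map_smul, hy x hx, smul_zero] }
    fun m n y hy x hx => by rw [← B.contra]; exact hy _ (N.lie_mem hx)

theorem ContraForm.mem_orthogonal (he : IsGlFamily e) (B : ContraForm e M)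
    {N : LieSubmodule ℂ L M} {y : M} : y ∈ B.orthogonal he N ↔ ∀ x ∈ N, B.form x y = 0 := Iff.rfl

/-- A homomorphism from a highest weight module to a module with a contravariant form, if it is
not zero, has the maximal submodule as its kernel. -/
theorem IsHighest.ker_eq_maxSubmodule (he : IsGlFamily e)
    {Q : Type*} [AddCommGroup Q] [Module ℂ Q] [LieRingModule L Q] [LieModule ℂ L Q]
    {c : ι → ℤ} {h : L} {a : ℂ} {q : Q}
    (hq : IsHighest e c h a q) (hgen : LieSubmodule.lieSpan ℂ L {q} = ⊤)
    (B : ContraForm e M) (hself : ∀ x y : M, B.form ⁅h, x⁆ y = B.form x ⁅h, y⁆)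
    (ha : (starRingEnd ℂ) a = a) (f : Q →ₗ⁅ℂ, L⁆ M) (hf : f q ≠ 0) :
    f.ker = maxSubmodule L Q := by
  refine le_antisymm (le_sSup fun hk => hf ?_) ?_
  · exact LieModuleHom.mem_ker.1 (hk ▸ LieSubmodule.mem_top q)
  · intro x hx
    -- The image of the maximal submodule is orthogonal to `f q`, because `h` is self-adjoint and
    -- the eigenvalues differ. By contravariance it is then orthogonal to all of `f Q`, in
    -- particular to itself, and positivity makes it zero.
    have hle : (⊤ : LieSubmodule ℂ L Q) ≤
        (B.orthogonal he ((maxSubmodule L Q).map f)).comap f := by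
      rw [← hgen, LieSubmodule.lieSpan_le, Set.singleton_subset_iff]
      change ∀ y ∈ (maxSubmodule L Q).map f, B.form y (f q) = 0
      intro y hy
      obtain ⟨z, hz, rfl⟩ := (LieSubmodule.mem_map _).1 hy
      have h1 : f z ∈ lowerPart M h a := lowerPart_map f (hq.maxSubmodule_le he hgen hz)
      have h2 : lowerPart M h a ≤ LinearMap.ker (B.form.flip (f q)) := by
        refine iSup_le fun b x hx => ?_
        have hx' : ⁅h, x⁆ = (b : ℂ) • x := Module.End.mem_eigenspace_iff.1 hx
        have h1 := hself x (f q)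
        rw [hx', (hq.map f).lie_eq, LinearMap.map_smulₛₗ, LinearMap.smul_apply, map_smul,
          smul_eq_mul, smul_eq_mul] at h1
        have h2 : ((starRingEnd ℂ) (b : ℂ) - a) * B.form x (f q) = 0 := by
          linear_combination h1
        refine LinearMap.mem_ker.2 ((mul_eq_zero.1 h2).resolve_left (sub_ne_zero.2 fun h3 => ?_))
        exact b.2 (by rw [← Complex.conj_conj (b : ℂ), h3, ha])
      exact LinearMap.mem_ker.1 (h2 h1)
    exact LieModuleHom.mem_ker.2 (B.eq_zero
      (hle (LieSubmodule.mem_top x) (f x) (LieSubmodule.mem_map_of_mem hx)))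

/-- The combination of the diagonal matrix units with coefficients `c`. -/
def degreeElement (e : ι → ι → L) (s : Finset ι) (c : ι → ℤ) : L :=
  ∑ i ∈ s, (c i : ℂ) • e i i

theorem IsGlFamily.degreeElement_lie (he : IsGlFamily e) {s : Finset ι} {c : ι → ℤ}
    (hc : ∀ i, i ∉ s → c i = 0) (m n : ι) :
    ⁅degreeElement e s c, e m n⁆ = ((c m - c n : ℤ) : ℂ) • e m n := by
  have h1 : ∀ i, (c i : ℂ) • ⁅e i i, e m n⁆ =
      (if i = m then (c i : ℂ) • e m n else 0) - (if i = n then (c i : ℂ) • e m n else 0) := by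
    intro i
    rw [he.lie_eq, smul_sub]
    congr 1 <;> split_ifs with h <;> simp [h]
  have h2 : ∀ j, (∑ i ∈ s, if i = j then (c i : ℂ) • e m n else 0) = (c j : ℂ) • e m n := by
    intro j
    rw [Finset.sum_ite_eq']
    split_ifs with h
    · rfl
    · simp [hc j h]
  rw [degreeElement, sum_lie]
  simp only [smul_lie, h1, Finset.sum_sub_distrib, h2]
  rw [← sub_smul]; push_cast; rfl

theorem ContraForm.degreeElement_self (B : ContraForm e M) (s : Finset ι) (c : ι → ℤ) (x y : M) :
    B.form ⁅degreeElement e s c, x⁆ y = B.form x ⁅degreeElement e s c, y⁆ := by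
  simp only [degreeElement, sum_lie, smul_lie, map_sum, LinearMap.sum_apply, map_smul,
    LinearMap.map_smulₛₗ, LinearMap.smul_apply, B.contra]
  simp

theorem degreeElement_lie_eq {s : Finset ι} {c : ι → ℤ} {l : ι → ℂ} {v : M}
    (hl : ∀ i ∈ s, ⁅e i i, v⁆ = l i • v) :
    ⁅degreeElement e s c, v⁆ = (∑ i ∈ s, (c i : ℂ) * l i) • v := by
  rw [degreeElement, sum_lie, Finset.sum_smul]
  refine Finset.sum_congr rfl fun i hi => ?_
  rw [smul_lie, hl i hi, mul_smul]

end Generic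

/-! ### Universal properties of the Verma modules -/

theorem span_coe_preimage {L : Type*} [LieRing L] [LieAlgebra ℂ L] (A : LieSubalgebra ℂ L)
    {s : Set L} (hs : ∀ x ∈ s, x ∈ A) (h : ∀ x ∈ A, x ∈ Submodule.span ℂ s) :
    Submodule.span ℂ {x : A | (x : L) ∈ s} = ⊤ := by
  refine eq_top_iff.2 fun x _ => ?_
  have h1 : Submodule.span ℂ s ≤
      (Submodule.span ℂ {x : A | (x : L) ∈ s}).map A.toSubmodule.subtype :=
    Submodule.span_le.2 fun y hy => ⟨⟨y, hs y hy⟩, Submodule.subset_span hy, rfl⟩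
  obtain ⟨y, hy, hyx⟩ := h1 (h x x.2)
  rwa [← show y = x from Subtype.ext hyx]

theorem isGlFamily_E : IsGlFamily E where
  span_eq := by
    rw [← span_coe_preimage gl (s := {x | ∃ m n : ℤ, x = unit m n})
      (fun x hx => Submodule.subset_span hx) fun x hx => hx]
    congr 1
    ext x
    exact exists_congr fun m => exists_congr fun n => Subtype.ext_iff
  lie_eq := E_lie

/-- The matrix units of `𝔤𝔩_S` as a family. -/
def EFin (S : Finset ℤ) (m n : S) : glS S := ES m.2 n.2

theorem EFin_coe {S : Finset ℤ} (m n : S) : (EFin S m n : gl) = E m n := rfl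

theorem isGlFamily_EFin (S : Finset ℤ) : IsGlFamily (EFin S) where
  span_eq := by
    rw [← span_coe_preimage (glS S) (s := {x | ∃ m ∈ S, ∃ n ∈ S, x = E m n})
      (fun x hx => Submodule.subset_span hx) fun x hx => hx]
    congr 1
    ext x
    constructor
    · rintro ⟨m, n, rfl⟩
      exact ⟨m, m.2, n, n.2, rfl⟩
    · rintro ⟨m, hm, n, hn, hx⟩
      exact ⟨⟨m, hm⟩, ⟨n, hn⟩, Subtype.ext hx⟩
  lie_eq m n r s := by
    apply Subtype.ext
    have h := E_lie m n r s
    simp only [← Subtype.ext_iff] at h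
    change ⁅E m n, E r s⁆ = _
    rw [h]
    split_ifs <;> simp [EFin_coe]

/-! ### Supported vectors and highest weight vectors -/

/-- The vectors killed by all `E_{m,n}` with `n ∉ T`. -/
def supportedIn (M : Type*) [AddCommGroup M] [Module ℂ M] [LieRingModule gl M] [LieModule ℂ gl M]
    (T : Set ℤ) : Submodule ℂ M where
  carrier := {x | ∀ m n, n ∉ T → ⁅E m n, x⁆ = 0}
  add_mem' {x y} hx hy m n hn := by rw [lie_add, hx m n hn, hy m n hn, add_zero]
  zero_mem' m n _ := lie_zero _
  smul_mem' t x hx m n hn := by rw [lie_smul, hx m n hn, smul_zero]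

/-- For `n ∉ T` and `a ∈ T` the commutator of `E_{m,n}` and `E_{a,b}` is zero or `-E_{a,n}`, which
kills `x`. Only the row index `a` has to lie in `T`. -/
theorem lie_mem_supportedIn {M : Type*} [AddCommGroup M] [Module ℂ M] [LieRingModule gl M]
    [LieModule ℂ gl M] {T : Set ℤ} {x : M} (hx : x ∈ supportedIn M T) {a : ℤ} (ha : a ∈ T)
    (b : ℤ) : ⁅E a b, x⁆ ∈ supportedIn M T := by
  intro m n hn
  have hna : n ≠ a := fun h => hn (h ▸ ha)
  rw [leibniz_lie, hx m n hn, lie_zero, add_zero, E_lie, if_neg hna, zero_sub, neg_lie]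
  split_ifs with h
  · rw [hx _ _ hn, neg_zero]
  · rw [zero_lie, neg_zero]

/-- The vectors killed by all `E_{m,n}` with `n ∉ T`, as a `𝔤𝔩_T`-module. -/
def supportedFin (M : Type*) [AddCommGroup M] [Module ℂ M] [LieRingModule gl M] [LieModule ℂ gl M]
    (T : Finset ℤ) : LieSubmodule ℂ (glS T) M :=
  (isGlFamily_EFin T).toLieSubmodule (supportedIn M T)
    fun a b _ hx => lie_mem_supportedIn hx a.2 b

/-- `v` is a highest weight vector of weight `λ_S`, for `𝔤𝔩_S`. -/
structure IsHWFin (S : Finset ℤ) (lam : Weight) {X : Type*} [AddCommGroup X] [Module ℂ X]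
    [LieRingModule (glS S) X] (v : X) : Prop where
  raise : ∀ m n : S, m < n → ⁅EFin S m n, v⁆ = 0
  weight : ∀ n : S, ⁅EFin S n n, v⁆ = lam.val n • v

/-- `v` is a highest weight vector of weight `λ_S` for `𝔤𝔩_S`, and the `E_{m,n}` with `n ∉ S`
kill it. -/
structure IsHWInf (S : Finset ℤ) (lam : Weight) {M : Type*} [AddCommGroup M] [Module ℂ M]
    [LieRingModule gl M] (v : M) : Prop where
  kill : ∀ m n, n ∉ S → ⁅E m n, v⁆ = 0
  raise : ∀ m ∈ S, ∀ n ∈ S, m < n → ⁅E m n, v⁆ = 0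
  weight : ∀ n ∈ S, ⁅E n n, v⁆ = lam.val n • v

/-- A degree function on the indices: decreasing and positive on `S`, and zero elsewhere. -/
def depth (S : Finset ℤ) (i : ℤ) : ℤ := if i ∈ S then (∑ j ∈ S, |j|) + 1 - i else 0

/-- The offset in `depth` serves this purpose: with positive values on `S` and zero outside,
`E_{m,n}` with `m ∉ S` and `n ∈ S` has negative degree. -/
theorem depth_pos {S : Finset ℤ} {i : ℤ} (hi : i ∈ S) : 0 < depth S i := by
  have h1 : |i| ≤ ∑ j ∈ S, |j| := Finset.single_le_sum (f := fun j => |j|)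
    (fun j _ => abs_nonneg j) hi
  have h2 := le_abs_self i
  rw [depth, if_pos hi]; omega

theorem depth_of_notMem {S : Finset ℤ} {i : ℤ} (hi : i ∉ S) : depth S i = 0 := if_neg hi

theorem depth_le_iff {S : Finset ℤ} {i j : ℤ} (hi : i ∈ S) (hj : j ∈ S) :
    depth S j ≤ depth S i ↔ i ≤ j := by
  rw [depth, depth, if_pos hi, if_pos hj]; omega

section

variable {S : Finset ℤ} {lam : Weight}

/-- The degree of a highest weight vector of weight `λ`. -/
def topDegree (S : Finset ℤ) (lam : Weight) : ℂ := ∑ i ∈ S, (depth S i : ℂ) * lam.val i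

/-- Natural weights make the top degree real, as the orthogonality of eigenspaces in
`IsHighest.ker_eq_maxSubmodule` requires. -/
theorem conj_topDegree (hlam : lam ∈ Pplus S) :
    (starRingEnd ℂ) (topDegree S lam) = topDegree S lam := by
  obtain ⟨f, hf, -⟩ := hlam
  simp [topDegree, hf]

theorem IsHWFin.isHighest {X : Type*} [AddCommGroup X] [Module ℂ X]
    [LieRingModule (glS S) X] [LieModule ℂ (glS S) X] {v : X} (hv : IsHWFin S lam v) :
    IsHighest (EFin S) (fun i => depth S i)
      (degreeElement (EFin S) Finset.univ fun i => depth S i) (topDegree S lam) v where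
  degree := (isGlFamily_EFin S).degreeElement_lie fun i hi => absurd (Finset.mem_univ i) hi
  lie_eq := by
    rw [degreeElement_lie_eq (l := fun i : S => lam.val i) fun i _ => hv.weight i, topDegree,
      ← Finset.sum_coe_sort S]
  raise m n hmn := by
    rw [depth_le_iff m.2 n.2] at hmn
    rcases eq_or_lt_of_le (show m ≤ n from hmn) with rfl | h
    · exact ⟨_, hv.weight m⟩
    · exact ⟨0, by rw [hv.raise m n h, zero_smul]⟩

/-- A matrix unit of nonnegative degree either has its column outside `S`, and kills `v`, or lies in
`𝔤𝔩_S` on or above the diagonal. -/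
theorem IsHWInf.isHighest {M : Type*} [AddCommGroup M] [Module ℂ M]
    [LieRingModule gl M] [LieModule ℂ gl M] {v : M} (hv : IsHWInf S lam v) :
    IsHighest E (depth S) (degreeElement E S (depth S)) (topDegree S lam) v where
  degree := isGlFamily_E.degreeElement_lie fun i hi => depth_of_notMem hi
  lie_eq := by rw [degreeElement_lie_eq hv.weight, topDegree]
  raise m n hmn := by
    by_cases hn : n ∈ S
    · by_cases hm : m ∈ S
      · rw [depth_le_iff hm hn] at hmn
        rcases eq_or_lt_of_le hmn with rfl | h
        · exact ⟨_, hv.weight m hm⟩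
        · exact ⟨0, by rw [hv.raise m hm n hn h, zero_smul]⟩
      · rw [depth_of_notMem hm] at hmn
        exact absurd (depth_pos hn) (not_lt.2 hmn)
    · exact ⟨0, by rw [hv.kill m n hn, zero_smul]⟩

theorem IsHWInf.isHWFin {M : Type*} [AddCommGroup M] [Module ℂ M]
    [LieRingModule gl M] [LieModule ℂ gl M] {v : M} (hv : IsHWInf S lam v) :
    IsHWFin S lam v where
  raise m n hmn := hv.raise m m.2 n n.2 hmn
  weight n := hv.weight n n.2

end

/-! ### Modules over the enveloping algebra and maps out of induced modules -/

/-- A `𝔤`-module as a module over the enveloping algebra. -/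
@[reducible] def liftModule (g M : Type*) [LieRing g] [LieAlgebra ℂ g] [AddCommGroup M]
    [Module ℂ M] [LieRingModule g M] [LieModule ℂ g M] :
    Module (UniversalEnvelopingAlgebra ℂ g) M :=
  Module.compHom M
    (UniversalEnvelopingAlgebra.lift ℂ (LieModule.toEnd ℂ g M) :
      UniversalEnvelopingAlgebra ℂ g →+* Module.End ℂ M)

section

variable (g M : Type*) [LieRing g] [LieAlgebra ℂ g] [AddCommGroup M]
    [Module ℂ M] [LieRingModule g M] [LieModule ℂ g M]

theorem liftModule_smul (u : UniversalEnvelopingAlgebra ℂ g) (x : M) :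
    letI := liftModule g M
    u • x = UniversalEnvelopingAlgebra.lift ℂ (LieModule.toEnd ℂ g M) u x := rfl

theorem liftModule_isScalarTower :
    letI := liftModule g M
    IsScalarTower ℂ (UniversalEnvelopingAlgebra ℂ g) M := by
  let _ := liftModule g M
  refine ⟨fun t u x => ?_⟩
  rw [liftModule_smul, liftModule_smul, map_smul, LinearMap.smul_apply]

theorem liftModule_ι_smul (a : g) (x : M) :
    letI := liftModule g M
    UniversalEnvelopingAlgebra.ι ℂ a • x = ⁅a, x⁆ := by
  let _ := liftModule g M
  rw [liftModule_smul, UniversalEnvelopingAlgebra.lift_ι_apply, LieModule.toEnd_apply_apply]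

theorem liftModule_algebraMap_smul (a : ℂ) (x : M) :
    letI := liftModule g M
    algebraMap ℂ (UniversalEnvelopingAlgebra ℂ g) a • x = a • x := by
  let _ := liftModule g M
  rw [liftModule_smul, AlgHom.commutes, Module.algebraMap_end_apply]

variable {g M}

/-- The map `ι` factors through the subalgebra `A` that it generates. Lifting it to `A` and
including `A` back gives the identity, by the uniqueness in the universal property. -/
theorem adjoin_range_ι :
    Algebra.adjoin ℂ (Set.range (UniversalEnvelopingAlgebra.ι ℂ (L := g))) = ⊤ := by
  set A := Algebra.adjoin ℂ (Set.range (UniversalEnvelopingAlgebra.ι ℂ (L := g))) with hA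
  let j : g →ₗ⁅ℂ⁆ A :=
    { toFun := fun x => ⟨UniversalEnvelopingAlgebra.ι ℂ x, Algebra.subset_adjoin ⟨x, rfl⟩⟩
      map_add' := fun x y => Subtype.ext (map_add _ x y)
      map_smul' := fun t x => Subtype.ext (map_smul _ t x)
      map_lie' := fun {x y} => Subtype.ext (LieHom.map_lie _ x y) }
  have h : A.val.comp (UniversalEnvelopingAlgebra.lift ℂ j) = AlgHom.id ℂ _ := by
    ext x
    change ((UniversalEnvelopingAlgebra.lift ℂ j (UniversalEnvelopingAlgebra.ι ℂ x) : A) :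
      UniversalEnvelopingAlgebra ℂ g) = UniversalEnvelopingAlgebra.ι ℂ x
    rw [UniversalEnvelopingAlgebra.lift_ι_apply]
    rfl
  refine eq_top_iff.2 fun x _ => ?_
  rw [← AlgHom.id_apply (R := ℂ) x, ← h]
  exact (UniversalEnvelopingAlgebra.lift ℂ j x).2

/-- A subspace stable under the Lie algebra is stable under the enveloping algebra. -/
theorem env_smul_mem {X : Type*} [AddCommGroup X] [Module ℂ X]
    [Module (UniversalEnvelopingAlgebra ℂ g) X]
    [IsScalarTower ℂ (UniversalEnvelopingAlgebra ℂ g) X] {N : Submodule ℂ X}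
    (hN : ∀ a, ∀ x ∈ N, UniversalEnvelopingAlgebra.ι ℂ (L := g) a • x ∈ N)
    (u : UniversalEnvelopingAlgebra ℂ g) {x : X} (hx : x ∈ N) : u • x ∈ N := by
  have hu : u ∈ Algebra.adjoin ℂ (Set.range (UniversalEnvelopingAlgebra.ι ℂ (L := g))) :=
    adjoin_range_ι (g := g) ▸ Algebra.mem_top
  induction hu using Algebra.adjoin_induction generalizing x with
  | mem u h => obtain ⟨a, rfl⟩ := h; exact hN a x hx
  | algebraMap t => rw [algebraMap_smul]; exact N.smul_mem t hx
  | add u w _ _ h1 h2 => rw [add_smul]; exact add_mem (h1 hx) (h2 hx)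
  | mul u w _ _ h1 h2 => rw [mul_smul]; exact h1 (h2 hx)

end

section Verma

variable (S : Finset ℤ) (lam : Weight)

/-- The generator of the Verma module. -/
def vermaGen : Verma S lam := (vermaIdeal S lam).mkQ 1

theorem verma_lie (a : glS S) (x : Verma S lam) :
    ⁅a, x⁆ = UniversalEnvelopingAlgebra.ι ℂ a • x := rfl

theorem lieSpan_vermaGen :
    LieSubmodule.lieSpan ℂ (glS S) {vermaGen S lam} = ⊤ := by
  refine eq_top_iff.2 fun x _ => ?_
  obtain ⟨u, rfl⟩ := (vermaIdeal S lam).mkQ_surjective x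
  have h1 : (vermaIdeal S lam).mkQ u = (u • vermaGen S lam : Verma S lam) := by
    change _ = (vermaIdeal S lam).mkQ (u • 1)
    rw [smul_eq_mul, mul_one]
  rw [h1]
  refine env_smul_mem (N := (LieSubmodule.lieSpan ℂ (glS S) {vermaGen S lam}).toSubmodule)
    (fun a x hx => ?_) u (LieSubmodule.subset_lieSpan rfl)
  rw [← verma_lie]
  exact LieSubmodule.lie_mem _ hx

theorem isHWFin_vermaGen : IsHWFin S lam (vermaGen S lam) where
  raise m n hmn := by
    change (vermaIdeal S lam).mkQ (UniversalEnvelopingAlgebra.ι ℂ (EFin S m n) * 1) = 0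
    rw [mul_one]
    exact (Submodule.Quotient.mk_eq_zero _).2
      (Submodule.subset_span (Or.inl ⟨m, n, m.2, n.2, hmn, rfl⟩))
  weight n := by
    have h1 : (lam.val n • vermaGen S lam : Verma S lam) =
        (vermaIdeal S lam).mkQ (algebraMap ℂ _ (lam.val n)) := by
      rw [Algebra.algebraMap_eq_smul_one]; rfl
    rw [h1]
    change (vermaIdeal S lam).mkQ (UniversalEnvelopingAlgebra.ι ℂ (EFin S n n) * 1) = _
    rw [mul_one, ← sub_eq_zero, ← map_sub]
    exact (Submodule.Quotient.mk_eq_zero _).2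
      (Submodule.subset_span (Or.inr ⟨n, n.2, rfl⟩))

variable {S lam}

theorem exists_verma_hom {X : Type*} [AddCommGroup X] [Module ℂ X]
    [LieRingModule (glS S) X] [LieModule ℂ (glS S) X] {v : X} (hv : IsHWFin S lam v) :
    ∃ f : Verma S lam →ₗ⁅ℂ, glS S⁆ X, f (vermaGen S lam) = v := by
  let _ := liftModule (glS S) X
  have _ := liftModule_isScalarTower (glS S) X
  let φ := LinearMap.toSpanSingleton (UniversalEnvelopingAlgebra ℂ (glS S)) X v
  have hφ : vermaIdeal S lam ≤ LinearMap.ker φ := by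
    rw [vermaIdeal, Submodule.span_le]
    rintro _ (⟨m, n, hm, hn, hmn, rfl⟩ | ⟨n, hn, rfl⟩)
    · change UniversalEnvelopingAlgebra.ι ℂ (ES hm hn) • v = 0
      rw [liftModule_ι_smul]
      exact hv.raise ⟨m, hm⟩ ⟨n, hn⟩ hmn
    · change (UniversalEnvelopingAlgebra.ι ℂ (ES hn hn) - algebraMap ℂ _ (lam.val n)) • v = 0
      rw [sub_smul, liftModule_ι_smul, liftModule_algebraMap_smul, sub_eq_zero]
      exact hv.weight ⟨n, hn⟩
  let ψ : Verma S lam →ₗ[UniversalEnvelopingAlgebra ℂ (glS S)] X := (vermaIdeal S lam).liftQ φ hφ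
  refine ⟨{ ψ.restrictScalars ℂ with
    map_lie' := fun {a x} => ?_ }, ?_⟩
  · change ψ ⁅a, x⁆ = ⁅a, ψ x⁆
    rw [verma_lie, map_smul, liftModule_ι_smul]
  · change (1 : UniversalEnvelopingAlgebra ℂ (glS S)) • v = v
    rw [one_smul]

end Verma

section GenVerma

variable {S : Finset ℤ} {V : Type} [AddCommGroup V] [Module ℂ V] [LieRingModule (glS S) V]
  [LieModule ℂ (glS S) V]

/-- The inclusion of `V` into the module induced from it. -/
def genVermaIncl (S : Finset ℤ) (V : Type) [AddCommGroup V] [Module ℂ V] [LieRingModule (glS S) V]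
    [LieModule ℂ (glS S) V] : V →ₗ[ℂ] GenVerma S V where
  toFun x := (genVermaRel S V).mkQ (1 ⊗ₜ x)
  map_add' x y := by rw [TensorProduct.tmul_add, map_add]; rfl
  map_smul' t x := by rw [TensorProduct.tmul_smul]; rfl

theorem genVerma_lie (a : gl) (x : GenVerma S V) :
    ⁅a, x⁆ = UniversalEnvelopingAlgebra.ι ℂ a • x := rfl

theorem smul_genVermaIncl (u : UniversalEnvelopingAlgebra ℂ gl) (x : V) :
    u • genVermaIncl S V x = (genVermaRel S V).mkQ (u ⊗ₜ x) := by
  change (genVermaRel S V).mkQ (u • (1 ⊗ₜ x)) = _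
  rw [TensorProduct.smul_tmul', smul_eq_mul, mul_one]

theorem lie_genVermaIncl (a : glS S) (x : V) :
    ⁅(a : gl), genVermaIncl S V x⁆ = genVermaIncl S V ⁅a, x⁆ := by
  rw [genVerma_lie, smul_genVermaIncl]
  change _ = (genVermaRel S V).mkQ (1 ⊗ₜ ⁅a, x⁆)
  rw [← sub_eq_zero, ← map_sub]
  exact (Submodule.Quotient.mk_eq_zero _).2 (Submodule.subset_span (Or.inl ⟨a, x, rfl⟩))

theorem lie_genVermaIncl_of_notMem {m n : ℤ} (hn : n ∉ S) (x : V) :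
    ⁅E m n, genVermaIncl S V x⁆ = 0 := by
  rw [genVerma_lie, smul_genVermaIncl]
  exact (Submodule.Quotient.mk_eq_zero _).2 (Submodule.subset_span (Or.inr ⟨m, n, x, hn, rfl⟩))

theorem lieSpan_genVermaIncl {x : V} (hx : LieSubmodule.lieSpan ℂ (glS S) {x} = ⊤) :
    LieSubmodule.lieSpan ℂ gl {genVermaIncl S V x} = ⊤ := by
  set N := LieSubmodule.lieSpan ℂ gl {genVermaIncl S V x} with hN
  -- The part of `V` whose image lies in `N` is a `𝔤𝔩_S`-submodule containing the generator `x`, so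
  -- it is all of `V`.
  let N' : LieSubmodule ℂ (glS S) V :=
    { N.toSubmodule.comap (genVermaIncl S V) with
      lie_mem := fun {a y} hy => by
        change genVermaIncl S V ⁅a, y⁆ ∈ N
        rw [← lie_genVermaIncl]
        exact N.lie_mem hy }
  have h1 : N' = ⊤ := top_le_iff.1 (hx ▸ LieSubmodule.lieSpan_le.2
    (Set.singleton_subset_iff.2 (LieSubmodule.subset_lieSpan rfl : genVermaIncl S V x ∈ N)))
  refine eq_top_iff.2 fun z _ => ?_
  clear * - h1
  obtain ⟨t, rfl⟩ := (genVermaRel S V).mkQ_surjective z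
  induction t using TensorProduct.induction_on with
  | zero => rw [map_zero]; exact zero_mem _
  | tmul u y =>
    rw [← smul_genVermaIncl]
    refine env_smul_mem (N := N.toSubmodule) (fun a z hz => ?_) u
      (h1 ▸ LieSubmodule.mem_top y : y ∈ N')
    rw [← genVerma_lie]
    exact N.lie_mem hz
  | add s t h1 h2 => rw [map_add]; exact add_mem h1 h2

theorem exists_genVerma_hom {M : Type*} [AddCommGroup M] [Module ℂ M]
    [LieRingModule gl M] [LieModule ℂ gl M] (f : V →ₗ⁅ℂ, glS S⁆ M)
    (hf : ∀ m n, n ∉ S → ∀ x, ⁅E m n, f x⁆ = 0) :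
    ∃ F : GenVerma S V →ₗ⁅ℂ, gl⁆ M, ∀ x, F (genVermaIncl S V x) = f x := by
  let _ := liftModule gl M
  have _ := liftModule_isScalarTower gl M
  let φ : UniversalEnvelopingAlgebra ℂ gl ⊗[ℂ] V →ₗ[UniversalEnvelopingAlgebra ℂ gl] M :=
    { TensorProduct.lift ((LinearMap.lcomp ℂ M (f : V →ₗ[ℂ] M)).comp
        (UniversalEnvelopingAlgebra.lift ℂ (LieModule.toEnd ℂ gl M)).toLinearMap) with
      map_smul' := fun w t => by
        change TensorProduct.lift _ (w • t) = w • TensorProduct.lift _ t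
        induction t using TensorProduct.induction_on with
        | zero => simp only [smul_zero, map_zero]
        | tmul u x =>
          rw [TensorProduct.smul_tmul', TensorProduct.lift.tmul, TensorProduct.lift.tmul]
          change (w * u) • f x = w • u • f x
          rw [mul_smul]
        | add s t hs ht => rw [smul_add, map_add, map_add, hs, ht, smul_add] }
  have hφt : ∀ u x, φ (u ⊗ₜ x) = u • f x := fun u x => rfl
  have hφ : genVermaRel S V ≤ LinearMap.ker φ := by
    rw [genVermaRel, Submodule.span_le]
    rintro _ (⟨a, x, rfl⟩ | ⟨m, n, x, hn, rfl⟩)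
    · refine LinearMap.mem_ker.2 ?_
      rw [map_sub, hφt, hφt, one_smul, liftModule_ι_smul, LieModuleHom.map_lie, sub_eq_zero]
      rfl
    · refine LinearMap.mem_ker.2 ?_
      rw [hφt, liftModule_ι_smul, hf m n hn]
  let ψ : GenVerma S V →ₗ[UniversalEnvelopingAlgebra ℂ gl] M := (genVermaRel S V).liftQ φ hφ
  refine ⟨{ ψ.restrictScalars ℂ with
    map_lie' := fun {a x} => ?_ }, fun x => ?_⟩
  · change ψ ⁅a, x⁆ = ⁅a, ψ x⁆
    rw [genVerma_lie, map_smul, liftModule_ι_smul]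
  · change φ (1 ⊗ₜ x) = f x
    rw [hφt, one_smul]

end GenVerma

/-! ### Irreducible highest weight modules inside modules with a contravariant form -/

theorem exists_quotient_hom {g Q M : Type*} [LieRing g] [LieAlgebra ℂ g] [AddCommGroup Q]
    [Module ℂ Q] [LieRingModule g Q] [LieModule ℂ g Q] [AddCommGroup M] [Module ℂ M]
    [LieRingModule g M] [LieModule ℂ g M] (f : Q →ₗ⁅ℂ, g⁆ M) {N : LieSubmodule ℂ g Q}
    (hN : f.ker = N) :
    ∃ F : (Q ⧸ N) →ₗ⁅ℂ, g⁆ M, Function.Injective F ∧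
      ∀ x, F (LieSubmodule.Quotient.mk' N x) = f x := by
  have hle : N.toSubmodule ≤ LinearMap.ker (f : Q →ₗ[ℂ] M) := fun x hx =>
    LieModuleHom.mem_ker.1 (hN ▸ hx : x ∈ f.ker)
  let ψ : (Q ⧸ N) →ₗ[ℂ] M := N.toSubmodule.liftQ (f : Q →ₗ[ℂ] M) hle
  have hψ : ∀ x, ψ (LieSubmodule.Quotient.mk' N x) = f x := fun x => rfl
  refine ⟨{ ψ with map_lie' := fun {a x} => ?_ }, ?_, hψ⟩
  · obtain ⟨x, rfl⟩ := LieSubmodule.Quotient.surjective_mk' N x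
    change ψ ⁅a, LieSubmodule.Quotient.mk' N x⁆ = ⁅a, ψ (LieSubmodule.Quotient.mk' N x)⁆
    rw [← LieModuleHom.map_lie, hψ, hψ, LieModuleHom.map_lie]
  · change Function.Injective ψ
    rw [injective_iff_map_eq_zero]
    intro x hx
    obtain ⟨x, rfl⟩ := LieSubmodule.Quotient.surjective_mk' N x
    rw [hψ] at hx
    exact (LieSubmodule.Quotient.mk_eq_zero N).2 (hN ▸ LieModuleHom.mem_ker.2 hx)

theorem lieSpan_quotient {g Q : Type*} [LieRing g] [LieAlgebra ℂ g] [AddCommGroup Q]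
    [Module ℂ Q] [LieRingModule g Q] [LieModule ℂ g Q] (N : LieSubmodule ℂ g Q) {q : Q}
    (hq : LieSubmodule.lieSpan ℂ g {q} = ⊤) :
    LieSubmodule.lieSpan ℂ g {LieSubmodule.Quotient.mk' N q} = ⊤ := by
  refine eq_top_iff.2 fun x _ => ?_
  obtain ⟨x, rfl⟩ := LieSubmodule.Quotient.surjective_mk' N x
  have : (⊤ : LieSubmodule ℂ g Q) ≤ (LieSubmodule.lieSpan ℂ g
      {LieSubmodule.Quotient.mk' N q}).comap (LieSubmodule.Quotient.mk' N) := by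
    rw [← hq, LieSubmodule.lieSpan_le, Set.singleton_subset_iff]
    exact LieSubmodule.subset_lieSpan rfl
  exact this (LieSubmodule.mem_top x)

section HighestWeight

variable (S : Finset ℤ) (lam : Weight)

/-- The highest weight vector of `L(λ_S)`. -/
def lfinGen : LFin S lam :=
  LieSubmodule.Quotient.mk' (maxSubmodule (glS S) (Verma S lam)) (vermaGen S lam)

theorem lieSpan_lfinGen : LieSubmodule.lieSpan ℂ (glS S) {lfinGen S lam} = ⊤ :=
  lieSpan_quotient _ (lieSpan_vermaGen S lam)

variable {S lam} in
theorem IsHWFin.map {X Y : Type*} [AddCommGroup X] [Module ℂ X] [LieRingModule (glS S) X]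
    [AddCommGroup Y] [Module ℂ Y] [LieRingModule (glS S) Y] {v : X} (hv : IsHWFin S lam v)
    (f : X →ₗ⁅ℂ, glS S⁆ Y) : IsHWFin S lam (f v) where
  raise m n h := by rw [← LieModuleHom.map_lie, hv.raise m n h, map_zero]
  weight n := by rw [← LieModuleHom.map_lie, hv.weight n, map_smul]

variable {S lam} in
theorem IsHWInf.map {X Y : Type*} [AddCommGroup X] [Module ℂ X] [LieRingModule gl X]
    [AddCommGroup Y] [Module ℂ Y] [LieRingModule gl Y] {v : X} (hv : IsHWInf S lam v)
    (f : X →ₗ⁅ℂ, gl⁆ Y) : IsHWInf S lam (f v) where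
  kill m n h := by rw [← LieModuleHom.map_lie, hv.kill m n h, map_zero]
  raise m hm n hn h := by rw [← LieModuleHom.map_lie, hv.raise m hm n hn h, map_zero]
  weight n hn := by rw [← LieModuleHom.map_lie, hv.weight n hn, map_smul]

theorem isHWFin_lfinGen : IsHWFin S lam (lfinGen S lam) :=
  (isHWFin_vermaGen S lam).map (LieSubmodule.Quotient.mk' (maxSubmodule (glS S) (Verma S lam)))

theorem isHWInf_genVermaIncl :
    IsHWInf S lam (genVermaIncl S (LFin S lam) (lfinGen S lam)) where
  kill m n hn := lie_genVermaIncl_of_notMem hn _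
  raise m hm n hn h := by
    have h1 := lie_genVermaIncl (EFin S ⟨m, hm⟩ ⟨n, hn⟩) (lfinGen S lam)
    rw [(isHWFin_lfinGen S lam).raise ⟨m, hm⟩ ⟨n, hn⟩ h, map_zero] at h1
    exact h1
  weight n hn := by
    have h1 := lie_genVermaIncl (EFin S ⟨n, hn⟩ ⟨n, hn⟩) (lfinGen S lam)
    rw [(isHWFin_lfinGen S lam).weight ⟨n, hn⟩, map_smul] at h1
    exact h1

/-- The highest weight vector of `L(S, λ)`. -/
def linfGen : LInf S lam :=
  LieSubmodule.Quotient.mk' (maxSubmodule gl (GenVerma S (LFin S lam)))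
    (genVermaIncl S (LFin S lam) (lfinGen S lam))

theorem lieSpan_linfGen : LieSubmodule.lieSpan ℂ gl {linfGen S lam} = ⊤ :=
  lieSpan_quotient _ (lieSpan_genVermaIncl (lieSpan_lfinGen S lam))

theorem isHWInf_linfGen : IsHWInf S lam (linfGen S lam) :=
  (isHWInf_genVermaIncl S lam).map
    (LieSubmodule.Quotient.mk' (maxSubmodule gl (GenVerma S (LFin S lam))))

variable {S lam}

/-- A form contravariant for `𝔤𝔩_∞` is contravariant for `𝔤𝔩_S`. -/
def ContraForm.toFin {M : Type*} [AddCommGroup M] [Module ℂ M] [LieRingModule gl M]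
    (B : ContraForm E M) (S : Finset ℤ) : ContraForm (EFin S) M where
  form := B.form
  contra m n := B.contra m n
  pos := B.pos

/-- The map from the Verma module that reaches `v` has exactly the maximal submodule as its kernel,
thanks to the form, so it descends to an embedding of the irreducible quotient. -/
theorem IsHWFin.exists_hom {X : Type*} [AddCommGroup X] [Module ℂ X]
    [LieRingModule (glS S) X] [LieModule ℂ (glS S) X] {v : X} (hv : IsHWFin S lam v)
    (hlam : lam ∈ Pplus S) (B : ContraForm (EFin S) X) (h0 : v ≠ 0) :
    ∃ f : LFin S lam →ₗ⁅ℂ, glS S⁆ X, Function.Injective f ∧ f (lfinGen S lam) = v := by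
  obtain ⟨g, hg⟩ := exists_verma_hom hv
  have hker := (isHWFin_vermaGen S lam).isHighest.ker_eq_maxSubmodule (isGlFamily_EFin S)
    (lieSpan_vermaGen S lam) B (B.degreeElement_self _ _) (conj_topDegree hlam) g (hg ▸ h0)
  obtain ⟨F, hF, hF'⟩ := exists_quotient_hom g hker
  exact ⟨F, hF, (hF' _).trans hg⟩

/-- This takes two stages. `L(λ_S)` is embedded over `𝔤𝔩_S`; its image stays among the vectors
supported in `S`, so the map extends to the induced module, where the kernel is again the maximal
submodule. -/
theorem IsHWInf.exists_hom {M : Type*} [AddCommGroup M] [Module ℂ M]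
    [LieRingModule gl M] [LieModule ℂ gl M] {v : M} (hv : IsHWInf S lam v)
    (hlam : lam ∈ Pplus S) (B : ContraForm E M) (h0 : v ≠ 0) :
    ∃ f : LInf S lam →ₗ⁅ℂ, gl⁆ M, Function.Injective f ∧ f (linfGen S lam) = v := by
  obtain ⟨f, -, hf⟩ := hv.isHWFin.exists_hom hlam (B.toFin S) h0
  have h1 : (⊤ : LieSubmodule ℂ (glS S) (LFin S lam)) ≤ (supportedFin M S).comap f := by
    rw [← lieSpan_lfinGen, LieSubmodule.lieSpan_le, Set.singleton_subset_iff]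
    change f (lfinGen S lam) ∈ supportedIn M S
    rw [hf]
    exact hv.kill
  obtain ⟨g, hg⟩ := exists_genVerma_hom f fun m n hn x => h1 (LieSubmodule.mem_top x) m n hn
  have hgq : g (genVermaIncl S (LFin S lam) (lfinGen S lam)) = v := (hg _).trans hf
  have hker := (isHWInf_genVermaIncl S lam).isHighest.ker_eq_maxSubmodule isGlFamily_E
    (lieSpan_genVermaIncl (lieSpan_lfinGen S lam)) B (B.degreeElement_self _ _)
    (conj_topDegree hlam) g (hgq ▸ h0)
  obtain ⟨F, hF, hF'⟩ := exists_quotient_hom g hker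
  exact ⟨F, hF, (hF' _).trans hgq⟩

/-- `L(λ_S)` is irreducible as soon as some module contains a highest weight vector of
weight `λ_S`. -/
theorem IsHWFin.isIrreducible {X : Type*} [AddCommGroup X] [Module ℂ X]
    [LieRingModule (glS S) X] [LieModule ℂ (glS S) X] {v : X} (hv : IsHWFin S lam v)
    (h0 : v ≠ 0) : LieModule.IsIrreducible ℂ (glS S) (LFin S lam) := by
  obtain ⟨g, hg⟩ := exists_verma_hom hv
  refine isIrreducible_quotient_maxSubmodule fun h => ?_
  refine (isHWFin_vermaGen S lam).isHighest.notMem_maxSubmodule (isGlFamily_EFin S)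
    (lieSpan_vermaGen S lam) (fun h1 => h0 ?_) (h ▸ LieSubmodule.mem_top _)
  rw [← hg, h1, map_zero]

theorem IsHWInf.isIrreducible {M : Type*} [AddCommGroup M] [Module ℂ M]
    [LieRingModule gl M] [LieModule ℂ gl M] {v : M} (hv : IsHWInf S lam v)
    (hlam : lam ∈ Pplus S) (B : ContraForm E M) (h0 : v ≠ 0) :
    LieModule.IsIrreducible ℂ gl (LInf S lam) := by
  obtain ⟨f, -, hf⟩ := hv.exists_hom hlam B h0
  refine isIrreducible_quotient_maxSubmodule fun h => h0 ?_
  have h1 : linfGen S lam = 0 := (LieSubmodule.Quotient.mk_eq_zero _).2 (h ▸ LieSubmodule.mem_top _)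
  rw [← hf, h1, map_zero]

end HighestWeight

section PolynomialModule

/-! ### The action on polynomials in the entries of a matrix with rows indexed by `ℤ` -/

open MvPolynomial

/-- Polynomials in variables `x_{i,j}` with `i ∈ ℤ` and `j ∈ J`. -/
abbrev Pol (J : Type) : Type := MvPolynomial (ℤ × J) ℂ

theorem derivation_sum_apply {R A ι : Type*} [CommRing R] [CommRing A] [Algebra R A]
    (s : Finset ι) (D : ι → Derivation R A A) (a : A) : (∑ i ∈ s, D i) a = ∑ i ∈ s, D i a := by
  classical
  induction s using Finset.induction_on with
  | empty => simp
  | insert i s hi ih => rw [Finset.sum_insert hi, Finset.sum_insert hi, Derivation.add_apply, ih]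

section Action

variable {J : Type}

/-- The unit vector at `a`. -/
def unitVec (a : ℤ) : Vec := (Finsupp.single a 1 : ℤ →₀ ℂ)

theorem vec_hom_ext {X : Type*} [AddCommGroup X] [Module ℂ X] {f g : Vec →ₗ[ℂ] X}
    (h : ∀ a, f (unitVec a) = g (unitVec a)) : f = g :=
  Finsupp.lhom_ext' (M := ℂ) fun a => LinearMap.ext_ring (h a)

theorem unit_unitVec (m n a : ℤ) : unit m n (unitVec a) = if n = a then unitVec m else 0 := by
  change (Finsupp.single m ((Finsupp.single a 1 : ℤ →₀ ℂ) n) : ℤ →₀ ℂ) = _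
  split_ifs with h
  · subst h; rw [Finsupp.single_eq_same]; rfl
  · rw [Finsupp.single_eq_of_ne h, Finsupp.single_zero]; rfl

/-- The linear form in the variables of the column `j` given by a vector. -/
def colMap (j : J) : Vec →ₗ[ℂ] Pol J :=
  (Finsupp.linearCombination ℂ fun a : ℤ => (X (a, j) : Pol J) : (ℤ →₀ ℂ) →ₗ[ℂ] Pol J)

theorem colMap_unitVec (j : J) (a : ℤ) : colMap j (unitVec a) = X (a, j) := by
  change Finsupp.linearCombination ℂ (fun a : ℤ => (X (a, j) : Pol J)) (Finsupp.single a 1) = _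
  rw [Finsupp.linearCombination_single, one_smul]

/-- The derivation by which an operator on column vectors acts on polynomials. -/
def polDer (A : Module.End ℂ Vec) : Derivation ℂ (Pol J) (Pol J) :=
  mkDerivation ℂ fun s => colMap s.2 (A (unitVec s.1))

theorem polDer_X (A : Module.End ℂ Vec) (a : ℤ) (j : J) :
    polDer A (X (a, j)) = colMap j (A (unitVec a)) := mkDerivation_X _ _ _

theorem polDer_colMap (A : Module.End ℂ Vec) (j : J) (u : Vec) :
    polDer A (colMap j u) = colMap j (A u) := by
  have : ((polDer A : Derivation ℂ (Pol J) (Pol J)) : Pol J →ₗ[ℂ] Pol J).comp (colMap j) =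
      (colMap j).comp A := by
    refine vec_hom_ext fun a => ?_
    change polDer A (colMap j (unitVec a)) = colMap j (A (unitVec a))
    rw [colMap_unitVec, polDer_X]
  exact LinearMap.congr_fun this u

instance : LieRingModule gl (Pol J) where
  bracket A p := polDer (A : Module.End ℂ Vec) p
  add_lie A B p := by
    have : polDer (J := J) ((A + B : gl) : Module.End ℂ Vec) = polDer A + polDer B := by
      refine derivation_ext fun s => ?_
      rw [Derivation.add_apply, polDer_X, polDer_X, polDer_X, ← map_add]; rfl
    change polDer ((A + B : gl) : Module.End ℂ Vec) p = _
    rw [this]; rfl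
  lie_add A p q := map_add _ p q
  leibniz_lie A B p := by
    have : ⁅(polDer (A : Module.End ℂ Vec) : Derivation ℂ (Pol J) (Pol J)),
        (polDer (B : Module.End ℂ Vec) : Derivation ℂ (Pol J) (Pol J))⁆ = polDer ((⁅A, B⁆ : gl) : Module.End ℂ Vec) := by
      refine derivation_ext fun s => ?_
      rw [Derivation.commutator_apply, polDer_X, polDer_X, polDer_colMap, polDer_colMap, polDer_X,
        ← map_sub]
      rfl
    change _ = polDer ((⁅A, B⁆ : gl) : Module.End ℂ Vec) p + _
    rw [← this, Derivation.commutator_apply]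
    change _ = polDer _ (polDer _ p) - polDer _ (polDer _ p) + polDer _ (polDer _ p)
    rw [sub_add_cancel]

theorem pol_lie (A : gl) (p : Pol J) : ⁅A, p⁆ = polDer (A : Module.End ℂ Vec) p := rfl

instance : LieModule ℂ gl (Pol J) where
  smul_lie t A p := by
    have : polDer (J := J) ((t • A : gl) : Module.End ℂ Vec) = t • polDer A := by
      refine derivation_ext fun s => ?_
      rw [Derivation.smul_apply, polDer_X, polDer_X, ← map_smul]; rfl
    rw [pol_lie, this]; rfl
  lie_smul t A p := Derivation.map_smul _ t p

theorem lie_mul (A : gl) (p q : Pol J) : ⁅A, p * q⁆ = p * ⁅A, q⁆ + ⁅A, p⁆ * q := by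
  rw [pol_lie, Derivation.leibniz, smul_eq_mul, smul_eq_mul, mul_comm q]; rfl

theorem lie_X (A : gl) (a : ℤ) (j : J) :
    ⁅A, (X (a, j) : Pol J)⁆ = colMap j ((A : Module.End ℂ Vec) (unitVec a)) := polDer_X _ _ _

theorem lie_C (A : gl) (t : ℂ) : ⁅A, (C t : Pol J)⁆ = 0 := by
  rw [pol_lie]; exact derivation_C _ _

theorem E_lie_X (m n a : ℤ) (j : J) :
    ⁅E m n, (X (a, j) : Pol J)⁆ = if n = a then X (m, j) else 0 := by
  rw [lie_X]
  change colMap j (unit m n (unitVec a)) = _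
  rw [unit_unitVec]
  split_ifs
  · rw [colMap_unitVec]
  · rw [map_zero]

/-- Both sides are derivations, so comparing them on the variables suffices. -/
theorem E_lie_pol [Fintype J] (m n : ℤ) (p : Pol J) :
    ⁅E m n, p⁆ = ∑ j, X (m, j) * pderiv (n, j) p := by
  classical
  have : polDer (J := J) ((E m n : gl) : Module.End ℂ Vec) =
      ∑ j, (X (m, j) : Pol J) • pderiv (n, j) := by
    refine derivation_ext fun ⟨a, j⟩ => ?_
    have h1 := E_lie_X m n a j
    rw [pol_lie] at h1
    rw [h1, derivation_sum_apply, Finset.sum_eq_single j]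
    · rw [Derivation.smul_apply, pderiv_X, smul_eq_mul]
      by_cases h : n = a
      · subst h; simp
      · have h2 : (a, j) ≠ (n, j) := fun h3 => h (congrArg Prod.fst h3).symm
        simp [h, Ne.symm h2]
    · intro i _ hi
      have h2 : (a, j) ≠ (n, i) := fun h3 => hi (congrArg Prod.snd h3).symm
      rw [Derivation.smul_apply, pderiv_X, Pi.single_eq_of_ne h2, smul_zero]
    · intro h; exact absurd (Finset.mem_univ j) h
  rw [pol_lie, this, derivation_sum_apply]
  rfl

variable [Fintype J]

/-- The weight of a monomial. -/
def monWeight (α : ℤ × J →₀ ℕ) (n : ℤ) : ℕ := ∑ j, α (n, j)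

theorem E_lie_monomial (n : ℤ) (α : ℤ × J →₀ ℕ) (t : ℂ) :
    ⁅E n n, monomial α t⁆ = (monWeight α n : ℂ) • monomial α t := by
  rw [E_lie_pol, monWeight, Nat.cast_sum, Finset.sum_smul]
  refine Finset.sum_congr rfl fun j _ => ?_
  rw [X_mul_pderiv_monomial, Nat.cast_smul_eq_nsmul]

theorem coeff_E_lie (n : ℤ) (α : ℤ × J →₀ ℕ) (p : Pol J) :
    coeff α ⁅E n n, p⁆ = (monWeight α n : ℂ) * coeff α p := by
  classical
  induction p using MvPolynomial.induction_on' with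
  | monomial β t =>
    rw [E_lie_monomial, coeff_smul, coeff_monomial, smul_eq_mul]
    split_ifs with h
    · rw [h]
    · simp
  | add p q hp hq => rw [lie_add, coeff_add, coeff_add, hp, hq, mul_add]

/-- Weight zero at `n` means that no variable of row `n` occurs in `p`. This property of polynomial
modules drives all the arguments on supports. -/
theorem E_lie_eq_zero {n : ℤ} {p : Pol J} (h : ⁅E n n, p⁆ = 0) (m : ℤ) : ⁅E m n, p⁆ = 0 := by
  rw [E_lie_pol]
  refine Finset.sum_eq_zero fun j _ => ?_
  rw [pderiv_eq_zero_of_notMem_vars, mul_zero]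
  intro hv
  obtain ⟨α, hα, hj⟩ := mem_vars_iff_mem_support _ |>.1 hv
  have h1 := coeff_E_lie n α p
  rw [h, coeff_zero, eq_comm, mul_eq_zero, Nat.cast_eq_zero] at h1
  have h2 := h1.resolve_right (mem_support_iff.1 hα)
  exact Finsupp.mem_support_iff.1 hj (Finset.sum_eq_zero_iff.1 h2 j (Finset.mem_univ j))

end Action

/-! ### The Fock form -/

section Fock

variable {σ : Type*}

/-- The product of the factorials of the exponents. -/
def factorialWeight (α : σ →₀ ℕ) : ℕ := α.prod fun _ k => k.factorial

theorem factorialWeight_pos (α : σ →₀ ℕ) : 0 < factorialWeight α :=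
  Finset.prod_pos fun _ _ => Nat.factorial_pos _

theorem factorialWeight_add_single (α : σ →₀ ℕ) (s : σ) :
    factorialWeight (α + Finsupp.single s 1) = (α s + 1) * factorialWeight α := by
  classical
  have h1 : factorialWeight α = ∏ i ∈ insert s α.support, (α i).factorial :=
    Finsupp.prod_of_support_subset _ (Finset.subset_insert _ _) _ fun _ _ => rfl
  have h2 : factorialWeight (α + Finsupp.single s 1) =
      ∏ i ∈ insert s α.support, ((α + Finsupp.single s 1 : σ →₀ ℕ) i).factorial := by
    refine Finsupp.prod_of_support_subset (α + Finsupp.single s 1 : σ →₀ ℕ) (fun i hi => ?_)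
      (fun _ k => k.factorial) fun _ _ => rfl
    rw [Finset.mem_insert, Finsupp.mem_support_iff]
    by_contra! h
    simp [Finsupp.single_eq_of_ne h.1, h.2] at hi
  rw [h1, h2, ← Finset.mul_prod_erase _ _ (Finset.mem_insert_self s _),
    ← Finset.mul_prod_erase _ _ (Finset.mem_insert_self s _), ← mul_assoc]
  congr 1
  · simp [Nat.factorial_succ]
  · refine Finset.prod_congr rfl fun i hi => ?_
    rw [Finsupp.add_apply, Finsupp.single_eq_of_ne (Finset.ne_of_mem_erase hi), add_zero]

/-- The bilinear form for which the monomials are orthogonal, of square norm the product of the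
factorials of the exponents. -/
def fockBilin : MvPolynomial σ ℂ →ₗ[ℂ] MvPolynomial σ ℂ →ₗ[ℂ] ℂ :=
  (basisMonomials σ ℂ).constr ℂ fun α => (factorialWeight α : ℂ) • lcoeff ℂ α

theorem fockBilin_monomial (α : σ →₀ ℕ) (t : ℂ) (q : MvPolynomial σ ℂ) :
    fockBilin (monomial α t) q = t * (factorialWeight α * coeff α q) := by
  have h : monomial α t = t • basisMonomials σ ℂ α := by
    rw [coe_basisMonomials, smul_monomial, smul_eq_mul, mul_one]
  rw [h, map_smul, fockBilin, Module.Basis.constr_basis]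
  rfl

theorem fockBilin_symm (p q : MvPolynomial σ ℂ) : fockBilin p q = fockBilin q p := by
  classical
  induction p using MvPolynomial.induction_on' with
  | monomial α t =>
    induction q using MvPolynomial.induction_on' with
    | monomial β u =>
      rw [fockBilin_monomial, fockBilin_monomial, coeff_monomial, coeff_monomial]
      by_cases h : α = β
      · subst h; simp; ring
      · simp [h, Ne.symm h]
    | add p q hp hq => rw [map_add, map_add, LinearMap.add_apply, hp, hq]
  | add p q hp hq => rw [map_add, map_add, LinearMap.add_apply, hp, hq]

/-- Multiplication by a variable is adjoint to differentiation; on monomials this is the recursion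
of the factorials, `factorialWeight_add_single`. -/
theorem fockBilin_X_mul (s : σ) (p q : MvPolynomial σ ℂ) :
    fockBilin (X s * p) q = fockBilin p (pderiv s q) := by
  classical
  induction p using MvPolynomial.induction_on' with
  | monomial α t =>
    have h1 : X s * monomial α t = monomial (α + Finsupp.single s 1) t := by
      rw [X, monomial_mul, one_mul, add_comm]
    induction q using MvPolynomial.induction_on' with
    | monomial β u =>
      rw [h1, fockBilin_monomial, pderiv_monomial, fockBilin_monomial, coeff_monomial,
        coeff_monomial]
      by_cases h : β = α + Finsupp.single s 1
      · subst h
        rw [if_pos rfl, if_pos (by simp), factorialWeight_add_single]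
        rw [Finsupp.add_apply, Finsupp.single_eq_same]
        push_cast; ring
      · rw [if_neg h]
        -- The subtraction of exponents is truncated: if `β s = 0`, the exponent after
        -- differentiation can equal `α`, but its coefficient is zero.
        by_cases h2 : β s = 0
        · simp [h2]
        · rw [if_neg]
          · simp
          · intro h3
            refine h ?_
            rw [← h3, tsub_add_cancel_of_le]
            rw [Finsupp.single_le_iff]
            omega
    | add p q hp hq => rw [map_add, map_add, map_add, hp, hq]
  | add p q hp hq => rw [mul_add, map_add, map_add, LinearMap.add_apply, LinearMap.add_apply, hp, hq]

/-- Complex conjugation of the coefficients. -/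
def conjPol : MvPolynomial σ ℂ →ₗ⋆[ℂ] MvPolynomial σ ℂ where
  toFun p := map (starRingEnd ℂ) p
  map_add' p q := map_add _ p q
  map_smul' t p := by rw [smul_eq_C_mul, smul_eq_C_mul, map_mul, map_C]

theorem fockBilin_conj_self (p : MvPolynomial σ ℂ) :
    fockBilin (conjPol p) p =
      ((∑ α ∈ p.support, (factorialWeight α : ℝ) * Complex.normSq (coeff α p) : ℝ) : ℂ) := by
  conv_lhs => rw [show conjPol p = conjPol (∑ α ∈ p.support, monomial α (coeff α p)) by
    rw [← p.as_sum]]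
  rw [map_sum, map_sum, LinearMap.sum_apply, Complex.ofReal_sum]
  refine Finset.sum_congr rfl fun α _ => ?_
  have h1 : conjPol (monomial α (coeff α p)) = monomial α ((starRingEnd ℂ) (coeff α p)) :=
    map_monomial _ _ _
  rw [h1, fockBilin_monomial, Complex.ofReal_mul, Complex.normSq_eq_conj_mul_self,
    Complex.ofReal_natCast]
  ring

/-- The Fock form on polynomials. -/
def fockForm (J : Type) [Fintype J] : ContraForm E (Pol J) where
  form := fockBilin.comp conjPol
  contra m n p q := by
    have h1 : conjPol ⁅E m n, p⁆ = ⁅E m n, conjPol p⁆ := by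
      rw [E_lie_pol, E_lie_pol, map_sum]
      refine Finset.sum_congr rfl fun j _ => ?_
      change map _ (X (m, j) * pderiv (n, j) p) = X (m, j) * pderiv (n, j) (map _ p)
      rw [map_mul, map_X, pderiv_map]
    change fockBilin (conjPol ⁅E m n, p⁆) q = fockBilin (conjPol p) ⁅E n m, q⁆
    -- Moving the variables across turns both sides into the sum over `j` of the pairings of
    -- `∂_{n,j} p̄` with `∂_{m,j} q`.
    rw [h1, fockBilin_symm (conjPol p), E_lie_pol, E_lie_pol, map_sum, map_sum,
      LinearMap.sum_apply, LinearMap.sum_apply]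
    refine Finset.sum_congr rfl fun j _ => ?_
    rw [fockBilin_X_mul, fockBilin_X_mul, fockBilin_symm]
  pos p hp := by
    change 0 < (fockBilin (conjPol p) p).re
    rw [fockBilin_conj_self, Complex.ofReal_re]
    refine Finset.sum_pos (fun α hα => ?_) (by rwa [Finset.nonempty_iff_ne_empty, Ne, support_eq_empty])
    exact mul_pos (Nat.cast_pos.2 (factorialWeight_pos α))
      (Complex.normSq_pos.2 (mem_support_iff.1 hα))

end Fock

/-! ### Leading principal minors as highest weight vectors -/

section Minors

theorem derivation_prod {R A ι : Type*} [CommRing R] [CommRing A] [Algebra R A] [DecidableEq ι]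
    (D : Derivation R A A) (s : Finset ι) (f : ι → A) :
    D (∏ i ∈ s, f i) = ∑ i ∈ s, (∏ k ∈ s.erase i, f k) * D (f i) := by
  induction s using Finset.induction_on with
  | empty => simp
  | insert a s ha ih =>
    rw [Finset.prod_insert ha, Derivation.leibniz, ih, Finset.sum_insert ha,
      Finset.erase_insert ha, smul_eq_mul, smul_eq_mul, Finset.mul_sum, add_comm]
    congr 1
    refine Finset.sum_congr rfl fun i hi => ?_
    have hia : a ≠ i := fun h => ha (h ▸ hi)
    rw [Finset.erase_insert_of_ne hia, Finset.prod_insert (by simp [ha]), mul_assoc]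

theorem derivation_det {R A ι : Type*} [CommRing R] [CommRing A] [Algebra R A] [DecidableEq ι]
    [Fintype ι] (D : Derivation R A A) (M : Matrix ι ι A) :
    D M.det = ∑ i, (M.updateCol i fun j => D (M j i)).det := by
  simp only [Matrix.det_apply', map_sum]
  rw [Finset.sum_comm]
  refine Finset.sum_congr rfl fun τ _ => ?_
  rw [← Finset.mul_sum, Derivation.leibniz, derivation_prod, smul_eq_mul, smul_eq_mul,
    Derivation.map_intCast, mul_zero, add_zero]
  congr 1
  refine Finset.sum_congr rfl fun i hi => ?_
  rw [← Finset.mul_prod_erase _ _ hi, Matrix.updateCol_self, mul_comm]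
  congr 1
  refine Finset.prod_congr rfl fun k hk => ?_
  rw [Matrix.updateCol_ne (Finset.ne_of_mem_erase hk)]

theorem derivation_prod_pow {R A ι : Type*} [CommRing R] [CommRing A] [Algebra R A]
    [DecidableEq ι] (D : Derivation R A A) (s : Finset ι) (g : ι → A) (e : ι → ℕ) (c : ι → R)
    (h : ∀ i ∈ s, D (g i) = c i • g i) :
    D (∏ i ∈ s, g i ^ e i) = (∑ i ∈ s, (e i : R) * c i) • ∏ i ∈ s, g i ^ e i := by
  induction s using Finset.induction_on with
  | empty => simp
  | insert a s ha ih =>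
    have h1 : D (g a ^ e a) = ((e a : R) * c a) • g a ^ e a := by
      rw [Derivation.leibniz_pow, h a (Finset.mem_insert_self a s)]
      rcases Nat.eq_zero_or_pos (e a) with h0 | h0
      · simp [h0]
      · rw [smul_comm _ (c a), smul_eq_mul, ← pow_succ, Nat.sub_add_cancel h0, mul_smul,
          Nat.cast_smul_eq_nsmul, smul_comm]
    rw [Finset.prod_insert ha, Derivation.leibniz, h1,
      ih fun i hi => h i (Finset.mem_insert_of_mem hi), Finset.sum_insert ha, smul_eq_mul,
      smul_eq_mul, mul_smul_comm, mul_smul_comm, add_smul, mul_comm (∏ i ∈ s, _), add_comm]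

/-- The matrix of the variables `x_{i,j}` with `i, j ∈ S`, where the columns with `i > k` are
replaced by those of the identity matrix. -/
def minorMatrix (S : Finset ℤ) (k : ℤ) : Matrix S S (Pol S) :=
  Matrix.of fun j i => if (i : ℤ) ≤ k then X ((i : ℤ), j) else if i = j then 1 else 0

/-- A leading principal minor. -/
def minor (S : Finset ℤ) (k : ℤ) : Pol S := (minorMatrix S k).det

theorem E_lie_minorMatrix (S : Finset ℤ) (k m n : ℤ) (j i : S) :
    ⁅E m n, minorMatrix S k j i⁆ = if (i : ℤ) = n ∧ n ≤ k then X (m, j) else 0 := by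
  rw [minorMatrix, Matrix.of_apply]
  by_cases h : (i : ℤ) ≤ k
  · rw [if_pos h, E_lie_X]
    by_cases h2 : n = i
    · rw [if_pos h2, if_pos ⟨h2.symm, h2 ▸ h⟩]
    · rw [if_neg h2, if_neg fun h3 => h2 h3.1.symm]
  · rw [if_neg h, if_neg fun h3 : (i : ℤ) = n ∧ n ≤ k => h (h3.1 ▸ h3.2)]
    split_ifs
    · exact lie_C (J := S) (E m n) 1
    · exact lie_zero _

theorem E_lie_minor (S : Finset ℤ) (k m n : ℤ) :
    ⁅E m n, minor S k⁆ = ∑ i, ((minorMatrix S k).updateCol i fun j =>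
      if (i : ℤ) = n ∧ n ≤ k then X (m, j) else 0).det := by
  rw [minor, pol_lie, derivation_det]
  refine Finset.sum_congr rfl fun i _ => ?_
  simp only [← pol_lie, E_lie_minorMatrix]

theorem det_updateCol_zero {A ι : Type*} [CommRing A] [DecidableEq ι] [Fintype ι]
    (M : Matrix ι ι A) (i : ι) : (M.updateCol i fun _ => 0).det = 0 :=
  Matrix.det_eq_zero_of_column_eq_zero i fun j => by rw [Matrix.updateCol_self]

theorem E_lie_minor_of_not {S : Finset ℤ} {k m n : ℤ} (h : ¬ (n ∈ S ∧ n ≤ k)) :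
    ⁅E m n, minor S k⁆ = 0 := by
  rw [E_lie_minor]
  refine Finset.sum_eq_zero fun i _ => ?_
  have h1 : ¬ ((i : ℤ) = n ∧ n ≤ k) := fun h2 => h ⟨h2.1 ▸ i.2, h2.2⟩
  simp only [if_neg h1]
  exact det_updateCol_zero _ _

/-- In the Leibniz expansion of the determinant by columns, only column `n` has a nonzero
derivative. -/
theorem E_lie_minor_of_mem {S : Finset ℤ} {k m n : ℤ} (hn : n ∈ S) (hnk : n ≤ k) :
    ⁅E m n, minor S k⁆ =
      ((minorMatrix S k).updateCol ⟨n, hn⟩ fun j => X (m, j)).det := by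
  rw [E_lie_minor, Finset.sum_eq_single ⟨n, hn⟩]
  · simp [hnk]
  · intro i _ hi
    have h1 : ¬ ((i : ℤ) = n ∧ n ≤ k) := fun h2 => hi (Subtype.ext h2.1)
    simp only [if_neg h1]
    exact det_updateCol_zero _ _
  · intro h; exact absurd (Finset.mem_univ _) h

/-- If `n ≤ k`, column `n` is replaced by a copy of column `m`, which is present since `m < n ≤ k`;
two columns coincide. -/
theorem E_lie_minor_of_lt {S : Finset ℤ} {k m n : ℤ} (hm : m ∈ S) (hmn : m < n) :
    ⁅E m n, minor S k⁆ = 0 := by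
  by_cases h : n ∈ S ∧ n ≤ k
  · rw [E_lie_minor_of_mem h.1 h.2]
    have hne : (⟨m, hm⟩ : S) ≠ ⟨n, h.1⟩ := fun h2 => hmn.ne (congrArg Subtype.val h2)
    refine Matrix.det_zero_of_column_eq hne fun j => ?_
    rw [Matrix.updateCol_self, Matrix.updateCol_ne hne, minorMatrix, Matrix.of_apply,
      if_pos (hmn.le.trans h.2)]
  · exact E_lie_minor_of_not h

theorem E_lie_minor_self {S : Finset ℤ} {k n : ℤ} (hn : n ∈ S) :
    ⁅E n n, minor S k⁆ = (if n ≤ k then 1 else 0 : ℂ) • minor S k := by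
  split_ifs with h
  · rw [E_lie_minor_of_mem hn h, one_smul, minor]
    congr 1
    ext j i : 2
    by_cases hi : i = ⟨n, hn⟩
    · subst hi
      rw [Matrix.updateCol_self, minorMatrix, Matrix.of_apply, if_pos h]
    · rw [Matrix.updateCol_ne hi]
  · rw [zero_smul, E_lie_minor_of_not fun h2 => h h2.2]

/-- Evaluation at the identity matrix shows that products of powers of minors do not vanish. -/
theorem eval_minor (S : Finset ℤ) (k : ℤ) :
    eval (fun s : ℤ × S => if s.1 = s.2 then (1 : ℂ) else 0) (minor S k) = 1 := by
  rw [minor, RingHom.map_det]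
  convert Matrix.det_one (n := S) (R := ℂ)
  ext j i
  rw [RingHom.mapMatrix_apply, Matrix.map_apply, minorMatrix, Matrix.of_apply, Matrix.one_apply]
  by_cases hij : i = j
  · subst hij; split_ifs <;> simp_all
  · have h1 : (i : ℤ) ≠ j := fun h => hij (Subtype.ext h)
    split_ifs <;> simp_all [eq_comm]

theorem sum_Icc_sub (f : ℤ → ℂ) (a n : ℤ) (han : a ≤ n) :
    ∑ k ∈ Finset.Icc a n, (f k - f (k + 1)) = f a - f (n + 1) := by
  induction n, han using Int.leInduction with
  | base => simp
  | succ n hn ih =>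
    rw [← Finset.insert_Icc_right_eq_Icc_add_one (by omega), Finset.sum_insert (by simp), ih]
    ring

theorem exists_isHWInf (r n : ℤ) (lam : Weight) (hlam : lam ∈ Pplus (Finset.Icc r n)) :
    ∃ p : Pol (Finset.Icc r n), p ≠ 0 ∧ IsHWInf (Finset.Icc r n) lam p := by
  obtain ⟨f, hf, h0, hdom⟩ := hlam
  set S := Finset.Icc r n with hS
  have hstep : ∀ k ∈ S, f (k + 1) ≤ f k := by
    intro k hk
    by_cases hk1 : k + 1 ∈ S
    · exact hdom k hk (k + 1) hk1 (by omega)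
    · rw [h0 _ hk1]; exact Nat.zero_le _
  -- The `k`-th minor has weight one at each index of `S` up to `k` and zero elsewhere, so these
  -- exponents give the weight at `b` as a telescoping sum equal to `f b`. The truncated differences
  -- are true ones by `hstep`, also at `k = n`, where `f (n + 1) = 0`.
  refine ⟨∏ k ∈ S, minor S k ^ (f k - f (k + 1)), ?_, ?_, ?_, ?_⟩
  · intro h
    have := congrArg (eval (fun s : ℤ × S => if s.1 = s.2 then (1 : ℂ) else 0)) h
    simp [eval_minor] at this
  · intro a b hb
    rw [pol_lie, derivation_prod_pow (c := fun _ => 0), Finset.sum_eq_zero (by simp), zero_smul]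
    intro k _
    rw [← pol_lie, E_lie_minor_of_not fun h => hb h.1, zero_smul]
  · intro a ha b hb hab
    rw [pol_lie, derivation_prod_pow (c := fun _ => 0), Finset.sum_eq_zero (by simp), zero_smul]
    intro k _
    rw [← pol_lie, E_lie_minor_of_lt ha hab, zero_smul]
  · intro b hb
    rw [pol_lie, derivation_prod_pow (c := fun k => if b ≤ k then 1 else 0)]
    · congr 1
      have hb' := Finset.mem_Icc.1 hb
      rw [hf, Finset.sum_congr rfl (g := fun k => if b ≤ k then (f k : ℂ) - f (k + 1) else 0),
        ← Finset.sum_filter]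
      · have : S.filter (fun k => b ≤ k) = Finset.Icc b n := by
          ext k; rw [hS, Finset.mem_filter, Finset.mem_Icc, Finset.mem_Icc]; omega
        rw [this, sum_Icc_sub (fun k => (f k : ℂ)) b n hb'.2, h0 (n + 1) (by simp [hS])]
        simp
      · intro k hk
        rw [Nat.cast_sub (hstep k hk)]
        split_ifs <;> simp
    · intro k _
      rw [← pol_lie, E_lie_minor_self hb]

end Minors

end PolynomialModule

/-! ### Polynomial modules -/

section Polynomial

variable {M : Type*} [AddCommGroup M] [Module ℂ M] [LieRingModule gl M] [LieModule ℂ gl M]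
  {M' : Type*} [AddCommGroup M'] [Module ℂ M'] [LieRingModule gl M'] [LieModule ℂ gl M']

/-- A `𝔤𝔩_∞`-module is polynomial if it embeds into one of the modules `Pol J`. -/
def IsPolynomial (M : Type*) [AddCommGroup M] [Module ℂ M] [LieRingModule gl M]
    [LieModule ℂ gl M] : Prop :=
  ∃ (J : Type) (_ : Fintype J) (f : M →ₗ⁅ℂ, gl⁆ Pol J), Function.Injective f

theorem IsPolynomial.nonempty_form (hM : IsPolynomial M) : Nonempty (ContraForm E M) := by
  obtain ⟨J, _, f, hf⟩ := hM
  exact ⟨(fockForm J).comap f hf⟩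

theorem IsPolynomial.lie_eq_zero (hM : IsPolynomial M) {n : ℤ} {x : M} (h : ⁅E n n, x⁆ = 0)
    (m : ℤ) : ⁅E m n, x⁆ = 0 := by
  obtain ⟨J, _, f, hf⟩ := hM
  refine hf ?_
  rw [LieModuleHom.map_lie, map_zero]
  refine E_lie_eq_zero ?_ m
  rw [← LieModuleHom.map_lie, h, map_zero]

/-- The Lie algebra acts on the row indices only, so relabelling the columns commutes with it. -/
theorem algHom_lie {J K : Type} (c : J → K) (g : Pol J →ₐ[ℂ] Pol K)
    (hg : ∀ a j, g (MvPolynomial.X (a, j)) = MvPolynomial.X (a, c j)) (A : gl) (p : Pol J) :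
    g ⁅A, p⁆ = ⁅A, g p⁆ := by
  have hcol : ∀ j u, g (colMap j u) = colMap (c j) u := fun j u => by
    have : g.toLinearMap.comp (colMap j) = colMap (c j) := vec_hom_ext fun a => by
      change g (colMap j (unitVec a)) = _
      rw [colMap_unitVec, colMap_unitVec, hg]
    exact LinearMap.congr_fun this u
  induction p using MvPolynomial.induction_on with
  | C t =>
    rw [lie_C, map_zero, ← MvPolynomial.algebraMap_eq, AlgHom.commutes,
      MvPolynomial.algebraMap_eq, lie_C]
  | add p q hp hq => rw [lie_add, map_add, map_add, lie_add, hp, hq]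
  | mul_X p s hp =>
    obtain ⟨a, j⟩ := s
    rw [lie_mul, map_add, map_mul, map_mul, map_mul, lie_mul, hp, hg, lie_X, lie_X, hcol]

/-- The tensor product of two polynomial modules is polynomial. -/
theorem IsPolynomial.tensor (hM : IsPolynomial M) (hM' : IsPolynomial M') :
    IsPolynomial (M ⊗[ℂ] M') := by
  obtain ⟨J, _, f, hf⟩ := hM
  obtain ⟨J', _, f', hf'⟩ := hM'
  -- The columns of the two factors are placed side by side; the diagonal action on the tensor
  -- product becomes the Leibniz rule for a product.
  let Φ : Pol J ⊗[ℂ] Pol J' ≃ₐ[ℂ] Pol (J ⊕ J') :=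
    (MvPolynomial.tensorEquivSum ℂ (ℤ × J) (ℤ × J') ℂ).trans
      (MvPolynomial.renameEquiv ℂ (Equiv.prodSumDistrib ℤ J J').symm)
  have h1 : ∀ (A : gl) (p : Pol J), Φ (⁅A, p⁆ ⊗ₜ 1) = ⁅A, Φ (p ⊗ₜ 1)⁆ := by
    refine algHom_lie Sum.inl
      (Φ.toAlgHom.comp (Algebra.TensorProduct.includeLeft)) fun a j => ?_
    change MvPolynomial.renameEquiv ℂ (Equiv.prodSumDistrib ℤ J J').symm
      (MvPolynomial.tensorEquivSum ℂ (ℤ × J) (ℤ × J') ℂ (MvPolynomial.X (a, j) ⊗ₜ 1)) = _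
    rw [MvPolynomial.tensorEquivSum_X_tmul_one, MvPolynomial.renameEquiv_apply,
      MvPolynomial.rename_X]
    rfl
  have h2 : ∀ (A : gl) (p : Pol J'), Φ (1 ⊗ₜ ⁅A, p⁆) = ⁅A, Φ (1 ⊗ₜ p)⁆ := by
    refine algHom_lie Sum.inr
      (Φ.toAlgHom.comp (Algebra.TensorProduct.includeRight)) fun a j => ?_
    change MvPolynomial.renameEquiv ℂ (Equiv.prodSumDistrib ℤ J J').symm
      (MvPolynomial.tensorEquivSum ℂ (ℤ × J) (ℤ × J') ℂ (1 ⊗ₜ MvPolynomial.X (a, j))) = _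
    rw [MvPolynomial.tensorEquivSum_one_tmul_X, MvPolynomial.renameEquiv_apply,
      MvPolynomial.rename_X]
    rfl
  have hmul : ∀ p q, Φ (p ⊗ₜ q) = Φ (p ⊗ₜ 1) * Φ (1 ⊗ₜ q) := fun p q => by
    rw [← map_mul, Algebra.TensorProduct.tmul_mul_tmul, mul_one, one_mul]
  let F : M ⊗[ℂ] M' →ₗ[ℂ] Pol (J ⊕ J') :=
    Φ.toLinearMap.comp (TensorProduct.map (f : M →ₗ[ℂ] Pol J) (f' : M' →ₗ[ℂ] Pol J'))
  have hF : ∀ x y, F (x ⊗ₜ y) = Φ (f x ⊗ₜ f' y) := fun x y => rfl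
  refine ⟨J ⊕ J', inferInstance, { F with map_lie' := fun {A t} => ?_ }, ?_⟩
  · change F ⁅A, t⁆ = ⁅A, F t⁆
    induction t using TensorProduct.induction_on with
    | zero => rw [lie_zero, map_zero, lie_zero]
    | tmul x y =>
      rw [TensorProduct.LieModule.lie_tmul_right, map_add, hF, hF, hF, LieModuleHom.map_lie,
        LieModuleHom.map_lie, hmul ⁅A, f x⁆, hmul (f x) ⁅A, f' y⁆, hmul (f x) (f' y), lie_mul, h1, h2,
        add_comm]
    | add s t hs ht => rw [lie_add, map_add, hs, ht, map_add, lie_add]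
  · exact Φ.injective.comp (TensorProduct.map_injective_of_flat_flat _ _ hf hf')

/-- `v` is a vector of weight `χ`. -/
def IsWeight (χ : ℤ →₀ ℕ) (v : M) : Prop := ∀ i, ⁅E i i, v⁆ = (χ i : ℂ) • v

/-- The span of the weight vectors whose weights are natural numbers with sum `d`. -/
def weightSpan (M : Type*) [AddCommGroup M] [Module ℂ M] [LieRingModule gl M]
    (d : ℕ) : Submodule ℂ M :=
  Submodule.span ℂ {v | ∃ χ : ℤ →₀ ℕ, χ.degree = d ∧ IsWeight χ v}

/-- One unit of weight moves from `n` to `m`. Splitting off the unit at `n` in the hypothesis avoids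
a subtraction of natural numbers. -/
theorem IsWeight.lie {χ : ℤ →₀ ℕ} {n : ℤ} {v : M} (hv : IsWeight (χ + Finsupp.single n 1) v)
    (m : ℤ) : IsWeight (χ + Finsupp.single m 1) ⁅E m n, v⁆ := by
  intro i
  have h1 : ⁅⁅E i i, E m n⁆, v⁆ =
      ((if i = m then 1 else 0 : ℂ) - (if i = n then 1 else 0 : ℂ)) • ⁅E m n, v⁆ := by
    rw [E_lie, sub_lie, sub_smul]
    congr 1 <;> split_ifs with h <;> simp [h]
  rw [leibniz_lie, h1, hv i, lie_smul, ← add_smul]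
  congr 1
  simp only [Finsupp.add_apply, Finsupp.single_apply, eq_comm (a := i)]
  push_cast
  ring

theorem exists_add_single {χ : ℤ →₀ ℕ} {n : ℤ} (h : χ n ≠ 0) :
    ∃ χ' : ℤ →₀ ℕ, χ = χ' + Finsupp.single n 1 :=
  ⟨χ - Finsupp.single n 1, by
    rw [tsub_add_cancel_of_le]
    rw [Finsupp.single_le_iff]
    omega⟩

/-- Matrix units preserve the total degree, and weights cannot become negative: where the weight at
`n` is zero, `E_{m,n}` acts as zero by polynomiality. -/
theorem weightSpan_eq_top_of_lieSpan (hM : IsPolynomial M) {χ : ℤ →₀ ℕ} {v : M}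
    (hv : IsWeight χ v) (hgen : LieSubmodule.lieSpan ℂ gl {v} = ⊤) :
    weightSpan M χ.degree = ⊤ := by
  have hst : ∀ m n, ∀ w ∈ weightSpan M χ.degree, ⁅E m n, w⁆ ∈ weightSpan M χ.degree := by
    intro m n w hw
    induction hw using Submodule.span_induction with
    | mem w h =>
      obtain ⟨ψ, hψ, hw⟩ := h
      by_cases h0 : ψ n = 0
      · rw [hM.lie_eq_zero (by rw [hw n, h0, Nat.cast_zero, zero_smul])]
        exact zero_mem _
      · obtain ⟨ψ, rfl⟩ := exists_add_single h0
        refine Submodule.subset_span ⟨_, ?_, hw.lie m⟩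
        rw [← hψ, map_add, map_add, Finsupp.degree_single, Finsupp.degree_single]
    | zero => rw [lie_zero]; exact zero_mem _
    | add x y _ _ h1 h2 => rw [lie_add]; exact add_mem h1 h2
    | smul t x _ h => rw [lie_smul]; exact Submodule.smul_mem _ t h
  have h1 : LieSubmodule.lieSpan ℂ gl {v} ≤ isGlFamily_E.toLieSubmodule _ hst := by
    rw [LieSubmodule.lieSpan_le, Set.singleton_subset_iff]
    exact Submodule.subset_span ⟨χ, rfl, hv⟩
  rw [hgen] at h1
  exact eq_top_iff.2 fun x _ => h1 (LieSubmodule.mem_top x)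

theorem IsWeight.tmul {χ ψ : ℤ →₀ ℕ} {x : M} {y : M'} (hx : IsWeight χ x) (hy : IsWeight ψ y) :
    IsWeight (χ + ψ) (x ⊗ₜ[ℂ] y) := by
  intro i
  rw [TensorProduct.LieModule.lie_tmul_right, hx i, hy i, TensorProduct.tmul_smul,
    ← TensorProduct.smul_tmul', ← add_smul, Finsupp.add_apply, Nat.cast_add]

/-- An induction principle for tensor products of modules spanned by weight vectors. -/
theorem tensor_weight_induction {d d' : ℕ} (hd : weightSpan M d = ⊤) (hd' : weightSpan M' d' = ⊤)
    {W : Submodule ℂ (M ⊗[ℂ] M')}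
    (h : ∀ χ ψ (x : M) (y : M'), χ.degree = d → ψ.degree = d' → IsWeight χ x → IsWeight ψ y →
      x ⊗ₜ y ∈ W) : W = ⊤ := by
  refine eq_top_iff.2 fun t _ => ?_
  clear * - h hd hd'
  induction t using TensorProduct.induction_on with
  | zero => exact zero_mem _
  | add s t hs ht => exact add_mem hs ht
  | tmul x y =>
    have hx : x ∈ weightSpan M d := hd ▸ Submodule.mem_top
    have hy : y ∈ weightSpan M' d' := hd' ▸ Submodule.mem_top
    induction hx using Submodule.span_induction with
    | mem x hx =>
      obtain ⟨χ, hχ, hx⟩ := hx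
      induction hy using Submodule.span_induction with
      | mem y hy =>
        obtain ⟨ψ, hψ, hy⟩ := hy
        exact h χ ψ x y hχ hψ hx hy
      | zero => rw [TensorProduct.tmul_zero]; exact zero_mem _
      | add y z _ _ h1 h2 => rw [TensorProduct.tmul_add]; exact add_mem h1 h2
      | smul t y _ h => rw [TensorProduct.tmul_smul]; exact W.smul_mem t h
    | zero => rw [TensorProduct.zero_tmul]; exact zero_mem _
    | add y z _ _ h1 h2 => rw [TensorProduct.add_tmul]; exact add_mem h1 h2
    | smul t y _ h => rw [← TensorProduct.smul_tmul']; exact W.smul_mem t h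

theorem weightSpan_tensor {d d' : ℕ} (hd : weightSpan M d = ⊤) (hd' : weightSpan M' d' = ⊤) :
    weightSpan (M ⊗[ℂ] M') (d + d') = ⊤ :=
  tensor_weight_induction hd hd' fun χ ψ _ _ hχ hψ hx hy =>
    Submodule.subset_span ⟨χ + ψ, by rw [map_add, hχ, hψ], hx.tmul hy⟩

theorem IsWeight.mem_supportedIn (hM : IsPolynomial M) {χ : ℤ →₀ ℕ} {x : M} (hx : IsWeight χ x)
    {T : Set ℤ} (hT : ∀ i, i ∉ T → χ i = 0) : x ∈ supportedIn M T := fun m n hn =>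
  hM.lie_eq_zero (by rw [hx n, hT n hn, Nat.cast_zero, zero_smul]) m

/-- A polynomial module is generated by its vectors supported in `T`, if `T` is large enough. -/
theorem eq_top_of_supportedIn_le (hM : IsPolynomial M) {d : ℕ} (hd : weightSpan M d = ⊤)
    {T : Set ℤ} (hT : ∀ χ : ℤ →₀ ℕ, χ.degree = d → ∀ i, i ∉ T → χ i ≠ 0 → ∃ t ∈ T, χ t = 0)
    {V : Submodule ℂ M} (hV : supportedIn M T ≤ V)
    (hst : ∀ i, ∀ t ∈ T, ∀ x ∈ V, ⁅E i t, x⁆ ∈ V) : V = ⊤ := by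
  classical
  -- Induction on the total weight outside `T`.
  have key : ∀ (k : ℕ) (χ : ℤ →₀ ℕ) (x : M), (χ.filter (· ∉ T)).degree = k → χ.degree = d →
      IsWeight χ x → x ∈ V := by
    intro k
    induction k with
    | zero =>
      intro χ x hk _ hx
      refine hV (hx.mem_supportedIn hM fun i hi => ?_)
      have h1 := (Finsupp.degree_eq_zero_iff _).1 hk
      rw [← Finsupp.filter_apply_pos (· ∉ T) χ hi, h1, Finsupp.zero_apply]
    | succ k ih =>
      intro χ x hk hχ hx
      obtain ⟨i, hi⟩ : ∃ i, χ.filter (· ∉ T) i ≠ 0 := by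
        by_contra! h
        have : χ.filter (· ∉ T) = 0 := Finsupp.ext h
        rw [this, map_zero] at hk
        omega
      have hiT : i ∉ T := by
        by_contra h
        exact hi (Finsupp.filter_apply_neg _ _ (not_not.2 h))
      rw [Finsupp.filter_apply_pos (· ∉ T) χ hiT] at hi
      -- With `t` fresh, `E_{i,t} x = 0`, so `E_{i,t} E_{t,i} x = (E_{i,i} - E_{t,t}) x = χ_i x`.
      -- Thus `x` is recovered from `E_{t,i} x`, which has one unit less outside `T`.
      obtain ⟨t, ht, ht0⟩ := hT χ hχ i hiT hi
      have hti : t ≠ i := fun h => hiT (h ▸ ht)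
      obtain ⟨χ', rfl⟩ := exists_add_single hi
      have hy : ⁅E t i, x⁆ ∈ V := by
        refine ih (χ' + Finsupp.single t 1) _ ?_ ?_ (hx.lie t)
        · rw [Finsupp.filter_add, map_add, Finsupp.filter_single_of_pos (· ∉ T) hiT,
            Finsupp.degree_single] at hk
          rw [Finsupp.filter_add, map_add, Finsupp.filter_single_of_neg (· ∉ T) (not_not.2 ht),
            map_zero]
          omega
        · rw [← hχ, map_add, map_add, Finsupp.degree_single, Finsupp.degree_single]
      have h1 := hst i t ht _ hy
      have h2 : ⁅E i t, x⁆ = 0 :=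
        hM.lie_eq_zero (by rw [hx t, ht0, Nat.cast_zero, zero_smul]) i
      rw [leibniz_lie, h2, lie_zero, add_zero, E_lie, if_pos rfl, if_pos rfl, sub_lie, hx i, hx t,
        ht0, Nat.cast_zero, zero_smul, sub_zero] at h1
      have h3 : ((χ' + Finsupp.single i 1 : ℤ →₀ ℕ) i : ℂ) ≠ 0 := Nat.cast_ne_zero.2 hi
      have h4 := V.smul_mem ((χ' + Finsupp.single i 1 : ℤ →₀ ℕ) i : ℂ)⁻¹ h1
      rwa [smul_smul, inv_mul_cancel₀ h3, one_smul] at h4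
  rw [eq_top_iff, ← hd, weightSpan, Submodule.span_le]
  rintro x ⟨χ, hχ, hx⟩
  exact key _ χ x rfl hχ hx

/-- The span of the vectors having a positive weight outside `T`. -/
def outerPart (M : Type*) [AddCommGroup M] [Module ℂ M] [LieRingModule gl M] (T : Set ℤ) :
    Submodule ℂ M :=
  Submodule.span ℂ {x | ∃ i, i ∉ T ∧ ∃ k : ℕ, ⁅E i i, x⁆ = ((k : ℂ) + 1) • x}

/-- A supported vector has weight zero at every `i ∉ T`, so it is orthogonal to each vector of
positive weight there, and hence to itself. -/
theorem eq_zero_of_mem_outerPart (B : ContraForm E M) {T : Set ℤ} {x : M}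
    (hx : x ∈ supportedIn M T) (hx' : x ∈ outerPart M T) : x = 0 := by
  have : outerPart M T ≤ LinearMap.ker (B.form x) := by
    rw [outerPart, Submodule.span_le]
    rintro y ⟨i, hi, k, hy⟩
    have h1 := B.contra i i x y
    rw [hx i i hi, hy, map_zero, LinearMap.zero_apply, map_smul, smul_eq_mul, eq_comm,
      mul_eq_zero] at h1
    exact LinearMap.mem_ker.2 (h1.resolve_left (Nat.cast_add_one_ne_zero k))
  exact B.eq_zero (LinearMap.mem_ker.1 (this hx'))

theorem mem_of_mem_sup_outerPart (B : ContraForm E M) {T : Set ℤ} {V : Submodule ℂ M}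
    (hV : V ≤ supportedIn M T) {x : M} (hx : x ∈ supportedIn M T) (hx' : x ∈ V ⊔ outerPart M T) :
    x ∈ V := by
  obtain ⟨y, hy, z, hz, rfl⟩ := Submodule.mem_sup.1 hx'
  have h1 : z ∈ supportedIn M T := by
    have := sub_mem hx (hV hy)
    rwa [add_sub_cancel_left] at this
  rw [eq_zero_of_mem_outerPart B h1 hz, add_zero]
  exact hy

/-- The submodule generated by a `𝔤𝔩_T`-stable space of vectors supported in `T` contains no
further vectors supported in `T`. -/
theorem mem_of_mem_lieSpan (B : ContraForm E M) {T : Set ℤ} {V : Submodule ℂ M}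
    (hV : V ≤ supportedIn M T) (hst : ∀ m ∈ T, ∀ n ∈ T, ∀ x ∈ V, ⁅E m n, x⁆ ∈ V) {x : M}
    (hx : x ∈ supportedIn M T) (hx' : x ∈ LieSubmodule.lieSpan ℂ gl (V : Set M)) : x ∈ V := by
  classical
  -- For this grading a matrix unit of nonnegative degree preserves `V` or kills it, while one of
  -- negative degree carries weight out of `T` and never brings any back. So `V` generates nothing
  -- beyond `V` and `outerPart M T`, and the latter contains no nonzero supported vector.
  let c : ℤ → ℤ := fun i => if i ∈ T then 1 else 0
  have hlt : ∀ m n, c m < c n → m ∉ T ∧ n ∈ T := by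
    intro m n h
    by_cases hm : m ∈ T <;> by_cases hn : n ∈ T <;> simp [c, hm, hn] at h ⊢
  refine mem_of_mem_sup_outerPart B hV hx (isGlFamily_E.lieSpan_le_sup c ?_ ?_ ?_ hx')
  · intro m n hmn y hy
    by_cases hn : n ∈ T
    · by_cases hm : m ∈ T
      · exact hst m hm n hn y hy
      · simp [c, hm, hn] at hmn
    · rw [hV hy m n hn]; exact zero_mem _
  · intro m n hmn y hy
    obtain ⟨hm, hn⟩ := hlt m n hmn
    have hne : n ≠ m := fun h => hm (h ▸ hn)
    refine Submodule.subset_span ⟨m, hm, 0, ?_⟩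
    rw [leibniz_lie, hV hy m m hm, lie_zero, add_zero, E_lie, if_pos rfl, if_neg hne.symm,
      sub_zero, Nat.cast_zero, zero_add, one_smul]
  · intro m n hmn y hy
    obtain ⟨hm, hn⟩ := hlt m n hmn
    have hne : n ≠ m := fun h => hm (h ▸ hn)
    induction hy using Submodule.span_induction with
    | mem y h =>
      obtain ⟨i, hi, k, hy⟩ := h
      have hin : i ≠ n := fun h => hi (h ▸ hn)
      by_cases him : i = m
      · subst him
        refine Submodule.subset_span ⟨i, hi, k + 1, ?_⟩
        rw [leibniz_lie, hy, lie_smul, E_lie, if_pos rfl, if_neg hin, sub_zero, Nat.cast_add,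
          Nat.cast_one, add_smul (_ + _), one_smul, add_comm]
      · refine Submodule.subset_span ⟨i, hi, k, ?_⟩
        rw [leibniz_lie, hy, lie_smul, E_lie, if_neg him, if_neg hin, sub_zero, zero_lie, zero_add]
    | zero => rw [lie_zero]; exact zero_mem _
    | add y z _ _ h1 h2 => rw [lie_add]; exact add_mem h1 h2
    | smul t y _ h => rw [lie_smul]; exact Submodule.smul_mem _ t h

end Polynomial

/-! ### The modules `L(S, λ)` for an interval `S` -/

section LInf

variable {r n : ℤ} {lam : Weight}

theorem lfin_isIrreducible (hlam : lam ∈ Pplus (Finset.Icc r n)) :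
    LieModule.IsIrreducible ℂ (glS (Finset.Icc r n)) (LFin (Finset.Icc r n) lam) := by
  obtain ⟨p, hp, hw⟩ := exists_isHWInf r n lam hlam
  exact hw.isHWFin.isIrreducible hp

theorem linf_isIrreducible (hlam : lam ∈ Pplus (Finset.Icc r n)) :
    LieModule.IsIrreducible ℂ gl (LInf (Finset.Icc r n) lam) := by
  obtain ⟨p, hp, hw⟩ := exists_isHWInf r n lam hlam
  exact hw.isIrreducible hlam (fockForm _) hp

theorem linf_isPolynomial (hlam : lam ∈ Pplus (Finset.Icc r n)) :
    IsPolynomial (LInf (Finset.Icc r n) lam) := by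
  obtain ⟨p, hp, hw⟩ := exists_isHWInf r n lam hlam
  obtain ⟨f, hf, -⟩ := hw.exists_hom hlam (fockForm _) hp
  exact ⟨_, inferInstance, f, hf⟩

theorem lfinGen_ne_zero (hlam : lam ∈ Pplus (Finset.Icc r n)) :
    lfinGen (Finset.Icc r n) lam ≠ 0 := by
  obtain ⟨p, hp, hw⟩ := exists_isHWInf r n lam hlam
  obtain ⟨f, -, hf⟩ := hw.isHWFin.exists_hom hlam ((fockForm _).toFin _) hp
  intro h
  rw [h, map_zero] at hf
  exact hp hf.symm

theorem linfGen_ne_zero (hlam : lam ∈ Pplus (Finset.Icc r n)) :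
    linfGen (Finset.Icc r n) lam ≠ 0 := by
  obtain ⟨p, hp, hw⟩ := exists_isHWInf r n lam hlam
  obtain ⟨f, -, hf⟩ := hw.exists_hom hlam (fockForm _) hp
  intro h
  rw [h, map_zero] at hf
  exact hp hf.symm

theorem exists_weightSpan_linf (hlam : lam ∈ Pplus (Finset.Icc r n)) :
    ∃ d, weightSpan (LInf (Finset.Icc r n) lam) d = ⊤ := by
  obtain ⟨f, hf, h0, -⟩ := id hlam
  have hw := isHWInf_linfGen (Finset.Icc r n) lam
  let χ : ℤ →₀ ℕ := Finsupp.onFinset (Finset.Icc r n) f fun i hi => by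
    by_contra h; exact hi (h0 i h)
  refine ⟨χ.degree, weightSpan_eq_top_of_lieSpan (linf_isPolynomial hlam) (fun i => ?_)
    (lieSpan_linfGen (Finset.Icc r n) lam)⟩
  change _ = (f i : ℂ) • _
  by_cases hi : i ∈ Finset.Icc r n
  · rw [hw.weight i hi, hf]
  · rw [hw.kill i i hi, h0 i hi, Nat.cast_zero, zero_smul]

theorem Pplus_mono {nbar : ℤ} (h : n ≤ nbar) (hlam : lam ∈ Pplus (Finset.Icc r n)) :
    lam ∈ Pplus (Finset.Icc r nbar) := by
  obtain ⟨f, hf, h0, hd⟩ := hlam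
  refine ⟨f, hf, fun i hi => h0 i fun h1 => hi ?_, fun i hi j hj hij => ?_⟩
  · rw [Finset.mem_Icc] at *; omega
  · by_cases h1 : j ∈ Finset.Icc r n
    · refine hd i ?_ j h1 hij
      rw [Finset.mem_Icc] at *; omega
    · rw [h0 j h1]; exact Nat.zero_le _

/-- The interval grows only to the right: a new raising operator has its column beyond `n`, and such
a matrix unit already kills the vector. A new index to the left of `r` would add raising operators
with columns in `S`. -/
theorem isHWInf_linfGen_of_le {nbar : ℤ} (h : n ≤ nbar) (hlam : lam ∈ Pplus (Finset.Icc r n)) :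
    IsHWInf (Finset.Icc r nbar) lam (linfGen (Finset.Icc r n) lam) := by
  have hw := isHWInf_linfGen (Finset.Icc r n) lam
  obtain ⟨f, hf, h0, -⟩ := hlam
  refine ⟨fun a b hb => hw.kill a b fun h1 => hb ?_, fun a ha b hb hab => ?_, fun b hb => ?_⟩
  · rw [Finset.mem_Icc] at *; omega
  · by_cases h1 : b ∈ Finset.Icc r n
    · refine hw.raise a ?_ b h1 hab
      rw [Finset.mem_Icc] at *; omega
    · exact hw.kill a b h1
  · by_cases h1 : b ∈ Finset.Icc r n
    · exact hw.weight b h1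
    · rw [hw.kill b b h1, hf, h0 b h1, Nat.cast_zero, zero_smul]

/-- The vectors of `L(S, λ)` supported in a larger interval form the finite-dimensional
irreducible module for that interval. -/
theorem exists_lfin_hom_linf {nbar : ℤ} (h : n ≤ nbar) (hlam : lam ∈ Pplus (Finset.Icc r n)) :
    ∃ f : LFin (Finset.Icc r nbar) lam →ₗ⁅ℂ, glS (Finset.Icc r nbar)⁆ LInf (Finset.Icc r n) lam,
      Function.Injective f ∧ f (lfinGen _ lam) = linfGen _ lam ∧
      ∀ x, x ∈ supportedIn (LInf (Finset.Icc r n) lam) (Finset.Icc r nbar : Finset ℤ) ↔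
        ∃ y, f y = x := by
  have hw := isHWInf_linfGen_of_le h hlam
  obtain ⟨B⟩ := (linf_isPolynomial hlam).nonempty_form
  obtain ⟨f, hf, hfv⟩ := hw.isHWFin.exists_hom (Pplus_mono h hlam) (B.toFin _)
    (linfGen_ne_zero hlam)
  have h1 : (⊤ : LieSubmodule ℂ (glS (Finset.Icc r nbar)) (LFin (Finset.Icc r nbar) lam)) ≤
      (supportedFin (LInf (Finset.Icc r n) lam) (Finset.Icc r nbar)).comap f := by
    rw [← lieSpan_lfinGen, LieSubmodule.lieSpan_le, Set.singleton_subset_iff]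
    change f (lfinGen _ lam) ∈ supportedIn (LInf (Finset.Icc r n) lam) _
    rw [hfv]
    exact hw.kill
  have hV : LinearMap.range (f : LFin (Finset.Icc r nbar) lam →ₗ[ℂ] LInf (Finset.Icc r n) lam) ≤
      supportedIn (LInf (Finset.Icc r n) lam) (Finset.Icc r nbar : Finset ℤ) := by
    rintro _ ⟨y, rfl⟩
    exact h1 (LieSubmodule.mem_top y)
  refine ⟨f, hf, hfv, fun x => ⟨fun hx => ?_, fun ⟨y, hy⟩ => hV ⟨y, hy⟩⟩⟩
  -- The image of `f` is `𝔤𝔩_T`-stable and contains the generator of the whole module, so it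
  -- contains every supported vector.
  refine mem_of_mem_lieSpan B hV ?_ hx ?_
  · rintro a ha b hb _ ⟨y, rfl⟩
    exact ⟨⁅EFin (Finset.Icc r nbar) ⟨a, ha⟩ ⟨b, hb⟩, y⁆, LieModuleHom.map_lie f _ _⟩
  · have h2 : (⊤ : LieSubmodule ℂ gl (LInf (Finset.Icc r n) lam)) ≤ LieSubmodule.lieSpan ℂ gl
        (LinearMap.range (f : LFin (Finset.Icc r nbar) lam →ₗ[ℂ] LInf (Finset.Icc r n) lam) :
          Set (LInf (Finset.Icc r n) lam)) := by
      rw [← lieSpan_linfGen]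
      exact LieSubmodule.lieSpan_mono (Set.singleton_subset_iff.2 ⟨_, hfv⟩)
    exact h2 (LieSubmodule.mem_top x)

end LInf

/-! ### Direct sums -/

section DirectSum

variable {g I : Type*} [LieRing g] [LieAlgebra ℂ g] {L : I → Type*} [∀ i, AddCommGroup (L i)]
  [∀ i, Module ℂ (L i)] [∀ i, LieRingModule g (L i)] [∀ i, LieModule ℂ g (L i)]
  {X : Type*} [AddCommGroup X] [Module ℂ X] [LieRingModule g X] [LieModule ℂ g X]

/-- The homomorphism from a direct sum given by homomorphisms from the summands. -/
def directSumLift [DecidableEq I] (f : ∀ i, L i →ₗ⁅ℂ, g⁆ X) : (⨁ i, L i) →ₗ⁅ℂ, g⁆ X where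
  toLinearMap := DirectSum.toModule ℂ I X fun i => (f i : L i →ₗ[ℂ] X)
  map_lie' {a x} := by
    change DirectSum.toModule ℂ I X (fun i => (f i : L i →ₗ[ℂ] X)) ⁅a, x⁆ =
      ⁅a, DirectSum.toModule ℂ I X (fun i => (f i : L i →ₗ[ℂ] X)) x⁆
    induction x using DirectSum.induction_on with
    | zero => rw [lie_zero, map_zero, lie_zero]
    | of i y =>
      have h := (DirectSum.lieModuleOf ℂ I g L i).map_lie a y
      change DirectSum.lof ℂ I L i ⁅a, y⁆ = ⁅a, DirectSum.lof ℂ I L i y⁆ at h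
      change DirectSum.toModule ℂ I X (fun i => (f i : L i →ₗ[ℂ] X))
        ⁅a, DirectSum.lof ℂ I L i y⁆ =
        ⁅a, DirectSum.toModule ℂ I X (fun i => (f i : L i →ₗ[ℂ] X)) (DirectSum.lof ℂ I L i y)⁆
      rw [← h, DirectSum.toModule_lof, DirectSum.toModule_lof]
      exact (f i).map_lie a y
    | add x y hx hy => rw [lie_add, map_add, hx, hy, map_add, lie_add]

theorem directSumLift_of [DecidableEq I] (f : ∀ i, L i →ₗ⁅ℂ, g⁆ X) (i : I) (y : L i) :
    directSumLift f (DirectSum.lieModuleOf ℂ I g L i y) = f i y :=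
  DirectSum.toModule_lof ℂ i y

theorem directSumLift_mem [DecidableEq I] (f : ∀ i, L i →ₗ⁅ℂ, g⁆ X) (W : Submodule ℂ X)
    (x : ⨁ i, L i) (h : ∀ i, x i ≠ 0 → f i (x i) ∈ W) : directSumLift f x ∈ W :=
  dfinsuppSumAddHom_mem W x (fun i => (f i : L i →ₗ[ℂ] X).toAddMonoidHom) h

theorem exists_equiv_of_bijective {Y : Type*} [AddCommGroup Y] [Module ℂ Y] [LieRingModule g Y]
    [LieModule ℂ g Y] (f : Y →ₗ⁅ℂ, g⁆ X) (hf : Function.Bijective f) :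
    ∃ e : Y ≃ₗ⁅ℂ, g⁆ X, ∀ y, e y = f y :=
  ⟨{ f with
      invFun := (LinearEquiv.ofBijective (f : Y →ₗ[ℂ] X) hf).symm
      left_inv := (LinearEquiv.ofBijective (f : Y →ₗ[ℂ] X) hf).left_inv
      right_inv := (LinearEquiv.ofBijective (f : Y →ₗ[ℂ] X) hf).right_inv }, fun _ => rfl⟩

/-- A module with an independent family of submodules whose sum is everything is isomorphic to
their direct sum. -/
theorem nonempty_equiv_directSum (f : ∀ i, L i →ₗ⁅ℂ, g⁆ X) (hf : ∀ i, Function.Injective (f i))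
    (hind : iSupIndep fun i => (f i).range) (htop : ⨆ i, (f i).range = ⊤) :
    Nonempty (X ≃ₗ⁅ℂ, g⁆ ⨁ i, L i) := by
  classical
  have hbij : Function.Bijective (directSumLift f) := by
    constructor
    · rw [injective_iff_map_eq_zero]
      intro x hx
      refine DFinsupp.ext fun i => ?_
      let y : ⨁ i, L i := DFinsupp.erase i x
      have h1 : x = DirectSum.lieModuleOf ℂ I g L i (x i) + y :=
        (DFinsupp.single_add_erase i x).symm
      have h2 : directSumLift f y ∈ ⨆ (j) (_ : j ≠ i), (f j).range := by
        refine directSumLift_mem f (⨆ (j) (_ : j ≠ i), (f j).range : LieSubmodule ℂ g X).toSubmodule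
          _ fun j hj => ?_
        have hji : j ≠ i := fun h => hj (h ▸ DFinsupp.erase_same)
        exact (le_iSup₂_of_le j hji le_rfl : (f j).range ≤ ⨆ (j) (_ : j ≠ i), (f j).range)
          ((LieModuleHom.mem_range _ _).2 ⟨_, rfl⟩)
      have h3 : f i (x i) = -directSumLift f y := by
        rw [eq_neg_iff_add_eq_zero, ← directSumLift_of f i (x i), ← map_add, ← h1, hx]
      have h4 : f i (x i) ∈ (f i).range ⊓ ⨆ (j) (_ : j ≠ i), (f j).range :=
        LieSubmodule.mem_inf _ _ _ |>.2
          ⟨(LieModuleHom.mem_range _ _).2 ⟨_, rfl⟩, h3 ▸ neg_mem h2⟩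
      rw [(hind i).eq_bot, LieSubmodule.mem_bot] at h4
      exact hf i (h4.trans (map_zero _).symm)
    · rw [← LieModuleHom.range_eq_top, ← top_le_iff, ← htop]
      refine iSup_le fun i x hx => ?_
      obtain ⟨y, rfl⟩ := (LieModuleHom.mem_range _ _).1 hx
      exact (LieModuleHom.mem_range _ _).2 ⟨_, directSumLift_of f i y⟩
  obtain ⟨e, -⟩ := exists_equiv_of_bijective _ hbij
  exact ⟨e.symm⟩

end DirectSum

/-! ### Decomposition of finite-dimensional polynomial modules -/

/-- The weight with prescribed values. -/
def weightOf (χ : ℤ →₀ ℕ) : Weight :=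
  (∑ i ∈ χ.support, (χ i : ℂ) • ((Finsupp.lapply i : (ℤ →₀ ℂ) →ₗ[ℂ] ℂ) ∘ₗ
    (LinearMap.applyₗ (unitVec i) : Module.End ℂ Vec →ₗ[ℂ] Vec))) ∘ₗ
    gl.toSubmodule.subtype ∘ₗ cartan.subtype

theorem weightOf_val (χ : ℤ →₀ ℕ) (n : ℤ) : (weightOf χ).val n = χ n := by
  have h : ∀ i, (Finsupp.lapply i : (ℤ →₀ ℂ) →ₗ[ℂ] ℂ) (unit n n (unitVec i)) =
      if i = n then 1 else 0 := by
    intro i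
    rw [unit_unitVec]
    by_cases hi : i = n
    · subst hi
      rw [if_pos rfl, if_pos rfl]
      exact Finsupp.single_eq_same
    · rw [if_neg hi, if_neg (Ne.symm hi)]
      exact map_zero (Finsupp.lapply i : (ℤ →₀ ℂ) →ₗ[ℂ] ℂ)
  change (∑ i ∈ χ.support, (χ i : ℂ) • ((Finsupp.lapply i : (ℤ →₀ ℂ) →ₗ[ℂ] ℂ) ∘ₗ
    (LinearMap.applyₗ (unitVec i) : Module.End ℂ Vec →ₗ[ℂ] Vec))) (unit n n) = _
  rw [LinearMap.sum_apply]
  have h2 : ∀ i, ((χ i : ℂ) • ((Finsupp.lapply i : (ℤ →₀ ℂ) →ₗ[ℂ] ℂ) ∘ₗ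
      (LinearMap.applyₗ (unitVec i) : Module.End ℂ Vec →ₗ[ℂ] Vec))) (unit n n) =
      if i = n then (χ i : ℂ) else 0 := by
    intro i
    change (χ i : ℂ) • (Finsupp.lapply i : (ℤ →₀ ℂ) →ₗ[ℂ] ℂ) (unit n n (unitVec i)) = _
    rw [h, smul_eq_mul, mul_ite, mul_one, mul_zero]
  simp only [h2]
  rw [Finset.sum_ite_eq']
  split_ifs with hn
  · rfl
  · rw [Finsupp.notMem_support_iff.1 hn, Nat.cast_zero]

/-- Commuting operators on a finite-dimensional space have a common eigenvector. -/
theorem exists_common_eigenvector {κ V : Type*} [AddCommGroup V] [Module ℂ V]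
    [FiniteDimensional ℂ V] (f : κ → Module.End ℂ V) (hf : ∀ i j v, f i (f j v) = f j (f i v))
    (s : Finset κ) (W : Submodule ℂ V) (hW : W ≠ ⊥) (hst : ∀ i, ∀ v ∈ W, f i v ∈ W) :
    ∃ v ∈ W, v ≠ 0 ∧ ∀ i ∈ s, ∃ c : ℂ, f i v = c • v := by
  classical
  induction s using Finset.induction_on generalizing W with
  | empty =>
    obtain ⟨v, hv, h0⟩ := W.ne_bot_iff.1 hW
    exact ⟨v, hv, h0, by simp⟩
  | insert a s _ ih =>
    have : Nontrivial W := Submodule.nontrivial_iff_ne_bot.2 hW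
    obtain ⟨c, hc⟩ := Module.End.exists_eigenvalue ((f a).restrict (hst a))
    obtain ⟨w, hw, hw0⟩ := hc.exists_hasEigenvector
    have hw1 : f a w = c • (w : V) := congrArg Subtype.val (Module.End.mem_eigenspace_iff.1 hw)
    obtain ⟨v, hv, h0, h⟩ := ih (W ⊓ (f a).eigenspace c)
      (by
        refine (Submodule.ne_bot_iff _).2 ⟨w, ⟨w.2, Module.End.mem_eigenspace_iff.2 hw1⟩, ?_⟩
        exact fun h => hw0 (Subtype.ext h))
      (fun i v hv => ⟨hst i v hv.1, Module.End.mem_eigenspace_iff.2 (by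
        rw [hf, Module.End.mem_eigenspace_iff.1 hv.2, map_smul])⟩)
    refine ⟨v, hv.1, h0, fun i hi => ?_⟩
    rcases Finset.mem_insert.1 hi with rfl | hi
    · exact ⟨c, Module.End.mem_eigenspace_iff.1 hv.2⟩
    · exact h i hi

section Decomposition

variable {T : Finset ℤ} {X : Type*} [AddCommGroup X] [Module ℂ X] [LieRingModule (glS T) X]
  [LieModule ℂ (glS T) X]

/-- A nonzero finite-dimensional module contains a nonzero vector that is killed by the raising
operators and is an eigenvector of the diagonal matrices. -/
theorem exists_singular_vector [FiniteDimensional ℂ X] (N : LieSubmodule ℂ (glS T) X)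
    (hN : N ≠ ⊥) : ∃ v ∈ N, v ≠ 0 ∧ (∀ m n : T, m < n → ⁅EFin T m n, v⁆ = 0) ∧
      ∀ n : T, ∃ c : ℂ, ⁅EFin T n n, v⁆ = c • v := by
  set h := degreeElement (EFin T) Finset.univ fun i => depth T i with hh
  have hdeg : ∀ m n : T, ⁅h, EFin T m n⁆ = ((depth T m - depth T n : ℤ) : ℂ) • EFin T m n :=
    (isGlFamily_EFin T).degreeElement_lie fun i hi => absurd (Finset.mem_univ i) hi
  -- An eigenvector of the degree whose eigenvalue has the largest real part is killed by the
  -- raising operators, since each adds a positive integer to the eigenvalue.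
  let A : Set ℂ := {c | ∃ w ∈ N, w ≠ 0 ∧ ⁅h, w⁆ = c • w}
  have hfin : A.Finite := by
    refine Set.Finite.subset (Module.End.finite_hasEigenvalue (LieModule.toEnd ℂ (glS T) X h)) ?_
    rintro c ⟨w, -, hw0, hw⟩
    exact Module.End.hasEigenvalue_of_hasEigenvector
      ⟨Module.End.mem_eigenspace_iff.2 hw, hw0⟩
  have hne : A.Nonempty := by
    obtain ⟨w, hw, hw0, hc⟩ := exists_common_eigenvector
      (fun _ : Fin 1 => LieModule.toEnd ℂ (glS T) X h) (fun _ _ _ => rfl) {0} N.toSubmodule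
      (by rwa [Ne, LieSubmodule.toSubmodule_eq_bot]) (fun _ v hv => N.lie_mem hv)
    obtain ⟨c, hc⟩ := hc 0 (Finset.mem_singleton_self 0)
    exact ⟨c, w, hw, hw0, hc⟩
  obtain ⟨c, ⟨w, hw, hw0, hwc⟩, hmax⟩ := hfin.exists_maximalFor Complex.re A hne
  have hraise : ∀ m n : T, m < n → ⁅EFin T m n, w⁆ = 0 := by
    intro m n hmn
    by_contra h0
    have hlt : depth T n < depth T m :=
      lt_of_le_of_ne ((depth_le_iff m.2 n.2).2 hmn.le) fun h1 =>
        absurd ((depth_le_iff n.2 m.2).1 h1.ge) (not_le.2 hmn)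
    have hmem : c + ((depth T m - depth T n : ℤ) : ℂ) ∈ A := by
      refine ⟨_, N.lie_mem hw, h0, ?_⟩
      rw [leibniz_lie, hdeg, hwc, smul_lie, lie_smul, ← add_smul, add_comm]
    have hz : (0 : ℝ) < ((depth T m - depth T n : ℤ) : ℝ) := by
      exact_mod_cast sub_pos.2 hlt
    have h2 := hmax hmem (by
      rw [Complex.add_re, Complex.intCast_re]; linarith)
    rw [Complex.add_re, Complex.intCast_re] at h2
    linarith
  -- The vectors of `N` killed by all raising operators form a nonzero space stable under the
  -- commuting diagonal matrices, which therefore have a common eigenvector in it.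
  let W : Submodule ℂ X :=
    { carrier := {v | v ∈ N ∧ ∀ m n : T, m < n → ⁅EFin T m n, v⁆ = 0}
      add_mem' := fun {x y} hx hy => ⟨add_mem hx.1 hy.1, fun m n hmn => by
        rw [lie_add, hx.2 m n hmn, hy.2 m n hmn, add_zero]⟩
      zero_mem' := ⟨zero_mem _, fun m n _ => lie_zero _⟩
      smul_mem' := fun t x hx => ⟨N.smul_mem t hx.1, fun m n hmn => by
        rw [lie_smul, hx.2 m n hmn, smul_zero]⟩ }
  obtain ⟨v, hv, hv0, hc⟩ := exists_common_eigenvector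
    (fun i : T => LieModule.toEnd ℂ (glS T) X (EFin T i i))
    (fun i j v => by
      change ⁅EFin T i i, ⁅EFin T j j, v⁆⁆ = ⁅EFin T j j, ⁅EFin T i i, v⁆⁆
      rw [leibniz_lie, (isGlFamily_EFin T).lie_eq]
      by_cases hij : i = j
      · subst hij; simp
      · simp [hij])
    Finset.univ W ((Submodule.ne_bot_iff _).2 ⟨w, ⟨hw, hraise⟩, hw0⟩)
    (fun i v hv => ⟨N.lie_mem hv.1, fun m n hmn => by
      change ⁅EFin T m n, ⁅EFin T i i, v⁆⁆ = 0
      rw [leibniz_lie, hv.2 m n hmn, lie_zero, add_zero, (isGlFamily_EFin T).lie_eq]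
      rw [sub_lie]
      by_cases h2 : n = i
      · subst h2
        rw [if_pos rfl, hv.2 m n hmn, if_neg hmn.ne, zero_lie, sub_zero]
      · rw [if_neg h2, zero_lie, zero_sub, neg_eq_zero]
        by_cases h3 : m = i
        · subst h3
          rw [if_pos rfl, hv.2 m n hmn]
        · rw [if_neg h3, zero_lie]⟩)
  exact ⟨v, hv.1, hv0, hv.2, fun n => hc n (Finset.mem_univ n)⟩

/-- The eigenvalues of a singular vector are read off from any monomial of its image, so they are
natural numbers. Positivity of the form gives dominance: for `i < j` the square norm of `E_{j,i} v`
is `λ_i - λ_j` times that of `v`. -/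
theorem exists_isHWFin [FiniteDimensional ℂ X] {J : Type} [Fintype J]
    (θ : X →ₗ⁅ℂ, glS T⁆ Pol J) (hθ : Function.Injective θ)
    (hT : ∀ x, θ x ∈ supportedIn (Pol J) T) (N : LieSubmodule ℂ (glS T) X) (hN : N ≠ ⊥) :
    ∃ v ∈ N, v ≠ 0 ∧ ∃ nu ∈ Pplus T, IsHWFin T nu v := by
  obtain ⟨v, hvN, hv0, hraise, hwt⟩ := exists_singular_vector N hN
  have hp0 : θ v ≠ 0 := fun h => hv0 (hθ (h.trans (map_zero θ).symm))
  obtain ⟨α, hα⟩ := (MvPolynomial.ne_zero_iff).1 hp0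
  have hin : ∀ n : T, ⁅E n n, θ v⁆ = (monWeight α n : ℂ) • θ v := by
    intro n
    obtain ⟨c, hc⟩ := hwt n
    have h1 : ⁅E n n, θ v⁆ = c • θ v := by
      rw [← map_smul, ← hc, LieModuleHom.map_lie]; rfl
    have h2 := coeff_E_lie n α (θ v)
    rw [h1, MvPolynomial.coeff_smul, smul_eq_mul] at h2
    rw [h1, mul_right_cancel₀ hα h2]
  have hout : ∀ n, n ∉ T → monWeight α n = 0 := by
    intro n hn
    have h2 := coeff_E_lie n α (θ v)
    rw [hT v n n hn, MvPolynomial.coeff_zero, eq_comm, mul_eq_zero, Nat.cast_eq_zero] at h2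
    exact h2.resolve_right hα
  let χ : ℤ →₀ ℕ := Finsupp.onFinset T (monWeight α) fun n hn => by
    by_contra h; exact hn (hout n h)
  refine ⟨v, hvN, hv0, weightOf χ, ⟨monWeight α, weightOf_val χ, hout, ?_⟩, hraise, fun n => ?_⟩
  · intro i hi j hj hij
    by_contra hlt
    rw [not_le] at hlt
    let B := fockForm J
    have h1 : ⁅E i j, θ v⁆ = 0 := by
      have := (θ.map_lie (EFin T ⟨i, hi⟩ ⟨j, hj⟩) v).symm
      rw [hraise ⟨i, hi⟩ ⟨j, hj⟩ hij, map_zero] at this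
      exact this
    have h2 : ⁅E i j, ⁅E j i, θ v⁆⁆ = ((monWeight α i : ℂ) - monWeight α j) • θ v := by
      rw [leibniz_lie, h1, lie_zero, add_zero, E_lie, if_pos rfl, if_pos rfl, sub_lie,
        hin ⟨i, hi⟩, hin ⟨j, hj⟩, sub_smul]
    have h3 : B.form ⁅E j i, θ v⁆ ⁅E j i, θ v⁆ =
        ((monWeight α i : ℂ) - monWeight α j) * B.form (θ v) (θ v) := by
      rw [B.contra, h2, map_smul, smul_eq_mul]
    have h4 : (B.form ⁅E j i, θ v⁆ ⁅E j i, θ v⁆).re =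
        ((monWeight α i : ℝ) - monWeight α j) * (B.form (θ v) (θ v)).re := by
      rw [h3, Complex.mul_re]
      simp
    have h5 := B.pos _ hp0
    have h6 : (monWeight α i : ℝ) - monWeight α j < 0 := sub_neg.2 (Nat.cast_lt.2 hlt)
    have h7 : (B.form ⁅E j i, θ v⁆ ⁅E j i, θ v⁆).re < 0 := h4 ▸ mul_neg_of_neg_of_pos h6 h5
    by_cases h8 : ⁅E j i, θ v⁆ = 0
    · rw [h8, map_zero] at h7
      simp at h7
    · exact absurd (B.pos _ h8) h7.not_gt
  · rw [weightOf_val]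
    refine hθ ?_
    rw [LieModuleHom.map_lie, map_smul]
    exact hin n

/-- Orthogonality to a basis of `N` imposes fewer linear conditions than the dimension of `X`. -/
theorem ContraForm.orthogonal_ne_bot [FiniteDimensional ℂ X] (B : ContraForm (EFin T) X)
    {N : LieSubmodule ℂ (glS T) X} (hN : N ≠ ⊤) :
    B.orthogonal (isGlFamily_EFin T) N ≠ ⊥ := by
  let b := Module.finBasis ℂ N.toSubmodule
  let g : X →ₗ[ℂ] (Fin (Module.finrank ℂ N.toSubmodule) → ℂ) :=
    LinearMap.pi fun i => B.form (b i)
  have hlt : Module.finrank ℂ N.toSubmodule < Module.finrank ℂ X :=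
    Submodule.finrank_lt (by rwa [Ne, LieSubmodule.toSubmodule_eq_top])
  have hker : LinearMap.ker g ≠ ⊥ := LinearMap.ker_ne_bot_of_finrank_lt (by
    rwa [Module.finrank_fin_fun])
  obtain ⟨y, hy, hy0⟩ := (Submodule.ne_bot_iff _).1 hker
  intro hbot
  refine hy0 ((LieSubmodule.mem_bot (R := ℂ) (L := glS T) _).1 (hbot ▸ ?_))
  rw [ContraForm.mem_orthogonal]
  intro x hx
  have h1 : (⟨x, hx⟩ : N.toSubmodule) = ∑ i, b.repr ⟨x, hx⟩ i • b i := (b.sum_repr _).symm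
  have h2 : x = ∑ i, b.repr ⟨x, hx⟩ i • (b i : X) := by
    have h3 := congrArg N.toSubmodule.subtype h1
    rw [map_sum] at h3
    exact h3
  rw [h2, map_sum, LinearMap.sum_apply]
  refine Finset.sum_eq_zero fun i _ => ?_
  have h3 : B.form (b i) y = 0 := congrFun (LinearMap.mem_ker.1 hy) i
  rw [LinearMap.map_smulₛₗ, LinearMap.smul_apply, h3, smul_zero]

/-- A finite-dimensional module that embeds into polynomials is a direct sum of irreducible
highest weight modules. -/
theorem exists_decomposition [FiniteDimensional ℂ X] {J : Type} [Fintype J]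
    (θ : X →ₗ⁅ℂ, glS T⁆ Pol J) (hθ : Function.Injective θ)
    (hT : ∀ x, θ x ∈ supportedIn (Pol J) T) :
    ∃ (N : ℕ) (nu : Fin N → Weight), (∀ i, nu i ∈ Pplus T) ∧
      Nonempty (X ≃ₗ⁅ℂ, glS T⁆ ⨁ i, LFin T (nu i)) := by
  let B : ContraForm (EFin T) X := ((fockForm J).toFin T).comap θ hθ
  -- Otherwise the orthogonal complement of the sum of all simple submodules would contain a simple
  -- submodule, which would be orthogonal to itself.
  have htop : sSup {a : LieSubmodule ℂ (glS T) X | IsAtom a} = ⊤ := by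
    by_contra h
    obtain ⟨a, ha, hle⟩ := (IsAtomic.eq_bot_or_exists_atom_le _).resolve_left
      (B.orthogonal_ne_bot h)
    refine ha.1 ((LieSubmodule.eq_bot_iff _).2 fun x hx => ?_)
    exact B.eq_zero (hle hx x ((le_sSup ha : a ≤ _) hx))
  obtain ⟨s, hind, hcompl, hatom⟩ := exists_sSupIndep_isCompl_sSup_atoms htop ⊥
  have hs : sSup s = ⊤ := by simpa using hcompl.sup_eq_top
  have : Finite s := WellFoundedGT.finite_of_sSupIndep hind
  have hex : ∀ a : s, ∃ nu ∈ Pplus T, ∃ f : LFin T nu →ₗ⁅ℂ, glS T⁆ X,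
      Function.Injective f ∧ f.range = a := by
    intro a
    obtain ⟨v, hva, hv0, nu, hnu, hv⟩ := exists_isHWFin θ hθ hT a (hatom a.2).1
    obtain ⟨f, hf, hfv⟩ := hv.exists_hom hnu B hv0
    have hle : f.range ≤ a := by
      have h1 : (⊤ : LieSubmodule ℂ (glS T) (LFin T nu)) ≤ (a : LieSubmodule ℂ (glS T) X).comap f := by
        rw [← lieSpan_lfinGen, LieSubmodule.lieSpan_le, Set.singleton_subset_iff]
        change f (lfinGen T nu) ∈ (a : LieSubmodule ℂ (glS T) X)
        rwa [hfv]
      intro x hx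
      obtain ⟨y, rfl⟩ := (LieModuleHom.mem_range _ _).1 hx
      exact h1 (LieSubmodule.mem_top y)
    refine ⟨nu, hnu, f, hf, ((hatom a.2).le_iff.1 hle).resolve_left fun h => hv0 ?_⟩
    have h2 : v ∈ f.range := (LieModuleHom.mem_range _ _).2 ⟨_, hfv⟩
    rwa [h, LieSubmodule.mem_bot] at h2
  choose nu hnu f hf hrange using hex
  obtain ⟨N, ⟨e⟩⟩ := Finite.exists_equiv_fin s
  refine ⟨N, fun i => nu (e.symm i), fun i => hnu _, nonempty_equiv_directSum
    (fun i => f (e.symm i)) (fun i => hf _) ?_ ?_⟩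
  · simp only [hrange]
    exact ((sSupIndep_iff s).1 hind).comp e.symm.injective
  · simp only [hrange]
    rw [e.symm.iSup_comp (g := fun a : s => (a : LieSubmodule ℂ (glS T) X)), ← sSup_eq_iSup', hs]

end Decomposition

/-! ### Finite dimensionality of `L(λ_T)` -/

theorem finite_monomials {J : Type} [Fintype J] (T : Finset ℤ) (d : ℕ) :
    {α : ℤ × J →₀ ℕ | (∀ n, n ∉ T → monWeight α n = 0) ∧ ∑ n ∈ T, monWeight α n = d}.Finite := by
  classical
  let β : ℤ × J →₀ ℕ := Finsupp.onFinset (T ×ˢ Finset.univ) (fun s => if s.1 ∈ T then d else 0)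
    fun s hs => by
      by_contra h
      have : s.1 ∉ T := fun h1 => h (Finset.mem_product.2 ⟨h1, Finset.mem_univ _⟩)
      simp [this] at hs
  refine (Set.finite_Iic β).subset ?_
  rintro α ⟨h1, h2⟩ ⟨n, j⟩
  have h3 : α (n, j) ≤ monWeight α n :=
    Finset.single_le_sum (f := fun j => α (n, j)) (fun _ _ => Nat.zero_le _) (Finset.mem_univ j)
  change α (n, j) ≤ if n ∈ T then d else 0
  split_ifs with hn
  · refine h3.trans (h2 ▸ ?_)
    exact Finset.single_le_sum (f := fun n => monWeight α n) (fun _ _ => Nat.zero_le _) hn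
  · rwa [h1 n hn] at h3

/-- The element `δ = ∑_{i ∈ T} E_{i,i}` commutes with `𝔤𝔩_T`, so the module generated by `p`
consists of polynomials of fixed degree in the variables with rows in `T`, and only finitely many
monomials are available. -/
theorem IsHWInf.finiteDimensional_lfin {T : Finset ℤ} {lam : Weight} (hlam : lam ∈ Pplus T)
    {J : Type} [Fintype J] {p : Pol J} (hw : IsHWInf T lam p) (hp : p ≠ 0) :
    FiniteDimensional ℂ (LFin T lam) := by
  obtain ⟨f, hf, hfv⟩ := hw.isHWFin.exists_hom hlam ((fockForm _).toFin _) hp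
  let c : ℤ → ℤ := fun i => if i ∈ T then 1 else 0
  let δ := degreeElement E T c
  have hδ : ∀ q : Pol J, ⁅δ, q⁆ = ∑ i ∈ T, ⁅E i i, q⁆ := fun q => by
    rw [show δ = ∑ i ∈ T, (c i : ℂ) • E i i from rfl, sum_lie]
    refine Finset.sum_congr rfl fun i hi => ?_
    simp [c, hi]
  obtain ⟨l, hl, -, -⟩ := id hlam
  let d := ∑ i ∈ T, l i
  let D : LieSubmodule ℂ (glS T) (Pol J) := (isGlFamily_EFin T).toLieSubmodule
    ((LieModule.toEnd ℂ gl (Pol J) δ).eigenspace d) fun a b q hq => by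
      rw [Module.End.mem_eigenspace_iff] at hq ⊢
      change ⁅δ, ⁅E a b, q⁆⁆ = (d : ℂ) • ⁅E a b, q⁆
      have hq' : ⁅δ, q⁆ = (d : ℂ) • q := hq
      rw [leibniz_lie, isGlFamily_E.degreeElement_lie (fun i hi => if_neg hi), hq', lie_smul]
      simp [a.2, b.2]
  have h1 : (⊤ : LieSubmodule ℂ (glS T) (LFin T lam)) ≤ (supportedFin (Pol J) T ⊓ D).comap f := by
    rw [← lieSpan_lfinGen, LieSubmodule.lieSpan_le, Set.singleton_subset_iff]
    change f (lfinGen T lam) ∈ supportedFin (Pol J) T ⊓ D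
    rw [hfv]
    refine (LieSubmodule.mem_inf _ _ _).2 ⟨hw.kill, Module.End.mem_eigenspace_iff.2 ?_⟩
    change ⁅δ, p⁆ = (d : ℂ) • p
    rw [hδ, Nat.cast_sum, Finset.sum_smul]
    refine Finset.sum_congr rfl fun i hi => ?_
    rw [hw.weight i hi, hl]
  let F := {α : ℤ × J →₀ ℕ | (∀ n, n ∉ T → monWeight α n = 0) ∧ ∑ n ∈ T, monWeight α n = d}
  have hF : F.Finite := finite_monomials T d
  let V : Submodule ℂ (Pol J) :=
    Submodule.span ℂ ((fun α => MvPolynomial.monomial α (1 : ℂ)) '' F)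
  have hV : FiniteDimensional ℂ V := FiniteDimensional.span_of_finite ℂ (hF.image _)
  have hfV : ∀ x, f x ∈ V := by
    intro x
    have h2 := (LieSubmodule.mem_inf _ _ _).1 (h1 (LieSubmodule.mem_top x))
    have h3 : f x ∈ supportedIn (Pol J) T := h2.1
    have h4 : ⁅δ, f x⁆ = (d : ℂ) • f x := Module.End.mem_eigenspace_iff.1 h2.2
    rw [(f x).as_sum]
    refine sum_mem fun α hα => ?_
    have h5 : MvPolynomial.monomial α (MvPolynomial.coeff α (f x)) =
        MvPolynomial.coeff α (f x) • (MvPolynomial.monomial α (1 : ℂ) : Pol J) := by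
      rw [MvPolynomial.smul_monomial, smul_eq_mul, mul_one]
    rw [h5]
    refine V.smul_mem _ (Submodule.subset_span ⟨α, ⟨fun n hn => ?_, ?_⟩, rfl⟩)
    · have h6 := coeff_E_lie n α (f x)
      rw [h3 n n hn, MvPolynomial.coeff_zero, eq_comm, mul_eq_zero, Nat.cast_eq_zero] at h6
      exact h6.resolve_right (MvPolynomial.mem_support_iff.1 hα)
    · have h6 := congrArg (MvPolynomial.coeff α) h4
      rw [hδ, MvPolynomial.coeff_sum, MvPolynomial.coeff_smul, smul_eq_mul] at h6
      simp only [coeff_E_lie] at h6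
      rw [← Finset.sum_mul, ← Nat.cast_sum] at h6
      exact_mod_cast mul_right_cancel₀ (MvPolynomial.mem_support_iff.1 hα) h6
  exact Module.Finite.of_injective ((f : LFin T lam →ₗ[ℂ] Pol J).codRestrict V hfV)
    fun x y h => hf (congrArg Subtype.val h)

theorem finiteDimensional_lfin {r n : ℤ} {lam : Weight} (hlam : lam ∈ Pplus (Finset.Icc r n)) :
    FiniteDimensional ℂ (LFin (Finset.Icc r n) lam) := by
  obtain ⟨p, hp, hw⟩ := exists_isHWInf r n lam hlam
  exact hw.finiteDimensional_lfin hlam hp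

/-! ### Comparison of decompositions over `𝔤𝔩_∞` and over `𝔤𝔩_T` -/

section Comparison

/-- Two modules with equivariant injective maps to the same space, with the same image, are
isomorphic. -/
theorem nonempty_equiv_of_range_eq {g X Y Z : Type*} [LieRing g] [LieAlgebra ℂ g]
    [AddCommGroup X] [Module ℂ X] [LieRingModule g X] [AddCommGroup Y] [Module ℂ Y]
    [LieRingModule g Y] [AddCommGroup Z] [Module ℂ Z] (act : g → Z → Z) (f : X →ₗ[ℂ] Z)
    (h : Y →ₗ[ℂ] Z) (hf : Function.Injective f) (hh : Function.Injective h)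
    (hrange : LinearMap.range f = LinearMap.range h) (hfact : ∀ a x, f ⁅a, x⁆ = act a (f x))
    (hhact : ∀ a y, h ⁅a, y⁆ = act a (h y)) : Nonempty (X ≃ₗ⁅ℂ, g⁆ Y) := by
  let e : X ≃ₗ[ℂ] Y := (LinearEquiv.ofInjective f hf).trans
    ((LinearEquiv.ofEq _ _ hrange).trans (LinearEquiv.ofInjective h hh).symm)
  have he : ∀ x, h (e x) = f x := fun x =>
    congrArg Subtype.val ((LinearEquiv.ofInjective h hh).apply_symm_apply
      ((LinearEquiv.ofEq _ _ hrange) ((LinearEquiv.ofInjective f hf) x)))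
  exact ⟨{ e with
    map_lie' := fun {a x} => hh (by
      change h (e ⁅a, x⁆) = h ⁅a, e x⁆
      rw [he, hfact, hhact, he]) }⟩

variable {r nbar : ℤ} {M X : Type*} [AddCommGroup M] [Module ℂ M] [LieRingModule gl M]
  [LieModule ℂ gl M] [AddCommGroup X] [Module ℂ X] [LieRingModule (glS (Finset.Icc r nbar)) X]
  [LieModule ℂ (glS (Finset.Icc r nbar)) X] {I : Type} {nu : I → Weight}

/-- The highest weight vectors `v i` of the summands are supported in `T`, so each generates a copy
of `L(T, ν_i)` in `M`. These copies are independent because generation creates no new supported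
vectors, and they span because supported vectors generate `M`. -/
theorem inf_decomposition_of_fin (B : ContraForm E M)
    (hgen : ∀ V : Submodule ℂ M, supportedIn M (Finset.Icc r nbar : Finset ℤ) ≤ V →
      (∀ m n, ∀ x ∈ V, ⁅E m n, x⁆ ∈ V) → V = ⊤)
    (θ : X →ₗ[ℂ] M) (hθ : Function.Injective θ)
    (hlie : ∀ (a : glS (Finset.Icc r nbar)) (x : X), θ ⁅a, x⁆ = ⁅(a : gl), θ x⁆)
    (hrange : LinearMap.range θ = supportedIn M (Finset.Icc r nbar : Finset ℤ))
    (hnu : ∀ i, nu i ∈ Pplus (Finset.Icc r nbar))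
    (e : X ≃ₗ⁅ℂ, glS (Finset.Icc r nbar)⁆ ⨁ i, LFin (Finset.Icc r nbar) (nu i)) :
    Nonempty (M ≃ₗ⁅ℂ, gl⁆ ⨁ i, LInf (Finset.Icc r nbar) (nu i)) := by
  classical
  let T := Finset.Icc r nbar
  let θ' : X →ₗ⁅ℂ, glS T⁆ M := { θ with map_lie' := fun {a x} => hlie a x }
  let κ : (⨁ i, LFin T (nu i)) →ₗ⁅ℂ, glS T⁆ M :=
    θ'.comp (e.symm : (⨁ i, LFin T (nu i)) →ₗ⁅ℂ, glS T⁆ X)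
  have hκinj : Function.Injective κ := hθ.comp e.symm.injective
  have hκsupp : ∀ y, κ y ∈ supportedIn M (T : Set ℤ) := fun y => hrange ▸ ⟨e.symm y, rfl⟩
  have hκsurj : ∀ x ∈ supportedIn M (T : Set ℤ), ∃ y, κ y = x := by
    intro x hx
    rw [← hrange] at hx
    obtain ⟨y, rfl⟩ := hx
    exact ⟨e y, congrArg θ (e.symm_apply_apply y)⟩
  let κi : ∀ i, LFin T (nu i) →ₗ⁅ℂ, glS T⁆ M := fun i =>
    κ.comp (DirectSum.lieModuleOf ℂ I (glS T) (fun i => LFin T (nu i)) i)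
  have hof : ∀ i, Function.Injective
      (DirectSum.lieModuleOf ℂ I (glS T) (fun i => LFin T (nu i)) i) :=
    fun i => DirectSum.of_injective i
  let v : I → M := fun i => κi i (lfinGen T (nu i))
  have hv0 : ∀ i, v i ≠ 0 := fun i h =>
    lfinGen_ne_zero (hnu i) (hof i (hκinj (h.trans
      ((map_zero (κi i)).symm.trans rfl))))
  have hv : ∀ i, IsHWInf T (nu i) (v i) := fun i => by
    have h1 := (isHWFin_lfinGen T (nu i)).map (κi i)
    exact ⟨fun m n hn => hκsupp _ m n hn, fun m hm n hn => h1.raise ⟨m, hm⟩ ⟨n, hn⟩,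
      fun n hn => h1.weight ⟨n, hn⟩⟩
  choose f hf hfv using fun i => (hv i).exists_hom (hnu i) B (hv0 i)
  have hrange_le : ∀ (i : I) (N : LieSubmodule ℂ gl M), v i ∈ N → (f i).range ≤ N := by
    intro i N hN x hx
    obtain ⟨y, rfl⟩ := (LieModuleHom.mem_range _ _).1 hx
    have h1 : (⊤ : LieSubmodule ℂ gl (LInf T (nu i))) ≤ N.comap (f i) := by
      rw [← lieSpan_linfGen, LieSubmodule.lieSpan_le, Set.singleton_subset_iff]
      change f i (linfGen T (nu i)) ∈ N
      rwa [hfv]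
    exact h1 (LieSubmodule.mem_top y)
  have hmem : ∀ i, v i ∈ (f i).range := fun i => (LieModuleHom.mem_range _ _).2 ⟨_, hfv i⟩
  refine nonempty_equiv_directSum f hf (fun i => ?_) ?_
  · rw [disjoint_iff]
    by_contra hne
    set R := ⨆ (j) (_ : j ≠ i), (f j).range with hR
    have : LieModule.IsIrreducible ℂ gl (LInf T (nu i)) := linf_isIrreducible (hnu i)
    have h1 : R.comap (f i) = ⊤ := by
      refine (eq_bot_or_eq_top (R.comap (f i))).resolve_left fun h => hne ?_
      rw [LieSubmodule.eq_bot_iff]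
      intro x hx
      obtain ⟨hx1, hx2⟩ := (LieSubmodule.mem_inf _ _ _).1 hx
      obtain ⟨y, rfl⟩ := (LieModuleHom.mem_range _ _).1 hx1
      have h2 : y ∈ R.comap (f i) := hx2
      rw [h, LieSubmodule.mem_bot] at h2
      rw [h2, map_zero]
    have h2 : v i ∈ R := by
      have : linfGen T (nu i) ∈ R.comap (f i) := h1 ▸ LieSubmodule.mem_top _
      rw [← hfv]; exact this
    -- By irreducibility a nonzero intersection puts `v i` into the sum `R` of the other copies.
    -- That sum is generated by vectors of `V`, the image of the elements with zero `i`-th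
    -- component, so `v i` would lie in `V`.
    let Y : Submodule ℂ (⨁ i, LFin T (nu i)) :=
      LinearMap.ker (DirectSum.component ℂ I (fun i => LFin T (nu i)) i)
    let V : Submodule ℂ M := Y.map (κ : (⨁ i, LFin T (nu i)) →ₗ[ℂ] M)
    have h3 : R ≤ LieSubmodule.lieSpan ℂ gl (V : Set M) := by
      refine iSup₂_le fun j hj => hrange_le j _ (LieSubmodule.subset_lieSpan ?_)
      refine ⟨DirectSum.lieModuleOf ℂ I (glS T) (fun i => LFin T (nu i)) j (lfinGen T (nu j)),
        ?_, rfl⟩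
      exact DirectSum.of_eq_of_ne (β := fun i => LFin T (nu i)) j i _ hj.symm
    have h4 : v i ∈ V := by
      refine mem_of_mem_lieSpan B ?_ ?_ (hκsupp _) (h3 h2)
      · rintro _ ⟨y, -, rfl⟩
        exact hκsupp y
      · rintro m hm n hn _ ⟨y, hy, rfl⟩
        refine ⟨⁅EFin T ⟨m, hm⟩ ⟨n, hn⟩, y⁆, ?_, κ.map_lie _ _⟩
        have h5 : y i = 0 := hy
        change (⁅EFin T ⟨m, hm⟩ ⟨n, hn⟩, y⁆ : ⨁ i, LFin T (nu i)) i = 0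
        rw [DirectSum.lie_module_bracket_apply, h5, lie_zero]
    obtain ⟨y, hy, hyv⟩ := h4
    have h5 : y = DirectSum.lieModuleOf ℂ I (glS T) (fun i => LFin T (nu i)) i
      (lfinGen T (nu i)) := hκinj hyv
    have h6 : y i = 0 := hy
    refine lfinGen_ne_zero (hnu i) ?_
    rw [h5] at h6
    exact (DirectSum.of_eq_same (β := fun i => LFin T (nu i)) i _).symm.trans h6
  · rw [← LieSubmodule.toSubmodule_eq_top]
    refine hgen _ ?_ fun m n x hx => LieSubmodule.lie_mem _ hx
    intro x hx
    obtain ⟨y, rfl⟩ := hκsurj x hx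
    induction y using DirectSum.induction_on with
    | zero => rw [map_zero]; exact zero_mem _
    | of i y =>
      let N : LieSubmodule ℂ (glS T) (LFin T (nu i)) :=
        { ((⨆ j, (f j).range : LieSubmodule ℂ gl M).toSubmodule.comap
            (κi i : LFin T (nu i) →ₗ[ℂ] M)) with
          lie_mem := fun {a z} hz => by
            change κi i ⁅a, z⁆ ∈ (⨆ j, (f j).range : LieSubmodule ℂ gl M)
            rw [LieModuleHom.map_lie]
            exact LieSubmodule.lie_mem _ hz }
      have h1 : N = ⊤ := by
        rw [← top_le_iff, ← lieSpan_lfinGen, LieSubmodule.lieSpan_le, Set.singleton_subset_iff]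
        exact (le_iSup (fun j => (f j).range) i : _) (hmem i)
      exact (h1 ▸ LieSubmodule.mem_top y : y ∈ N)
    | add y z hy hz =>
      rw [map_add]
      exact add_mem (hy (hκsupp y)) (hz (hκsupp z))

/-- A vector of a direct sum is supported in `T` exactly when its components are, and the supported
part of `L(T, ν_i)` is `L((ν_i)_T)`. This direction needs no generation hypothesis. -/
theorem fin_decomposition_of_inf
    (θ : X →ₗ[ℂ] M) (hθ : Function.Injective θ)
    (hlie : ∀ (a : glS (Finset.Icc r nbar)) (x : X), θ ⁅a, x⁆ = ⁅(a : gl), θ x⁆)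
    (hrange : LinearMap.range θ = supportedIn M (Finset.Icc r nbar : Finset ℤ))
    (hnu : ∀ i, nu i ∈ Pplus (Finset.Icc r nbar))
    (e : M ≃ₗ⁅ℂ, gl⁆ ⨁ i, LInf (Finset.Icc r nbar) (nu i)) :
    Nonempty (X ≃ₗ⁅ℂ, glS (Finset.Icc r nbar)⁆ ⨁ i, LFin (Finset.Icc r nbar) (nu i)) := by
  classical
  let T := Finset.Icc r nbar
  choose f hf _ hfr using fun i => exists_lfin_hom_linf (le_refl nbar) (hnu i)
  let Q := ⨁ i, LInf T (nu i)
  let e' : M →ₗ⁅ℂ, gl⁆ Q := e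
  have he' : Function.Bijective e' := ⟨e.injective, e.surjective⟩
  let ψ : (⨁ i, LFin T (nu i)) →ₗ[ℂ] Q :=
    DFinsupp.mapRange.linearMap fun i => (f i : LFin T (nu i) →ₗ[ℂ] LInf T (nu i))
  have hψ : ∀ y i, ψ y i = f i (y i) := fun y i =>
    DFinsupp.mapRange_apply (fun i => f i) (fun i => map_zero (f i)) y i
  refine nonempty_equiv_of_range_eq (fun (a : glS T) (z : Q) => ⁅(a : gl), z⁆)
    ((e' : M →ₗ[ℂ] Q).comp θ) ψ (he'.injective.comp hθ) ?_ ?_ ?_ ?_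
  · intro x y hxy
    refine DFinsupp.ext fun i => hf i ?_
    rw [← hψ, ← hψ, hxy]
  · ext z
    constructor
    · rintro ⟨x, rfl⟩
      have h1 : θ x ∈ supportedIn M (T : Set ℤ) := hrange ▸ ⟨x, rfl⟩
      have h2 : ∀ i, ∃ y, f i y = (e' (θ x)) i := fun i => by
        refine (hfr i _).1 fun m n hn => ?_
        rw [← DirectSum.lie_module_bracket_apply, ← LieModuleHom.map_lie, h1 m n hn, map_zero]
        rfl
      have h3 : ∀ i, Function.invFun (f i) 0 = 0 := fun i => by
        have := Function.leftInverse_invFun (hf i) 0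
        rwa [map_zero] at this
      refine ⟨DFinsupp.mapRange (fun i => Function.invFun (f i)) h3 (e' (θ x)), ?_⟩
      refine DFinsupp.ext fun i => ?_
      change ψ _ i = e' (θ x) i
      rw [hψ]
      change f i ((DFinsupp.mapRange (fun i => Function.invFun (f i)) h3 (e' (θ x))) i) = _
      rw [DFinsupp.mapRange_apply]
      exact Function.invFun_eq (h2 i)
    · rintro ⟨y, rfl⟩
      obtain ⟨x, hx⟩ := he'.surjective (ψ y)
      have h1 : x ∈ supportedIn M (T : Set ℤ) := fun m n hn => by
        refine he'.injective ?_
        rw [LieModuleHom.map_lie, hx, map_zero]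
        refine DFinsupp.ext fun i => ?_
        change ⁅E m n, ψ y⁆ i = 0
        rw [DirectSum.lie_module_bracket_apply, hψ]
        exact (hfr i _).2 ⟨y i, rfl⟩ m n hn
      rw [← hrange] at h1
      obtain ⟨w, rfl⟩ := h1
      exact ⟨w, hx⟩
  · intro a x
    change e' (θ ⁅a, x⁆) = ⁅(a : gl), e' (θ x)⁆
    rw [hlie, LieModuleHom.map_lie]
  · intro a y
    refine DFinsupp.ext fun i => ?_
    change ψ ⁅a, y⁆ i = ⁅(a : gl), ψ y⁆ i
    rw [hψ, DirectSum.lie_module_bracket_apply, DirectSum.lie_module_bracket_apply,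
      LieModuleHom.map_lie, hψ]
    rfl

end Comparison

/-! ### Tensor products -/

section Tensor

variable {r n nbar : ℤ} {lam mu : Weight}

/-- A tensor of weight vectors has weight `χ + ψ`. As no weight is negative, either both factors are
supported in the interval or the tensor lies in the outer part, which meets the supported vectors
only in zero. -/
theorem exists_tensor_hom (h : n ≤ nbar) (hlam : lam ∈ Pplus (Finset.Icc r n))
    (hmu : mu ∈ Pplus (Finset.Icc r n)) :
    ∃ θ : LFin (Finset.Icc r nbar) lam ⊗[ℂ] LFin (Finset.Icc r nbar) mu →ₗ[ℂ]
        LInf (Finset.Icc r n) lam ⊗[ℂ] LInf (Finset.Icc r n) mu,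
      Function.Injective θ ∧ (∀ (a : glS (Finset.Icc r nbar)) x, θ ⁅a, x⁆ = ⁅(a : gl), θ x⁆) ∧
      LinearMap.range θ = supportedIn (LInf (Finset.Icc r n) lam ⊗[ℂ] LInf (Finset.Icc r n) mu)
        (Finset.Icc r nbar : Finset ℤ) := by
  obtain ⟨f, hf, -, hfr⟩ := exists_lfin_hom_linf h hlam
  obtain ⟨f', hf', -, hfr'⟩ := exists_lfin_hom_linf h hmu
  have hP := linf_isPolynomial hlam
  have hP' := linf_isPolynomial hmu
  obtain ⟨d, hd⟩ := exists_weightSpan_linf hlam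
  obtain ⟨d', hd'⟩ := exists_weightSpan_linf hmu
  obtain ⟨B⟩ := (hP.tensor hP').nonempty_form
  let θ := TensorProduct.map (f : LFin (Finset.Icc r nbar) lam →ₗ[ℂ] LInf (Finset.Icc r n) lam)
    (f' : LFin (Finset.Icc r nbar) mu →ₗ[ℂ] LInf (Finset.Icc r n) mu)
  have hθt : ∀ x y, θ (x ⊗ₜ y) = f x ⊗ₜ f' y := fun x y => rfl
  refine ⟨θ, TensorProduct.map_injective_of_flat_flat _ _ hf hf', fun a t => ?_,
    le_antisymm ?_ fun t ht => ?_⟩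
  · induction t using TensorProduct.induction_on with
    | zero => rw [lie_zero, map_zero, lie_zero]
    | tmul x y =>
      rw [TensorProduct.LieModule.lie_tmul_right, map_add, hθt, hθt, hθt,
        TensorProduct.LieModule.lie_tmul_right, LieModuleHom.map_lie, LieModuleHom.map_lie]
      rfl
    | add s t hs ht => rw [lie_add, map_add, hs, ht, map_add, lie_add]
  · rintro _ ⟨t, rfl⟩
    induction t using TensorProduct.induction_on with
    | zero => rw [map_zero]; exact zero_mem _
    | tmul x y =>
      intro a b hb
      rw [hθt, TensorProduct.LieModule.lie_tmul_right, (hfr _).2 ⟨x, rfl⟩ a b hb,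
        (hfr' _).2 ⟨y, rfl⟩ a b hb, TensorProduct.zero_tmul, TensorProduct.tmul_zero, add_zero]
    | add s t hs ht => rw [map_add]; exact add_mem hs ht
  · refine mem_of_mem_sup_outerPart B ?_ ht ?_
    · rintro _ ⟨t, rfl⟩
      clear ht
      induction t using TensorProduct.induction_on with
      | zero => rw [map_zero]; exact zero_mem _
      | tmul x y =>
        intro a b hb
        rw [hθt, TensorProduct.LieModule.lie_tmul_right, (hfr _).2 ⟨x, rfl⟩ a b hb,
          (hfr' _).2 ⟨y, rfl⟩ a b hb, TensorProduct.zero_tmul, TensorProduct.tmul_zero, add_zero]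
      | add s t hs ht => rw [map_add]; exact add_mem hs ht
    · rw [tensor_weight_induction (W := LinearMap.range θ ⊔ outerPart _ _) hd hd']
      · exact Submodule.mem_top
      · intro χ ψ x y _ _ hx hy
        by_cases hout : ∀ i, i ∉ ((Finset.Icc r nbar : Finset ℤ) : Set ℤ) → (χ + ψ) i = 0
        · obtain ⟨x, rfl⟩ := (hfr x).1 (hx.mem_supportedIn hP fun i hi =>
            (Nat.add_eq_zero_iff.1 (hout i hi)).1)
          obtain ⟨y, rfl⟩ := (hfr' y).1 (hy.mem_supportedIn hP' fun i hi =>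
            (Nat.add_eq_zero_iff.1 (hout i hi)).2)
          exact Submodule.mem_sup_left ⟨x ⊗ₜ y, rfl⟩
        · push Not at hout
          obtain ⟨i, hi, h0⟩ := hout
          obtain ⟨k, hk⟩ := Nat.exists_eq_succ_of_ne_zero h0
          refine Submodule.mem_sup_right (Submodule.subset_span ⟨i, hi, k, ?_⟩)
          rw [(hx.tmul hy) i, hk, Nat.succ_eq_add_one, Nat.cast_add, Nat.cast_one]

/-! ### Fresh indices and cyclicity -/

variable {M : Type*} [AddCommGroup M] [Module ℂ M] [LieRingModule gl M] [LieModule ℂ gl M]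
  {M' : Type*} [AddCommGroup M'] [Module ℂ M'] [LieRingModule gl M'] [LieModule ℂ gl M']

theorem exists_fresh {T : Set ℤ} (hT : T.Infinite) (χ : ℤ →₀ ℕ) : ∃ t ∈ T, χ t = 0 := by
  obtain ⟨t, ht, h⟩ := hT.exists_notMem_finset χ.support
  exact ⟨t, ht, Finsupp.notMem_support_iff.1 h⟩

/-- An infinite `T` always has a fresh index, so supported vectors generate `M`; were they all zero,
`M` would be zero. -/
theorem exists_ne_zero_mem_supportedIn [Nontrivial M] (hM : IsPolynomial M) {d : ℕ}
    (hd : weightSpan M d = ⊤) {T : Set ℤ} (hT : T.Infinite) :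
    ∃ v ∈ supportedIn M T, v ≠ 0 := by
  refine (Submodule.ne_bot_iff _).1 fun h => ?_
  refine bot_ne_top (α := Submodule ℂ M) (eq_top_of_supportedIn_le hM hd
    (fun χ _ _ _ _ => exists_fresh hT χ) h.le fun i t _ x hx => ?_)
  rw [(Submodule.mem_bot ℂ).1 hx, lie_zero]
  exact zero_mem _

/-- A nonzero `V` generates `M`, yet generation adds no supported vectors to it. In effect the
supported part of `M` is irreducible under the matrix units of `T`. -/
theorem supportedIn_le_of_irreducible [LieModule.IsIrreducible ℂ gl M] (B : ContraForm E M)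
    {T : Set ℤ} {V : Submodule ℂ M} (hV : V ≤ supportedIn M T)
    (hst : ∀ m ∈ T, ∀ n ∈ T, ∀ x ∈ V, ⁅E m n, x⁆ ∈ V) {v : M} (hv : v ∈ V) (h0 : v ≠ 0) :
    supportedIn M T ≤ V := fun x hx => by
  refine mem_of_mem_lieSpan B hV hst hx ?_
  rw [(eq_bot_or_eq_top (LieSubmodule.lieSpan ℂ gl (V : Set M))).resolve_left fun h => h0 ?_]
  · exact LieSubmodule.mem_top x
  · have : v ∈ LieSubmodule.lieSpan ℂ gl (V : Set M) := LieSubmodule.subset_lieSpan hv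
    rwa [h, LieSubmodule.mem_bot] at this

/-- The tensor product of two irreducible polynomial modules is cyclic. -/
theorem isCyclicModule_tensor [LieModule.IsIrreducible ℂ gl M] [LieModule.IsIrreducible ℂ gl M']
    (hM : IsPolynomial M) (hM' : IsPolynomial M') {d d' : ℕ} (hd : weightSpan M d = ⊤)
    (hd' : weightSpan M' d' = ⊤) : IsCyclicModule gl (M ⊗[ℂ] M') := by
  have : Nontrivial M := (LieSubmodule.nontrivial_iff ℂ gl M).1 inferInstance
  have : Nontrivial M' := (LieSubmodule.nontrivial_iff ℂ gl M').1 inferInstance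
  obtain ⟨B⟩ := hM.nonempty_form
  obtain ⟨B'⟩ := hM'.nonempty_form
  have hC : (Set.Ici (0 : ℤ)).Infinite := Set.Ici_infinite 0
  have hD : (Set.Iio (0 : ℤ)).Infinite := Set.Iio_infinite 0
  obtain ⟨v, hv, hv0⟩ := exists_ne_zero_mem_supportedIn hM hd hC
  obtain ⟨w, hw, hw0⟩ := exists_ne_zero_mem_supportedIn hM' hd' hD
  refine ⟨v ⊗ₜ w, ?_⟩
  set N := LieSubmodule.lieSpan ℂ gl {v ⊗ₜ[ℂ] w} with hN
  have hlie : ∀ m n (x : M) (y : M'), x ⊗ₜ y ∈ N → ⁅E m n, x⁆ ⊗ₜ y + x ⊗ₜ ⁅E m n, y⁆ ∈ N := by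
    intro m n x y h
    rw [← TensorProduct.LieModule.lie_tmul_right]
    exact N.lie_mem h
  -- Matrix units with nonnegative column kill `w`, so they act on the first factor alone.
  have h1 : ∀ x ∈ supportedIn M (Set.Ici 0), x ⊗ₜ w ∈ N := by
    let V : Submodule ℂ M := supportedIn M (Set.Ici 0) ⊓
      N.toSubmodule.comap ((TensorProduct.mk ℂ M M').flip w)
    have hle : supportedIn M (Set.Ici 0) ≤ V := by
      refine supportedIn_le_of_irreducible B inf_le_left ?_
        (⟨hv, LieSubmodule.subset_lieSpan rfl⟩ : v ∈ V) hv0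
      rintro m hm n hn x ⟨hx, hxN⟩
      refine ⟨lie_mem_supportedIn hx hm n, ?_⟩
      have h := hlie m n x w hxN
      rwa [hw m n (Set.notMem_Iio.2 hn), TensorProduct.tmul_zero, add_zero] at h
    exact fun x hx => (hle hx).2
  have h2 : ∀ y ∈ supportedIn M' (Set.Iio 0), ∀ x ∈ supportedIn M (Set.Ici 0), x ⊗ₜ y ∈ N := by
    let V : Submodule ℂ M' := supportedIn M' (Set.Iio 0) ⊓
      ⨅ x : supportedIn M (Set.Ici 0), N.toSubmodule.comap (TensorProduct.mk ℂ M M' x)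
    have hmem : ∀ y, y ∈ V ↔ y ∈ supportedIn M' (Set.Iio 0) ∧
        ∀ x ∈ supportedIn M (Set.Ici 0), x ⊗ₜ y ∈ N := by
      intro y
      simp only [V, Submodule.mem_inf, Submodule.mem_iInf, Subtype.forall]
      rfl
    have hle : supportedIn M' (Set.Iio 0) ≤ V := by
      refine supportedIn_le_of_irreducible B' inf_le_left ?_ ((hmem w).2 ⟨hw, h1⟩) hw0
      intro m hm n hn y hy
      obtain ⟨hy, hyN⟩ := (hmem y).1 hy
      refine (hmem _).2 ⟨lie_mem_supportedIn hy hm n, fun x hx => ?_⟩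
      have h := hlie m n x y (hyN x hx)
      rwa [hx m n (Set.notMem_Ici.2 hn), TensorProduct.zero_tmul, zero_add] at h
    exact fun y hy => ((hmem y).1 (hle hy)).2
  -- The units `E_{i,t}` with `t ≥ 0` and arbitrary `i` still kill `y`, and these suffice to
  -- generate `M` from its vectors supported in the nonnegative integers.
  have h3 : ∀ y ∈ supportedIn M' (Set.Iio 0), ∀ x : M, x ⊗ₜ y ∈ N := by
    intro y hy
    let V : Submodule ℂ M :=
      ⨅ y : supportedIn M' (Set.Iio 0), N.toSubmodule.comap ((TensorProduct.mk ℂ M M').flip y)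
    have hmem : ∀ x, x ∈ V ↔ ∀ y ∈ supportedIn M' (Set.Iio 0), x ⊗ₜ y ∈ N := by
      intro x
      simp only [V, Submodule.mem_iInf, Subtype.forall]
      rfl
    have hV : V = ⊤ := by
      refine eq_top_of_supportedIn_le hM hd (fun χ _ _ _ _ => exists_fresh hC χ)
        (fun x hx => (hmem x).2 fun y hy => h2 y hy x hx) fun i t ht x hx => ?_
      refine (hmem _).2 fun y hy => ?_
      have h := hlie i t x y ((hmem x).1 hx y hy)
      rwa [hy i t (Set.notMem_Iio.2 ht), TensorProduct.tmul_zero, add_zero] at h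
    exact fun x => (hmem x).1 (hV ▸ Submodule.mem_top) y hy
  -- The first factor is now arbitrary, so the term in which the matrix unit acts on it already lies
  -- in `N` and can be subtracted.
  have h4 : ∀ (y : M') (x : M), x ⊗ₜ y ∈ N := by
    let V : Submodule ℂ M' := ⨅ x : M, N.toSubmodule.comap (TensorProduct.mk ℂ M M' x)
    have hmem : ∀ y, y ∈ V ↔ ∀ x : M, x ⊗ₜ y ∈ N := by
      intro y
      simp only [V, Submodule.mem_iInf]
      rfl
    have hV : V = ⊤ := by
      refine eq_top_of_supportedIn_le hM' hd' (fun χ _ _ _ _ => exists_fresh hD χ)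
        (fun y hy => (hmem y).2 (h3 y hy)) fun i t _ y hy => ?_
      refine (hmem _).2 fun x => ?_
      have h := sub_mem (hlie i t x y ((hmem y).1 hy x)) ((hmem y).1 hy ⁅E i t, x⁆)
      rwa [add_sub_cancel_left] at h
    exact fun y => (hmem y).1 (hV ▸ Submodule.mem_top)
  refine eq_top_iff.2 fun t _ => ?_
  clear * - h4
  induction t using TensorProduct.induction_on with
  | zero => exact zero_mem _
  | tmul x y => exact h4 y x
  | add s t hs ht => exact add_mem hs ht

/-- A weight nonzero at `i` and on all of `T` would have degree at least `T.card + 1`. -/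
theorem exists_fresh_of_le_card {T : Finset ℤ} {χ : ℤ →₀ ℕ} (hd : χ.degree ≤ T.card) {i : ℤ}
    (hi : i ∉ T) (h0 : χ i ≠ 0) : ∃ t ∈ T, χ t = 0 := by
  classical
  by_contra! h
  have hsub : insert i T ⊆ χ.support := by
    intro t ht
    rcases Finset.mem_insert.1 ht with rfl | ht
    · exact Finsupp.mem_support_iff.2 h0
    · exact Finsupp.mem_support_iff.2 (h t ht)
  have h1 := Finset.card_le_card hsub
  rw [Finset.card_insert_of_notMem hi] at h1
  have h2 : χ.support.card ≤ χ.degree := by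
    rw [Finset.card_eq_sum_ones, Finsupp.degree_apply]
    exact Finset.sum_le_sum fun t ht => Nat.one_le_iff_ne_zero.2 (Finsupp.mem_support_iff.1 ht)
  omega

end Tensor

end GlInfty

end

/-! ### The theorem -/

theorem theorem4p4 (r n : ℤ) (hrn : r ≤ n) (lam mu : GlInfty.Weight)
    (hlam : lam ∈ GlInfty.Pplus (Finset.Icc r n)) (hmu : mu ∈ GlInfty.Pplus (Finset.Icc r n)) :
    GlInfty.IsCyclicModule GlInfty.gl
      (GlInfty.LInf (Finset.Icc r n) lam ⊗[ℂ] GlInfty.LInf (Finset.Icc r n) mu) ∧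
    ∃ k : ℤ, n ≤ k ∧ ∀ nbar : ℤ, k ≤ nbar →
      (∃ (N : ℕ) (nu : Fin N → GlInfty.Weight),
        (∀ i, nu i ∈ GlInfty.Pplus (Finset.Icc r nbar)) ∧
        (∀ i, LieModule.IsIrreducible ℂ GlInfty.gl (GlInfty.LInf (Finset.Icc r nbar) (nu i))) ∧
        (∀ i, LieModule.IsIrreducible ℂ (GlInfty.glS (Finset.Icc r nbar))
          (GlInfty.LFin (Finset.Icc r nbar) (nu i))) ∧
        GlInfty.InfDecomp (Finset.Icc r n) (Finset.Icc r nbar) lam mu nu ∧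
        GlInfty.FinDecomp (Finset.Icc r nbar) lam mu nu) ∧
      ∀ (I : Type) (nu : I → GlInfty.Weight),
        (∀ i, nu i ∈ GlInfty.Pplus (Finset.Icc r nbar)) →
        (GlInfty.InfDecomp (Finset.Icc r n) (Finset.Icc r nbar) lam mu nu ↔
          GlInfty.FinDecomp (Finset.Icc r nbar) lam mu nu) := by
  have hP := GlInfty.linf_isPolynomial hlam
  have hP' := GlInfty.linf_isPolynomial hmu
  obtain ⟨d, hd⟩ := GlInfty.exists_weightSpan_linf hlam
  obtain ⟨d', hd'⟩ := GlInfty.exists_weightSpan_linf hmu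
  have hirr := GlInfty.linf_isIrreducible hlam
  have hirr' := GlInfty.linf_isIrreducible hmu
  -- The tensor product has total degree `d + d'`, and this `k` makes every larger interval have
  -- more than `d + d'` elements, which is enough for fresh indices.
  refine ⟨GlInfty.isCyclicModule_tensor hP hP' hd hd', max n (r + (d + d' : ℕ)), le_max_left _ _,
    fun nbar hk => ?_⟩
  have hn : n ≤ nbar := (le_max_left _ _).trans hk
  have hr : r + (d + d' : ℕ) ≤ nbar := (le_max_right _ _).trans hk
  have hPt := hP.tensor hP'
  obtain ⟨B⟩ := hPt.nonempty_form
  obtain ⟨θ, hθ, hlie, hrange⟩ := GlInfty.exists_tensor_hom hn hlam hmu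
  have hgen := fun V hV hst => GlInfty.eq_top_of_supportedIn_le hPt
    (GlInfty.weightSpan_tensor hd hd') (T := (Finset.Icc r nbar : Finset ℤ))
    (fun χ hχ i hi h0 => GlInfty.exists_fresh_of_le_card (T := Finset.Icc r nbar)
      (by rw [hχ, Int.card_Icc]; omega) hi h0) (V := V) hV hst
  have hiff : ∀ (I : Type) (nu : I → GlInfty.Weight),
      (∀ i, nu i ∈ GlInfty.Pplus (Finset.Icc r nbar)) →
      (GlInfty.InfDecomp (Finset.Icc r n) (Finset.Icc r nbar) lam mu nu ↔
        GlInfty.FinDecomp (Finset.Icc r nbar) lam mu nu) := by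
    intro I nu hnu
    constructor
    · rintro ⟨e⟩
      exact GlInfty.fin_decomposition_of_inf θ hθ hlie hrange hnu e
    · rintro ⟨e⟩
      exact GlInfty.inf_decomposition_of_fin B
        (fun V hV hst => hgen V hV fun i t _ x hx => hst i t x hx) θ hθ hlie hrange hnu e
  refine ⟨?_, hiff⟩
  have := GlInfty.finiteDimensional_lfin (GlInfty.Pplus_mono hn hlam)
  have := GlInfty.finiteDimensional_lfin (GlInfty.Pplus_mono hn hmu)
  obtain ⟨J, _, f, hf⟩ := hPt
  -- The polynomial embedding of the infinite tensor product restricts along `θ`, so the finite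
  -- tensor product decomposes; `hiff` carries the decomposition over to `𝔤𝔩_∞`.
  obtain ⟨N, nu, hnu, hdec⟩ := GlInfty.exists_decomposition (T := Finset.Icc r nbar)
    (X := GlInfty.LFin (Finset.Icc r nbar) lam ⊗[ℂ] GlInfty.LFin (Finset.Icc r nbar) mu)
    (J := J)
    { (f.toLinearMap.comp θ) with
      map_lie' := fun {a x} => by
        change f (θ ⁅a, x⁆) = ⁅(a : GlInfty.gl), f (θ x)⁆
        rw [hlie, LieModuleHom.map_lie] }
    (hf.comp hθ) (fun x a b hb => by
      have h1 : θ x ∈ GlInfty.supportedIn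
          (GlInfty.LInf (Finset.Icc r n) lam ⊗[ℂ] GlInfty.LInf (Finset.Icc r n) mu)
          (Finset.Icc r nbar : Finset ℤ) := hrange ▸ ⟨x, rfl⟩
      change ⁅GlInfty.E a b, f (θ x)⁆ = 0
      rw [← LieModuleHom.map_lie, h1 a b hb, map_zero])
  exact ⟨N, nu, hnu, fun i => GlInfty.linf_isIrreducible (hnu i),
    fun i => GlInfty.lfin_isIrreducible (hnu i), (hiff _ nu hnu).2 hdec, hdec⟩
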